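/- **Conventions.** A *scale* is a strictly increasing sequence $H=(p_k)_{k\ge1}$ of positive integers with $p_k\mid p_{k+1}$; its *adding machine* is the compact group $G=\varprojlim_k \mathbb Z/p_k\mathbb Z$ with normalized Haar measure $\lambda$, and its *odometer* is $(G,\tau)$ with $\tau(g)=g+(1,1,\dots)$. A factor map $\pi:X\to G$ is *almost 1-1* if $\pi^{-1}(\pi(x))=\{x\}$ for a residual set of $x\in X$. For $x\in\{0,1\}^{\mathbb Z}$ let $\mathrm{Per}_p(x)=\{n: x(n)=x(n+mp)\ \forall m\in\mathbb Z\}$ and $\mathrm{Aper}(x)=\mathbb Z\setminus\bigcup_{p\ge1}\mathrm{Per}_p(x)$; $x$ is a *Toeplitz sequence* if $\mathrm{Aper}(x)=\emptyset$, and a *Toeplitz subshift* is the shift orbit closure of a Toeplitz sequence. A Toeplitz subshift with maximal equicontinuous factor map $\pi:X\to G$ onto an odometer is *regular* if $\{g:\#\pi^{-1}(g)=1\}$ has full measure $\lambda$, and *irregular* otherwise. The *density* of a set $A\subset\mathbb Z$ is $\lim_n\frac1n\#(A\cap[0,n-1])=\lim_n\frac1n\#(A\cap[-n,-1])$, if both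 limits exist and coincide. **Construction.** *Admissible parameters* are integers $q_k,r_k,s_k$ $(k\ge1)$ with $0<r_k<q_k$ and, putting $p_0=Q_0=1$, $p_k=q_1\cdots q_k$, $Q_k=\prod_{i=1}^k(q_i-r_i)$, with $0\le s_k<r_kQ_{k-1}$, such that * $\prod_{k=1}^N(1-r_k/q_k)$ converges, as $N\to\infty$, to a number $d>0$; * for every $k\ge0$ and every $0\le c<Q_k$ there are infinitely many $k'>k$ with $s_{k'}\equiv c \pmod {Q_k}$. Let $B_k$ be the block of length $r_kQ_{k-1}$ with symbol $1$ at index $s_k$ (indices starting at $0$) and $0$ elsewhere. Starting from the empty one-sided sequence, in step $k\ge1$ fill, in increasing order, the $r_kQ_{k-1}$ still unfilled positions in $[0,r_kp_{k-1}-1]$ with the block $B_k$, and repeat this with period $p_k$. Let $X\subset\{0,1\}^{\mathbb Z}$ be the subshift of all two-sided sequences each of whose finite blocks occurs in the resulting one-sided sequence, $T$ the shift on $X$, and $(G,\tau)$ the odometer with scale $(p_k)_{k\ge1}$. **Statement.** Admissible parameters exist, and for all admissible parameters $X$ is an irregular Toeplitz subshift which is strictly ergodic (minimal and uniquely ergodic)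 and isomorphic to its maximal equicontinuous factor $(G,\tau)$, the isomorphism being the topological factor map itself. More precisely: 1. $X$ is a Toeplitz subshift and $(X,T)$ is strictly ergodic; let $\mu$ be its unique invariant probability measure; 2. there is a topological factor map $\pi:(X,T)\to(G,\tau)$ which is almost 1-1, makes $(G,\tau)$ the maximal equicontinuous factor of $(X,T)$, is not regular (i.e. $\{g:\#\pi^{-1}(g)=1\}$ does not have full measure $\lambda$), and is at the same time a measure-theoretic isomorphism from $(X,\mu,T)$ to $(G,\lambda,\tau)$; 3. for every $x\in X$ the densities of $\mathrm{Per}_{p_k}(x)$ exist and $1-\sup_k\mathrm{dens}(\mathrm{Per}_{p_k}(x))=d$. Moreover $X$ has the same aperiodic readouts, with common space $Y$ equal to the set of all $y\in\{0,1\}^{\mathbb Z}$ having at most one symbol $1$: the set $E$ of $g\in G$ such that $\mathrm{Aper}(x)$ has density $d$ for all $x\in\pi^{-1}(g)$ is nonempty, and for every $g\in E$ the set of all sequences $(x(n_i))_{i\in\mathbb Z}$, where $x\in\pi^{-1}(g)$ and $\mathrm{Aper}(x)=\{n_i\}_{i\in\mathbb Z}$ is enumerated increasingly with $n_0$ its least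 nonnegative element, equals $Y$; 4. Sarnak's conjecture holds for $(X,T)$: for every continuous $f:X\to\mathbb C$ and every $x\in X$, $$\lim_{n\to\infty}\frac1n\sum_{i=1}^n f(T^ix)\,\boldsymbol\mu(i)=0,$$ where $\boldsymbol\mu$ is the Möbius function. Finally, the only shift-invariant Borel probability measure on $\{0,1\}^{\mathbb Z}$ supported by $Y$ is the point mass at $0^{\mathbb Z}$. -/

import Mathlib

open MeasureTheory Filter Topology

universe u

noncomputable section

namespace OdometerModel

/-! ### Topological dynamical systems and their invariant measures -/

section Systems

/-- A topological system `(X, T)` is minimal: `X` is nonempty and every (two-sided) orbit is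
dense. -/
def IsMinimalSystem {X : Type*} [TopologicalSpace X] (T : X ≃ₜ X) : Prop :=
  Nonempty X ∧ ∀ x : X, Dense (Set.range fun n : ℤ => (T ^ n) x)

/-- `μ` is a `T`-invariant probability measure. -/
def IsInvariantProbability {X : Type*} [TopologicalSpace X] [MeasurableSpace X]
    (T : X ≃ₜ X) (μ : Measure X) : Prop :=
  IsProbabilityMeasure μ ∧ MeasurePreserving T μ μ

/-- Unique ergodicity: there is exactly one invariant probability measure. -/
def IsUniquelyErgodic {X : Type*} [TopologicalSpace X] [MeasurableSpace X] (T : X ≃ₜ X) : Prop :=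
  ∃! μ : Measure X, IsInvariantProbability T μ

/-- Strict ergodicity: minimality together with unique ergodicity. -/
def IsStrictlyErgodic {X : Type*} [TopologicalSpace X] [MeasurableSpace X] (T : X ≃ₜ X) : Prop :=
  IsMinimalSystem T ∧ IsUniquelyErgodic T

/-- The system `(X, T)` on a compact Hausdorff space is equicontinuous: the powers of `T` form an
equicontinuous family for the unique uniformity of `X`. -/
def IsEquicontinuousSystem {X : Type*} [TopologicalSpace X] [CompactSpace X] [T2Space X]
    (T : X ≃ₜ X) : Prop :=
  letI : UniformSpace X := uniformSpaceOfCompactR1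
  UniformEquicontinuous fun (n : ℤ) (x : X) => (T ^ n) x

/-- `π` is a topological factor map from `(X, T)` onto `(Y, S)`. -/
structure IsFactorMap {X Y : Type*} [TopologicalSpace X] [TopologicalSpace Y]
    (T : X ≃ₜ X) (S : Y ≃ₜ Y) (π : X → Y) : Prop where
  continuous : Continuous π
  surjective : Function.Surjective π
  equivariant : ∀ x, π (T x) = S (π x)

/-- `(Y, S)` is the maximal equicontinuous factor of `(X, T)` by way of the factor map `π`: it is an
equicontinuous factor, and every factor map onto an equicontinuous system factors through `π`. -/
structure IsMaximalEquicontinuousFactor {X Y : Type*} [TopologicalSpace X]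
    [TopologicalSpace Y] [CompactSpace Y] [T2Space Y]
    (T : X ≃ₜ X) (S : Y ≃ₜ Y) (π : X → Y) : Prop where
  isFactorMap : IsFactorMap T S π
  equicontinuous : IsEquicontinuousSystem S
  maximal : ∀ (Z : Type u) [TopologicalSpace Z] [CompactSpace Z] [T2Space Z] (R : Z ≃ₜ Z)
    (φ : X → Z), IsEquicontinuousSystem R → IsFactorMap T R φ →
      ∃ ψ : Y → Z, IsFactorMap S R ψ ∧ φ = ψ ∘ π

/-- `π` is almost 1-1: `π⁻¹(π(x)) = {x}` holds on a residual set of points `x`. -/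
def IsAlmostOneToOne {X Y : Type*} [TopologicalSpace X] (π : X → Y) : Prop :=
  {x : X | π ⁻¹' {π x} = {x}} ∈ residual X

/-- `π` is an isomorphism of the measure spaces `(X, μ)` and `(Y, ν)`: it is measure preserving and
has a measure preserving inverse modulo null sets. -/
def IsMeasureIsomorphism {X Y : Type*} [MeasurableSpace X] [MeasurableSpace Y]
    (μ : Measure X) (ν : Measure Y) (π : X → Y) : Prop :=
  MeasurePreserving π μ ν ∧ ∃ ψ : Y → X, MeasurePreserving ψ ν μ ∧
    (∀ᵐ x ∂μ, ψ (π x) = x) ∧ ∀ᵐ y ∂ν, π (ψ y) = y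

/-- Two complex sequences (indexed by the positive integers) are uncorrelated. -/
def Uncorrelated (ξ η : ℕ → ℂ) : Prop :=
  Tendsto (fun n : ℕ => (1 / (n : ℂ)) * ∑ i ∈ Finset.Icc 1 n, ξ i * (starRingEnd ℂ) (η i))
    atTop (𝓝 0)

/-- The assertion of Sarnak's conjecture for `(X, T)`: every sequence `n ↦ f (T ^ n x)` with `f`
continuous is uncorrelated to the Möbius function. -/
def SarnakConjectureHolds {X : Type*} [TopologicalSpace X] (T : X ≃ₜ X) : Prop :=
  ∀ f : X → ℂ, Continuous f → ∀ x : X,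
    Uncorrelated (fun n => f (T^[n] x)) (fun n => (ArithmeticFunction.moebius n : ℂ))

end Systems

/-! ### Odometers -/

/-- A scale: an increasing sequence of positive integers, each dividing the next one. -/
structure Scale where
  p : ℕ → ℕ
  pos : ∀ k, 0 < p k
  strictMono : StrictMono p
  dvd : ∀ k, p k ∣ p (k + 1)

namespace Scale

/-- The adding machine: the inverse limit of the cyclic groups `ℤ / p k`. -/
def addingMachine (H : Scale) : AddSubgroup (∀ k, ZMod (H.p k)) where
  carrier := {g | ∀ k, ZMod.castHom (H.dvd k) (ZMod (H.p k)) (g (k + 1)) = g k}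
  zero_mem' := fun k => by simp
  add_mem' := fun {a b} ha hb k => by
    have h1 := ha k
    have h2 := hb k
    simp only [Pi.add_apply, map_add, h1, h2]
  neg_mem' := fun {a} ha k => by
    have h1 := ha k
    simp only [Pi.neg_apply, map_neg, h1]

instance (H : Scale) : CompactSpace H.addingMachine := by
  have : ∀ k, NeZero (H.p k) := fun k => ⟨(H.pos k).ne'⟩
  have hc : IsClosed (H.addingMachine : Set (∀ k, ZMod (H.p k))) := by
    have : (H.addingMachine : Set (∀ k, ZMod (H.p k))) =
        ⋂ k, {g | ZMod.castHom (H.dvd k) (ZMod (H.p k)) (g (k + 1)) = g k} := by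
      ext g
      simp [addingMachine]
    rw [this]
    exact isClosed_iInter fun k => isClosed_eq
      ((continuous_of_discreteTopology).comp (continuous_apply (k + 1))) (continuous_apply k)
  exact isCompact_iff_compactSpace.mp hc.isCompact

instance (H : Scale) : BorelSpace H.addingMachine := by
  have : ∀ k, BorelSpace (ZMod (H.p k)) := fun k => ⟨(borel_eq_top_of_discrete).symm⟩
  have : ∀ k, NeZero (H.p k) := fun k => ⟨(H.pos k).ne'⟩
  have : ∀ k, SecondCountableTopology (ZMod (H.p k)) := fun k => inferInstance
  exact Subtype.borelSpace _

/-- The topological generator `(1, 1, …)` of the adding machine. -/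
def one (H : Scale) : H.addingMachine := ⟨fun _ => 1, fun k => map_one (ZMod.castHom (H.dvd k) (ZMod (H.p k)))⟩

/-- The odometer `g ↦ g + (1, 1, …)`. -/
def odometer (H : Scale) : H.addingMachine ≃ₜ H.addingMachine := Homeomorph.addRight H.one

/-- The normalized Haar measure of the adding machine. -/
def haar (H : Scale) : Measure H.addingMachine :=
  Measure.addHaarMeasure (⊤ : TopologicalSpace.PositiveCompacts H.addingMachine)

end Scale

/-! ### Subshifts, Toeplitz sequences and aperiodic readouts -/

/-- Two-sided subshifts over the alphabet `{0, 1}`. -/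
abbrev BinarySubshift := SymbolicDynamics.FullShift.Subshift (Fin 2) ℤ

/-- The shift `x ↦ (n ↦ x (n + 1))` as a self-homeomorphism of a subshift. -/
def shiftHomeo (X : BinarySubshift) : X.carrier ≃ₜ X.carrier where
  toFun x := ⟨SymbolicDynamics.FullShift.shift 1 x.1, X.mapsTo 1 x.2⟩
  invFun x := ⟨SymbolicDynamics.FullShift.shift (-1) x.1, X.mapsTo (-1) x.2⟩
  left_inv x := by ext n; simp
  right_inv x := by ext n; simp
  continuous_toFun := by fun_prop
  continuous_invFun := by fun_prop

/-- The `p`-periodic part of a two-sided sequence. -/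
def periodicPart (p : ℕ) (x : ℤ → Fin 2) : Set ℤ := {n | ∀ m : ℤ, x n = x (n + m * p)}

/-- The aperiodic part of a two-sided sequence. -/
def aperiodicPart (x : ℤ → Fin 2) : Set ℤ := {n | ∀ p : ℕ, 0 < p → n ∉ periodicPart p x}

/-- Toeplitz sequences: every position belongs to some periodic part. -/
def IsToeplitzSequence (x : ℤ → Fin 2) : Prop := ∀ n : ℤ, ∃ p : ℕ, 0 < p ∧ n ∈ periodicPart p x

/-- A Toeplitz subshift is the orbit closure of a Toeplitz sequence. -/
def IsToeplitzSubshift (X : BinarySubshift) : Prop :=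
  ∃ x : ℤ → Fin 2, IsToeplitzSequence x ∧
    X.carrier = closure (Set.range fun n : ℤ => SymbolicDynamics.FullShift.shift n x)

/-- Regularity of an almost 1-1 extension `π : X → G` of an odometer: the points of `G` with exactly
one preimage have full Haar measure. -/
def IsRegularExtension {X : Type*} (H : Scale) (π : X → H.addingMachine) : Prop :=
  ∀ᵐ g ∂H.haar, ∃! x, π x = g

/-- A set of integers has forward density `δ` and backward density `δ`. -/
def HasDensity (A : Set ℤ) (δ : ℝ) : Prop :=
  Tendsto (fun n : ℕ => ((A ∩ Set.Ico (0 : ℤ) n).ncard : ℝ) / n) atTop (𝓝 δ) ∧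
  Tendsto (fun n : ℕ => ((A ∩ Set.Ico (-(n : ℤ)) 0).ncard : ℝ) / n) atTop (𝓝 δ)

/-- `d = 1 - sup_k dens (Per_{p k} (x))`, where these densities exist, for every `x` in `X`. -/
def HasIrregularity (X : BinarySubshift) (H : Scale) (d : ℝ) : Prop :=
  ∀ x ∈ X.carrier, ∃ δ : ℕ → ℝ,
    (∀ k, HasDensity (periodicPart (H.p k) x) (δ k)) ∧ IsLUB (Set.range δ) (1 - d)

/-- `y` is the aperiodic readout of `x`: the aperiodic part of `x` is enumerated increasingly as
`(n i)` with `n 0` its least nonnegative element, and `y i = x (n i)`. -/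
def IsAperiodicReadout (x y : ℤ → Fin 2) : Prop :=
  ∃ n : ℤ → ℤ, StrictMono n ∧ Set.range n = aperiodicPart x ∧ n (-1) < 0 ∧ 0 ≤ n 0 ∧
    ∀ i, y i = x (n i)

/-- The set `E` of those points of the factor over which the aperiodic part has density `d`. -/
def readoutBase {G : Type*} (X : BinarySubshift) (π : X.carrier → G) (d : ℝ) : Set G :=
  {g | ∀ x : X.carrier, π x = g → HasDensity (aperiodicPart x.1) d}

/-- The set `Y_g` of aperiodic readouts of the points in the fibre of `g`. -/
def readouts {G : Type*} (X : BinarySubshift) (π : X.carrier → G) (g : G) : Set (ℤ → Fin 2) :=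
  {y | ∃ x : X.carrier, π x = g ∧ IsAperiodicReadout x.1 y}

/-- Same aperiodic readouts, with `Y` as the common space: `E` is nonempty and `Y_g = Y` for every
`g ∈ E`. -/
def SameAperiodicReadouts {G : Type*} (X : BinarySubshift) (π : X.carrier → G) (d : ℝ)
    (Y : Set (ℤ → Fin 2)) : Prop :=
  (readoutBase X π d).Nonempty ∧ ∀ g ∈ readoutBase X π d, readouts X π g = Y

/-- The two-sided sequences over `{0, 1}` with at most one symbol `1`. -/
def atMostOneOne : Set (ℤ → Fin 2) := {y | ∀ i j, y i = 1 → y j = 1 → i = j}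

/-! ### The construction

Steps are numbered from `0`: step `k` passes from period `period q k` to `period q (k + 1)`. -/

/-- `q 0 * ⋯ * q (k - 1)`, the period of the partially filled sequence after `k` steps. -/
def period (q : ℕ → ℕ) (k : ℕ) : ℕ := ∏ i ∈ Finset.range k, q i

/-- `(q 0 - r 0) * ⋯ * (q (k - 1) - r (k - 1))`, the number of unfilled positions in a period after
`k` steps. -/
def unfilled (q r : ℕ → ℕ) (k : ℕ) : ℕ := ∏ i ∈ Finset.range k, (q i - r i)

/-- The partially filled one-sided sequence after `k` steps (`none` is an unfilled position). In
step `k` the unfilled positions in `[0, r k * period q k)` are filled, in increasing order, with the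
block whose symbol at index `s k` is `1` and whose other symbols are `0`; this is repeated with
period `period q (k + 1)`. -/
def fill (q r s : ℕ → ℕ) : ℕ → ℕ → Option (Fin 2)
  | 0, _ => none
  | k + 1, n =>
    if fill q r s k n = none ∧ n % period q (k + 1) < r k * period q k then
      some (if Nat.count (fun j => fill q r s k j = none) (n % period q (k + 1)) = s k
        then 1 else 0)
    else fill q r s k n

/-- The one-sided sequence obtained after all steps. -/
def limitSequence (q r s : ℕ → ℕ) (n : ℕ) : Fin 2 :=
  open scoped Classical in if ∃ k, fill q r s k n = some 1 then 1 else 0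

/-- The two-sided subshift generated by a one-sided sequence `x`: all two-sided sequences each of
whose finite blocks occurs in `x`. -/
def generatedSubshift (x : ℕ → Fin 2) : BinarySubshift where
  carrier := {z | ∀ (a : ℤ) (n : ℕ), ∃ m : ℕ, ∀ i < n, z (a + i) = x (m + i)}
  isClosed := by
    have : {z : ℤ → Fin 2 | ∀ (a : ℤ) (n : ℕ), ∃ m : ℕ, ∀ i < n, z (a + i) = x (m + i)} =
        ⋂ (a : ℤ) (n : ℕ), (fun (z : ℤ → Fin 2) (i : Fin n) => z (a + (i : ℕ))) ⁻¹'
          {w | ∃ m : ℕ, ∀ i : Fin n, w i = x (m + i)} := by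
      ext z
      simp [Fin.forall_iff]
    rw [this]
    exact isClosed_iInter fun a => isClosed_iInter fun n =>
      (isClosed_discrete _).preimage (by fun_prop)
  mapsTo := fun g z hz a n => by
    obtain ⟨m, hm⟩ := hz (g + a) n
    exact ⟨m, fun i hi => by simpa [add_assoc] using hm i hi⟩

/-- Admissible parameters: integers `0 < r k < q k`, the position `s k` of the symbol `1` in the
`k`-th block (which has length `r k * unfilled q r k`), such that the densities of the unfilled
positions tend to some `d > 0` and, for each `k`, the remainders modulo `unfilled q r k` of the
positions of `1` in the later blocks assume every possible value infinitely many times. -/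
structure Parameters where
  q : ℕ → ℕ
  r : ℕ → ℕ
  s : ℕ → ℕ
  d : ℝ
  r_pos : ∀ k, 0 < r k
  r_lt : ∀ k, r k < q k
  s_lt : ∀ k, s k < r k * unfilled q r k
  d_pos : 0 < d
  tendsto_d : Tendsto (fun N => ∏ k ∈ Finset.range N, (1 - (r k : ℝ) / q k)) atTop (𝓝 d)
  recurrent : ∀ k, ∀ c < unfilled q r k, {j | k ≤ j ∧ s j % unfilled q r k = c}.Infinite

namespace Parameters

/-- The scale `(q 0, q 0 * q 1, …)`. -/
def scale (D : Parameters) : Scale where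
  p k := period D.q (k + 1)
  pos k := Finset.prod_pos fun i _ => (D.r_pos i).trans (D.r_lt i)
  strictMono := strictMono_nat_of_lt_succ fun k => by
    have h0 : 0 < period D.q (k + 1) := Finset.prod_pos fun i _ => (D.r_pos i).trans (D.r_lt i)
    have h1 : 1 < D.q (k + 1) := lt_of_le_of_lt (D.r_pos (k + 1)) (D.r_lt (k + 1))
    have h2 : period D.q (k + 1 + 1) = period D.q (k + 1) * D.q (k + 1) :=
      Finset.prod_range_succ _ _
    rw [h2]
    exact lt_mul_of_one_lt_right h0 h1
  dvd k := ⟨D.q (k + 1), Finset.prod_range_succ _ _⟩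

/-- The subshift generated by the sequence constructed from the parameters. -/
def subshift (D : Parameters) : BinarySubshift := generatedSubshift (limitSequence D.q D.r D.s)

end Parameters

end OdometerModel

end

open OdometerModel

/-!
The points of the subshift `X` are described over the adding machine `G`. A point `g` of `G`
fixes, for each `k`, a position relative to the period `p_k`, and so prescribes the symbols at all
positions that some step of the construction fills (its *skeleton*); the other positions are the
*holes* of `g`. Two facts about the construction carry everything.

* The unfilled positions in an aligned block of length `p_k` are filled at the same later step, by
  consecutive entries of one block with a single symbol `1`. So at most one of them receives a `1`
  (`eq_of_symbol_eq_one`), and this persists in all points of `X`.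
* By the recurrence condition on the positions `s_k`, and since the number of unfilled positions
  per period grows, each class of unfilled positions modulo `p_k` receives both symbols at later
  steps (`exists_symbol_eq_one`, `exists_symbol_eq_zero`).

Hence `X` consists exactly of the sequences that extend the skeleton of some `g` and carry at most
one `1` on its holes (`exists_isPointOver_of_mem`, `IsPointOver.mem_subshift`). The `p_k`-periodic
part of such a sequence is the set of positions filled after `k` steps, which determines `g`
(`Extends.periodicPart_eq`, `Extends.unique`), and the aperiodic part is the set of holes. Sending
a sequence to its `g` is the factor map; it is continuous because its graph is closed.

Points with the same image differ at no more than two positions, so they are asymptotic and have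
equal images in each equicontinuous factor: `G` is the maximal one. Under an invariant measure,
the events that the only `1` on the holes sits at position `n` are disjoint and equally likely,
hence null. So almost every point of `X` has zeros on its holes; such points form a section of the
factor map, which is therefore an isomorphism for the only invariant measure
(`ae_zeroPoint_factor_eq`). The extension is irregular because the set of `g` with hole `0` has
Haar measure at least `d`. The same argument with disjoint events shows that the point mass at
zero is the only invariant measure on the sequences with at most one `1`.

If the holes of `g` have density `d > 0`, they are unbounded in both directions and can be
enumerated by the integers; the description of the fibre says that the readouts are all the
sequences with at most one `1`. A point `g` of this kind is obtained by staying in the middle of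
the blocks of each level, so that a window of length `n` around the origin meets the positions
filled at step `k` in a proportion of order `r_k / q_k` only, which is summable
(`hasDensity_holes_middlePoint`).

For Sarnak's conjecture, fill all positions left open after `k` steps with zeros. This changes a
point of `X` on a set of upper density at most `1 / p_k`, so the values of a continuous function
along an orbit are approximated in mean by periodic sequences. The Möbius function is orthogonal
to periodic sequences: with Dirichlet characters this amounts to the mean value zero of `μ χ`,
which follows from the non-vanishing of `L(s, χ)` on the line of real part one by a Tauberian
theorem (`tendsto_zero_of_laplace`).
-/

/-! ### A Tauberian theorem -/

namespace MoebiusCorrelation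
open scoped FourierTransform SchwartzMap

section Tauberian

variable {F : ℝ → ℂ} {H : ℂ → ℂ} {C : ℝ}

/-- The Laplace transform of a bounded function converges in the open right half-plane. -/
lemma integrable_mul_exp_neg (hF : Measurable F) (hC : ∀ u, ‖F u‖ ≤ C)
    (h0 : ∀ u < 0, F u = 0) {σ : ℝ} (hσ : 0 < σ) :
    Integrable fun u : ℝ => F u * (Real.exp (-σ * u) : ℂ) := by
  have h1 : Integrable (Set.indicator (Set.Ici (0 : ℝ)) fun u : ℝ => (Real.exp (-σ * u) : ℂ)) := by
    rw [integrable_indicator_iff measurableSet_Ici, integrableOn_Ici_iff_integrableOn_Ioi]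
    exact (exp_neg_integrableOn_Ioi 0 hσ).ofReal
  refine (h1.bdd_mul (c := C) hF.aestronglyMeasurable (ae_of_all _ hC)).congr
    (ae_of_all _ fun u => ?_)
  rcases lt_or_ge u 0 with hu | hu
  · simp [h0 u hu]
  · simp [Set.indicator_of_mem (Set.mem_Ici.2 hu)]

/-- Pairing a damped bounded function with an inverse Fourier transform amounts to pairing its
Laplace transform on a vertical line with the original function. -/
lemma integral_mul_exp_mul_fourierInv (hF : Measurable F) (hC : ∀ u, ‖F u‖ ≤ C)
    (h0 : ∀ u < 0, F u = 0)
    (hH : ∀ z : ℂ, 0 < z.re → ∫ u : ℝ, F u * Complex.exp (-z * u) = H z)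
    (ψ : 𝓢(ℝ, ℂ)) {σ : ℝ} (hσ : 0 < σ) (T : ℝ) :
    ∫ u : ℝ, F u * (Real.exp (-σ * u) : ℂ) * 𝓕⁻ (ψ : ℝ → ℂ) (T - u) =
      ∫ ξ : ℝ, ψ ξ * H (σ + 2 * Real.pi * ξ * Complex.I) *
        Complex.exp (2 * Real.pi * T * ξ * Complex.I) := by
  have hint := integrable_mul_exp_neg hF hC h0 hσ
  have key : Integrable (Function.uncurry fun (u ξ : ℝ) =>
      F u * (Real.exp (-σ * u) : ℂ) *
        (Complex.exp (2 * Real.pi * (ξ * (T - u)) * Complex.I) * ψ ξ)) (volume.prod volume) := by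
    have h1 := hint.mul_prod (ψ.integrable (μ := volume))
    have h2 := h1.bdd_mul (c := 1)
      (f := fun p : ℝ × ℝ => Complex.exp (2 * Real.pi * (p.2 * (T - p.1)) * Complex.I))
      (by fun_prop) (ae_of_all _ fun p => by
        rw [show (2 * Real.pi * (p.2 * (T - p.1)) * Complex.I : ℂ)
          = ((2 * Real.pi * (p.2 * (T - p.1)) : ℝ) : ℂ) * Complex.I by push_cast; ring,
          Complex.norm_exp_ofReal_mul_I])
    refine h2.congr (ae_of_all _ fun p => ?_)
    simp only [Function.uncurry]
    ring
  calc ∫ u : ℝ, F u * (Real.exp (-σ * u) : ℂ) * 𝓕⁻ (ψ : ℝ → ℂ) (T - u)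
      = ∫ u : ℝ, ∫ ξ : ℝ, F u * (Real.exp (-σ * u) : ℂ) *
          (Complex.exp (2 * Real.pi * (ξ * (T - u)) * Complex.I) * ψ ξ) := by
        refine integral_congr_ae (ae_of_all _ fun u => ?_)
        simp only
        rw [Real.fourierInv_eq', ← integral_const_mul]
        refine integral_congr_ae (ae_of_all _ fun ξ => ?_)
        simp only [smul_eq_mul]
        congr 3
        simp
        ring
    _ = ∫ ξ : ℝ, ∫ u : ℝ, F u * (Real.exp (-σ * u) : ℂ) *
          (Complex.exp (2 * Real.pi * (ξ * (T - u)) * Complex.I) * ψ ξ) :=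
        integral_integral_swap key
    _ = _ := by
        refine integral_congr_ae (ae_of_all _ fun ξ => ?_)
        simp only
        rw [← hH _ (by simpa using hσ), ← integral_const_mul, ← integral_mul_const]
        refine integral_congr_ae (ae_of_all _ fun u => ?_)
        simp only
        have : Complex.exp (2 * Real.pi * (ξ * (T - u)) * Complex.I) * (Real.exp (-σ * u) : ℂ)
            = Complex.exp (-(σ + 2 * Real.pi * ξ * Complex.I) * u) *
              Complex.exp (2 * Real.pi * T * ξ * Complex.I) := by
          rw [Complex.ofReal_exp, ← Complex.exp_add, ← Complex.exp_add]
          congr 1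
          push_cast
          ring
        linear_combination F u * ψ ξ * this

/-- If the Laplace transform of a bounded function extends continuously to the closed right
half-plane, then the function is small at infinity on average, with respect to every weight
whose Fourier transform has compact support. -/
theorem tendsto_integral_mul_fourierInv (hF : Measurable F) (hC : ∀ u, ‖F u‖ ≤ C)
    (h0 : ∀ u < 0, F u = 0) (hHc : ContinuousOn H {z | 0 ≤ z.re})
    (hH : ∀ z : ℂ, 0 < z.re → ∫ u : ℝ, F u * Complex.exp (-z * u) = H z)
    (ψ : 𝓢(ℝ, ℂ)) (hψ : HasCompactSupport ψ) :
    Tendsto (fun T : ℝ => ∫ u : ℝ, F u * 𝓕⁻ (ψ : ℝ → ℂ) (T - u)) atTop (𝓝 0) := by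
  have hφ : Integrable (𝓕⁻ (ψ : ℝ → ℂ)) := by
    rw [← SchwartzMap.fourierInv_coe]; exact (𝓕⁻ ψ).integrable
  have hC0 : 0 ≤ C := (norm_nonneg _).trans (hC 0)
  have hlim : ∀ T : ℝ, ∫ u : ℝ, F u * 𝓕⁻ (ψ : ℝ → ℂ) (T - u) =
      ∫ ξ : ℝ, ψ ξ * H (2 * Real.pi * ξ * Complex.I) *
        Complex.exp (2 * Real.pi * T * ξ * Complex.I) := by
    intro T
    have hexp1 : ∀ ξ : ℝ, ‖Complex.exp (2 * Real.pi * T * ξ * Complex.I)‖ = 1 := fun ξ => by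
      rw [show (2 * Real.pi * T * ξ * Complex.I : ℂ)
          = ((2 * Real.pi * T * ξ : ℝ) : ℂ) * Complex.I by push_cast; ring,
          Complex.norm_exp_ofReal_mul_I]
    have hL : Tendsto (fun σ : ℝ => ∫ u : ℝ, F u * (Real.exp (-σ * u) : ℂ) *
        𝓕⁻ (ψ : ℝ → ℂ) (T - u)) (𝓝[>] 0) (𝓝 (∫ u : ℝ, F u * 𝓕⁻ (ψ : ℝ → ℂ) (T - u))) := by
      refine tendsto_integral_filter_of_dominated_convergence
        (fun u => C * ‖𝓕⁻ (ψ : ℝ → ℂ) (T - u)‖) ?_ ?_ ?_ ?_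
      · refine Eventually.of_forall fun σ => ?_
        exact (by fun_prop : AEStronglyMeasurable (fun u : ℝ => F u * (Real.exp (-σ * u) : ℂ))
          volume).mul (hφ.comp_sub_left T).aestronglyMeasurable
      · filter_upwards [self_mem_nhdsWithin] with σ hσ
        refine ae_of_all _ fun u => ?_
        rw [norm_mul, norm_mul]
        refine mul_le_mul_of_nonneg_right ?_ (norm_nonneg _)
        rcases lt_or_ge u 0 with hu | hu
        · simp [h0 u hu, hC0]
        · have : ‖(Real.exp (-σ * u) : ℂ)‖ ≤ 1 := by
            rw [Complex.norm_real, Real.norm_eq_abs, Real.abs_exp, Real.exp_le_one_iff]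
            have : 0 ≤ σ * u := mul_nonneg (le_of_lt hσ) hu
            linarith
          calc ‖F u‖ * ‖(Real.exp (-σ * u) : ℂ)‖ ≤ C * 1 :=
                mul_le_mul (hC u) this (norm_nonneg _) hC0
            _ = C := mul_one C
      · exact (hφ.comp_sub_left T).norm.const_mul C
      · refine ae_of_all _ fun u => ?_
        have : Tendsto (fun σ : ℝ => F u * (Real.exp (-σ * u) : ℂ) * 𝓕⁻ (ψ : ℝ → ℂ) (T - u))
            (𝓝 0) (𝓝 (F u * (Real.exp (-0 * u) : ℂ) * 𝓕⁻ (ψ : ℝ → ℂ) (T - u))) := by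
          apply Continuous.tendsto (f := fun σ : ℝ => F u * (Real.exp (-σ * u) : ℂ) *
            𝓕⁻ (ψ : ℝ → ℂ) (T - u))
          fun_prop
        simpa using this.mono_left nhdsWithin_le_nhds
    obtain ⟨B, hB⟩ : ∃ B : ℝ, ∀ p ∈ Set.Icc (0 : ℝ) 1 ×ˢ tsupport ψ,
        ‖H (p.1 + 2 * Real.pi * p.2 * Complex.I)‖ ≤ B := by
      refine (isCompact_Icc.prod hψ).exists_bound_of_continuousOn (hHc.comp ?_ ?_)
      · fun_prop
      · rintro ⟨a, b⟩ ⟨ha, -⟩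
        simpa using ha.1
    have hcont : ∀ σ : ℝ, 0 ≤ σ →
        Continuous fun ξ : ℝ => H (σ + 2 * Real.pi * ξ * Complex.I) := fun σ hσ => by
      rw [← continuousOn_univ]
      exact hHc.comp (by fun_prop) fun ξ _ => by simpa using hσ
    have hR : Tendsto (fun σ : ℝ => ∫ ξ : ℝ, ψ ξ * H (σ + 2 * Real.pi * ξ * Complex.I) *
        Complex.exp (2 * Real.pi * T * ξ * Complex.I)) (𝓝[>] 0)
        (𝓝 (∫ ξ : ℝ, ψ ξ * H (2 * Real.pi * ξ * Complex.I) *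
        Complex.exp (2 * Real.pi * T * ξ * Complex.I))) := by
      refine tendsto_integral_filter_of_dominated_convergence (fun ξ => B * ‖ψ ξ‖) ?_ ?_ ?_ ?_
      · filter_upwards [self_mem_nhdsWithin] with σ hσ
        have := hcont σ (le_of_lt hσ)
        exact ((ψ.continuous.mul this).mul (by fun_prop)).aestronglyMeasurable
      · filter_upwards [self_mem_nhdsWithin, Ioo_mem_nhdsGT (zero_lt_one' ℝ)] with σ hσ hσ1
        refine ae_of_all _ fun ξ => ?_
        rw [norm_mul, norm_mul, hexp1, mul_one, mul_comm]
        by_cases hξ : ξ ∈ tsupport ψ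
        · exact mul_le_mul_of_nonneg_right (hB (σ, ξ) ⟨⟨hσ1.1.le, hσ1.2.le⟩, hξ⟩) (norm_nonneg _)
        · simp [image_eq_zero_of_notMem_tsupport hξ]
      · exact ψ.integrable.norm.const_mul B
      · refine ae_of_all _ fun ξ => ?_
        refine Tendsto.mul (Tendsto.mul tendsto_const_nhds ?_) tendsto_const_nhds
        have h1 : ContinuousWithinAt (fun σ : ℝ => H (σ + 2 * Real.pi * ξ * Complex.I))
            (Set.Ici 0) 0 :=
          (hHc.comp (s := Set.Ici (0 : ℝ)) (f := fun σ : ℝ => (σ + 2 * Real.pi * ξ * Complex.I : ℂ))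
            (by fun_prop) fun σ hσ => by simpa using hσ) 0 Set.self_mem_Ici
        have h2 := h1.tendsto.mono_left (nhdsWithin_mono _ Set.Ioi_subset_Ici_self)
        simpa using h2
    refine tendsto_nhds_unique hL (hR.congr' ?_)
    filter_upwards [self_mem_nhdsWithin] with σ hσ
    exact (integral_mul_exp_mul_fourierInv hF hC h0 hH ψ hσ T).symm
  have hRL := (Real.zero_at_infty_fourier
    (fun ξ : ℝ => ψ ξ * H (2 * Real.pi * ξ * Complex.I))).comp
    (tendsto_neg_atTop_atBot.mono_right atBot_le_cocompact)
  refine hRL.congr fun T => ?_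
  rw [hlim, Function.comp_apply, Real.fourier_real_eq_integral_exp_smul]
  refine integral_congr_ae (ae_of_all _ fun ξ => ?_)
  simp only [smul_eq_mul]
  rw [mul_comm]
  congr 2
  push_cast
  ring

/-- There is a weight of total mass one whose Fourier transform has compact support. -/
lemma exists_hasCompactSupport_integral_fourierInv_eq_one :
    ∃ ψ : 𝓢(ℝ, ℂ), HasCompactSupport ψ ∧ ∫ v : ℝ, 𝓕⁻ (ψ : ℝ → ℂ) v = 1 := by
  let b : ContDiffBump (0 : ℝ) := ⟨1, 2, one_pos, one_lt_two⟩
  have hb : HasCompactSupport fun ξ : ℝ => (b ξ : ℂ) :=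
    b.hasCompactSupport.comp_left (g := fun t : ℝ => (t : ℂ)) Complex.ofReal_zero
  have hs : ContDiff ℝ (⊤ : ℕ∞) fun ξ : ℝ => (b ξ : ℂ) :=
    Complex.ofRealCLM.contDiff.comp b.contDiff
  refine ⟨hb.toSchwartzMap hs, hb, ?_⟩
  have h1 := congrArg (fun f : 𝓢(ℝ, ℂ) => f 0)
    (FourierTransform.fourier_fourierInv_eq (E := 𝓢(ℝ, ℂ)) (F := 𝓢(ℝ, ℂ)) (hb.toSchwartzMap hs))
  have h2 : (hb.toSchwartzMap hs) 0 = 1 := by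
    change (b 0 : ℂ) = 1
    rw [b.one_of_mem_closedBall (by simp [b])]
    simp
  rw [h2] at h1
  rw [← h1]
  simp only [SchwartzMap.fourier_coe, SchwartzMap.fourierInv_coe]
  rw [Real.fourier_real_eq]
  simp

/-- **Tauberian theorem.** A bounded, slowly oscillating function whose Laplace transform extends
continuously to the closed right half-plane tends to zero. -/
theorem tendsto_zero_of_laplace (hF : Measurable F) (hC : ∀ u, ‖F u‖ ≤ C)
    (h0 : ∀ u < 0, F u = 0) (hHc : ContinuousOn H {z | 0 ≤ z.re})
    (hH : ∀ z : ℂ, 0 < z.re → ∫ u : ℝ, F u * Complex.exp (-z * u) = H z)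
    (hosc : ∀ ε > 0, ∃ δ > 0, ∃ U : ℝ, ∀ u ≥ U, ∀ w, |w - u| ≤ δ → ‖F u - F w‖ ≤ ε) :
    Tendsto F atTop (𝓝 0) := by
  obtain ⟨ψ, hψ, hψ1⟩ := exists_hasCompactSupport_integral_fourierInv_eq_one
  set φ : ℝ → ℂ := 𝓕⁻ (ψ : ℝ → ℂ) with hφdef
  have hφ : Integrable φ := by
    rw [hφdef, ← SchwartzMap.fourierInv_coe]; exact (𝓕⁻ ψ).integrable
  have hC0 : 0 ≤ C := (norm_nonneg _).trans (hC 0)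
  set A := ∫ v, ‖φ v‖
  have hA : 0 ≤ A := integral_nonneg fun _ => norm_nonneg _
  rw [Metric.tendsto_atTop]
  intro ε hε
  set η := ε / (2 * (A + 2 * C + 1)) with hη
  have hη0 : 0 < η := by positivity
  obtain ⟨δ, hδ, U, hU⟩ := hosc η hη0
  -- the weight is concentrated on a bounded interval up to `η`
  obtain ⟨R, hR⟩ : ∃ R : ℕ, ∫ v in {v : ℝ | (R : ℝ) < |v|}, ‖φ v‖ < η := by
    have h := tendsto_setIntegral_of_antitone (μ := volume) (f := fun v => ‖φ v‖)
      (s := fun n : ℕ => {v : ℝ | (n : ℝ) < |v|})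
      (fun n => measurableSet_lt measurable_const measurable_id.abs)
      (fun m n hmn v (hv : (n : ℝ) < |v|) =>
        show (m : ℝ) < |v| from lt_of_le_of_lt (Nat.cast_le.2 hmn) hv) ⟨0, hφ.norm.integrableOn⟩
    have he : (⋂ n : ℕ, {v : ℝ | (n : ℝ) < |v|}) = ∅ := by
      ext v
      simp only [Set.mem_iInter, Set.mem_ofPred_eq, Set.mem_empty_iff_false, iff_false, not_forall,
        not_lt]
      exact exists_nat_ge _
    rw [he, Measure.restrict_empty, integral_zero_measure] at h
    exact (h.eventually (gt_mem_nhds hη0)).exists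
  set l : ℝ := (R + 1) / δ with hl
  have hl0 : 0 < l := by positivity
  have hRl : R / l ≤ δ := by
    rw [hl, div_div_eq_mul_div, div_le_iff₀ (by positivity)]
    nlinarith
  -- rescaling concentrates the weight near the origin
  have hT1 := tendsto_integral_mul_fourierInv (F := fun u => F (u / l))
    (H := fun z => l * H (l * z)) (C := C) (by fun_prop) (fun u => hC _)
    (fun u hu => h0 _ (div_neg_of_neg_of_pos hu hl0))
    (by
      refine continuousOn_const.mul (hHc.comp (by fun_prop) fun z hz => ?_)
      simpa using mul_nonneg hl0.le hz)
    (by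
      intro z hz
      rw [← hH (l * z) (by simpa using mul_pos hl0 hz)]
      have := Measure.integral_comp_div (fun w : ℝ => F w * Complex.exp (-(l * z) * w)) l
      rw [abs_of_pos hl0, Complex.real_smul] at this
      rw [← this]
      refine integral_congr_ae (ae_of_all _ fun u => ?_)
      have : (l : ℂ) ≠ 0 := by exact_mod_cast hl0.ne'
      simp only
      congr 2
      push_cast
      field_simp) ψ hψ
  have hT2 := (hT1.comp (tendsto_id.const_mul_atTop hl0)).norm
  rw [norm_zero] at hT2
  obtain ⟨V, hV⟩ := (hT2.eventually (gt_mem_nhds hη0)).exists_forall_of_atTop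
  refine ⟨max U V, fun T hT => ?_⟩
  have hTU : U ≤ T := (le_max_left _ _).trans hT
  have h1 := hV T ((le_max_right _ _).trans hT)
  simp only [Function.comp_apply, id_eq] at h1
  rw [← integral_sub_left_eq_self _ volume (l * T)] at h1
  simp only [sub_sub_cancel] at h1
  have hTl : ∀ v : ℝ, (l * T - v) / l = T - v / l := fun v => by field_simp
  simp only [hTl] at h1
  have hFint : Integrable fun v : ℝ => F (T - v / l) * φ v :=
    hφ.bdd_mul (c := C) (hF.comp (by fun_prop)).aestronglyMeasurable (ae_of_all _ fun v => hC _)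
  have h2 : F T - ∫ v : ℝ, F (T - v / l) * φ v = ∫ v : ℝ, (F T - F (T - v / l)) * φ v := by
    have : F T = ∫ v : ℝ, F T * φ v := by rw [integral_const_mul, hψ1, mul_one]
    conv_lhs => rw [this]
    rw [← integral_sub (hφ.const_mul _) hFint]
    refine integral_congr_ae (ae_of_all _ fun v => ?_)
    simp only
    ring
  have hset : MeasurableSet {v : ℝ | (R : ℝ) < |v|} :=
    measurableSet_lt measurable_const measurable_id.abs
  have h3 : ‖F T - ∫ v : ℝ, F (T - v / l) * φ v‖ ≤ η * A + 2 * C * η := by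
    rw [h2]
    have hbd : Integrable fun v : ℝ => η * ‖φ v‖ +
        Set.indicator {v : ℝ | (R : ℝ) < |v|} (fun v => 2 * C * ‖φ v‖) v :=
      (hφ.norm.const_mul _).add ((hφ.norm.const_mul _).indicator hset)
    refine (norm_integral_le_of_norm_le hbd (ae_of_all _ fun v => ?_)).trans ?_
    · rw [norm_mul]
      by_cases hv : (R : ℝ) < |v|
      · rw [Set.indicator_of_mem (by exact hv)]
        have : ‖F T - F (T - v / l)‖ ≤ 2 * C :=
          (norm_sub_le _ _).trans (by linarith [hC T, hC (T - v / l)])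
        nlinarith [norm_nonneg (φ v)]
      · rw [Set.indicator_of_notMem (by exact hv), add_zero]
        refine mul_le_mul_of_nonneg_right (hU T hTU _ ?_) (norm_nonneg _)
        rw [sub_sub_cancel_left, abs_neg, abs_div, abs_of_pos hl0]
        exact (div_le_div_of_nonneg_right (not_lt.1 hv) hl0.le).trans hRl
    · rw [integral_add (hφ.norm.const_mul _) ((hφ.norm.const_mul _).indicator hset),
        integral_const_mul, integral_indicator hset, integral_const_mul]
      have := mul_le_mul_of_nonneg_left hR.le (by positivity : 0 ≤ 2 * C)
      linarith
  rw [dist_zero_right]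
  have h4 : ‖F T‖ ≤ η * A + 2 * C * η + η := by
    calc ‖F T‖ = ‖(F T - ∫ v : ℝ, F (T - v / l) * φ v) + ∫ v : ℝ, F (T - v / l) * φ v‖ := by
          rw [sub_add_cancel]
      _ ≤ _ := (norm_add_le _ _).trans (add_le_add h3 h1.le)
  have h5 : η * A + 2 * C * η + η = ε / 2 := by
    rw [hη]
    field_simp
  linarith

end Tauberian

/-! ### Mean values of bounded arithmetic functions -/

section PartialSums

variable {a : ℕ → ℂ}

lemma norm_sum_Icc_sub_le (ha : ∀ n, ‖a n‖ ≤ 1) (m n : ℕ) :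
    ‖∑ k ∈ Finset.Icc 1 m, a k - ∑ k ∈ Finset.Icc 1 n, a k‖ ≤ |(m : ℝ) - n| := by
  have key : ∀ m n : ℕ, m ≤ n →
      ‖∑ k ∈ Finset.Icc 1 n, a k - ∑ k ∈ Finset.Icc 1 m, a k‖ ≤ (n : ℝ) - m := by
    intro m n h
    induction n, h using Nat.le_induction with
    | base => simp
    | succ n hn ih =>
      rw [Finset.sum_Icc_succ_top (by lia), add_sub_right_comm]
      refine (norm_add_le _ _).trans ?_
      push_cast
      linarith [ha (n + 1)]
  rcases le_total m n with h | h
  · rw [norm_sub_rev, abs_sub_comm, abs_of_nonneg (sub_nonneg.2 (Nat.cast_le.2 h))]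
    exact key m n h
  · rw [abs_of_nonneg (sub_nonneg.2 (Nat.cast_le.2 h))]
    exact key n m h

lemma norm_sum_Icc_le (ha : ∀ n, ‖a n‖ ≤ 1) (n : ℕ) : ‖∑ k ∈ Finset.Icc 1 n, a k‖ ≤ n := by
  simpa using norm_sum_Icc_sub_le ha n 0

lemma abs_natFloor_sub_natFloor_le {x y : ℝ} (hx : 0 ≤ x) (hy : 0 ≤ y) :
    |(⌊x⌋₊ : ℝ) - ⌊y⌋₊| ≤ |x - y| + 1 := by
  have h1 := Nat.floor_le hx
  have h2 := Nat.floor_le hy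
  have h3 := Nat.lt_floor_add_one x
  have h4 := Nat.lt_floor_add_one y
  rw [abs_le]
  constructor
  · linarith [neg_abs_le (x - y)]
  · linarith [le_abs_self (x - y)]

/-- The Laplace transform of the normalized partial sums, in logarithmic scale, is
`L(1 + z) / (1 + z)`. -/
lemma integral_normalized_partial_sums (ha : ∀ n, ‖a n‖ ≤ 1) {z : ℂ} (hz : 0 < z.re) :
    ∫ u : ℝ, (∑ k ∈ Finset.Icc 1 ⌊Real.exp u⌋₊, a k) * (Real.exp (-u) : ℂ) * Complex.exp (-z * u) =
      LSeries a (1 + z) / (1 + z) := by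
  have hre : (1 : ℝ) < (1 + z).re := by simpa using hz
  have hz1 : (1 + z) ≠ 0 := fun h => by rw [h, Complex.zero_re] at hre; linarith
  have hO : (fun n : ℕ ↦ ∑ k ∈ Finset.Icc 1 n, ‖a k‖) =O[atTop] fun n ↦ (n : ℝ) ^ (1 : ℝ) := by
    refine Asymptotics.isBigO_of_le _ fun n => ?_
    rw [Real.rpow_one, Real.norm_of_nonneg (Finset.sum_nonneg fun _ _ => norm_nonneg _),
      Real.norm_natCast]
    calc ∑ k ∈ Finset.Icc 1 n, ‖a k‖ ≤ ∑ k ∈ Finset.Icc 1 n, (1 : ℝ) :=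
          Finset.sum_le_sum fun k _ => ha k
      _ = n := by simp
  rw [LSeries_eq_mul_integral' a zero_le_one hre hO, mul_div_cancel_left₀ _ hz1]
  have himg : Real.exp '' Set.Ioi 0 = Set.Ioi 1 := by
    ext y
    constructor
    · rintro ⟨x, hx, rfl⟩
      exact Real.one_lt_exp_iff.2 hx
    · intro hy
      have hy : 1 < y := hy
      exact ⟨Real.log y, Real.log_pos hy, Real.exp_log (by linarith)⟩
  rw [← himg, integral_image_eq_integral_abs_deriv_smul measurableSet_Ioi
    (fun x _ => (Real.hasDerivAt_exp x).hasDerivWithinAt) Real.exp_injective.injOn,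
    ← integral_indicator measurableSet_Ioi]
  have h0 : ∀ᵐ u : ℝ, u ≠ 0 := Measure.ae_ne volume 0
  refine integral_congr_ae (h0.mono fun u hu0 => ?_)
  simp only
  rcases lt_or_gt_of_ne hu0 with hu | hu
  · rw [Set.indicator_of_notMem (by simpa using hu.le),
      Nat.floor_eq_zero.2 (Real.exp_lt_one_iff.2 hu)]
    simp
  · rw [Set.indicator_of_mem (by exact hu), Real.abs_exp, Complex.real_smul,
      Complex.cpow_def_of_ne_zero (by exact_mod_cast (Real.exp_pos u).ne'),
      ← Complex.ofReal_log (Real.exp_pos u).le, Real.log_exp, Complex.ofReal_exp,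
      Complex.ofReal_exp, mul_left_comm, ← Complex.exp_add, mul_assoc, ← Complex.exp_add]
    congr 2
    push_cast
    ring

/-- A bounded arithmetic function whose Dirichlet series extends continuously to the closed
half-plane of real part at least one has mean value zero. -/
theorem tendsto_mean_zero_of_LSeries (ha : ∀ n, ‖a n‖ ≤ 1) {H : ℂ → ℂ}
    (hHc : ContinuousOn H {s | 1 ≤ s.re}) (hH : ∀ s : ℂ, 1 < s.re → LSeries a s = H s) :
    Tendsto (fun N : ℕ => (1 / (N : ℂ)) * ∑ k ∈ Finset.Icc 1 N, a k) atTop (𝓝 0) := by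
  have hM : ∀ u : ℝ, ‖∑ k ∈ Finset.Icc 1 ⌊Real.exp u⌋₊, a k‖ ≤ Real.exp u := fun u =>
    (norm_sum_Icc_le ha _).trans (Nat.floor_le (Real.exp_pos u).le)
  have hexp : ∀ u : ℝ, ‖(Real.exp (-u) : ℂ)‖ = Real.exp (-u) := fun u => by
    rw [Complex.norm_real, Real.norm_eq_abs, Real.abs_exp]
  have key := tendsto_zero_of_laplace (C := 1) (H := fun z => H (1 + z) / (1 + z))
    (F := fun u : ℝ => (∑ k ∈ Finset.Icc 1 ⌊Real.exp u⌋₊, a k) * (Real.exp (-u) : ℂ))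
    ?_ ?_ ?_ ?_ ?_ ?_
  · have hlog : Tendsto (fun N : ℕ => Real.log N) atTop atTop :=
      Real.tendsto_log_atTop.comp tendsto_natCast_atTop_atTop
    refine (key.comp hlog).congr' ?_
    filter_upwards [eventually_gt_atTop 0] with N hN
    have hN' : (0 : ℝ) < N := Nat.cast_pos.2 hN
    simp only [Function.comp_apply]
    rw [Real.exp_log hN', Nat.floor_natCast, Real.exp_neg, Real.exp_log hN', mul_comm]
    simp
  · refine Measurable.mul ?_ (by fun_prop)
    exact (measurable_from_nat (f := fun n : ℕ => ∑ k ∈ Finset.Icc 1 n, a k)).comp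
      (Nat.measurable_floor.comp Real.measurable_exp)
  · intro u
    rw [norm_mul, hexp]
    calc _ ≤ Real.exp u * Real.exp (-u) := mul_le_mul_of_nonneg_right (hM u) (Real.exp_pos _).le
      _ = 1 := by rw [← Real.exp_add, add_neg_cancel, Real.exp_zero]
  · intro u hu
    rw [Nat.floor_eq_zero.2 (Real.exp_lt_one_iff.2 hu)]
    simp
  · refine ContinuousOn.div (hHc.comp (by fun_prop) fun z hz => ?_) (by fun_prop) fun z hz h => ?_
    · have hz : 0 ≤ z.re := hz
      simpa using hz
    · have hz : 0 ≤ z.re := hz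
      have := congrArg Complex.re h
      simp only [Complex.add_re, Complex.one_re, Complex.zero_re] at this
      linarith
  · intro z hz
    rw [integral_normalized_partial_sums ha hz, hH _ (by simpa using hz)]
  · intro ε hε
    refine ⟨min 1 (ε / 8), by positivity, -Real.log (ε / 2), fun u hu w hw => ?_⟩
    have h1 : Real.exp (-u) ≤ ε / 2 := by
      rw [← Real.exp_log (by positivity : 0 < ε / 2)]
      exact Real.exp_le_exp.2 (by linarith)
    have h2 : |Real.exp (w - u) - 1| ≤ ε / 4 :=
      (Real.abs_exp_sub_one_le (hw.trans (min_le_left _ _))).trans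
        (by linarith [hw.trans (min_le_right 1 (ε / 8))])
    have h3 : Real.exp (w - u) = Real.exp w * Real.exp (-u) := by
      rw [sub_eq_add_neg, Real.exp_add]
    have huu : Real.exp u * Real.exp (-u) = 1 := by
      rw [← Real.exp_add, add_neg_cancel, Real.exp_zero]
    have hww : Real.exp w * Real.exp (-w) = 1 := by
      rw [← Real.exp_add, add_neg_cancel, Real.exp_zero]
    have h4 : |Real.exp u - Real.exp w| * Real.exp (-u) ≤ ε / 4 := by
      rw [← abs_of_pos (Real.exp_pos (-u)), ← abs_mul, sub_mul,
        huu, ← h3, abs_sub_comm]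
      exact h2
    have h5 : Real.exp w * |Real.exp (-u) - Real.exp (-w)| ≤ ε / 4 := by
      rw [← abs_of_pos (Real.exp_pos w), ← abs_mul, mul_sub,
        hww, ← h3]
      exact h2
    set Mu := ∑ k ∈ Finset.Icc 1 ⌊Real.exp u⌋₊, a k
    set Mw := ∑ k ∈ Finset.Icc 1 ⌊Real.exp w⌋₊, a k
    have h6 : ‖Mu - Mw‖ ≤ |Real.exp u - Real.exp w| + 1 :=
      (norm_sum_Icc_sub_le ha _ _).trans
        (abs_natFloor_sub_natFloor_le (Real.exp_pos _).le (Real.exp_pos _).le)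
    calc ‖Mu * (Real.exp (-u) : ℂ) - Mw * (Real.exp (-w) : ℂ)‖
        = ‖(Mu - Mw) * (Real.exp (-u) : ℂ) + Mw * ((Real.exp (-u) - Real.exp (-w) : ℝ) : ℂ)‖ := by
          congr 1
          push_cast
          ring
      _ ≤ (|Real.exp u - Real.exp w| + 1) * Real.exp (-u)
          + Real.exp w * |Real.exp (-u) - Real.exp (-w)| := by
          refine (norm_add_le _ _).trans (add_le_add ?_ ?_)
          · rw [norm_mul, hexp]
            exact mul_le_mul_of_nonneg_right h6 (Real.exp_pos _).le
          · rw [norm_mul, Complex.norm_real, Real.norm_eq_abs]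
            exact mul_le_mul_of_nonneg_right (hM w) (abs_nonneg _)
      _ ≤ ε := by linarith

end PartialSums

/-! ### Orthogonality of the Möbius function to periodic sequences -/

section Residues

/-- The sequence `w` has mean correlation zero with the Möbius function. -/
def MoebiusOrthogonal (w : ℕ → ℂ) : Prop :=
  Tendsto (fun N : ℕ => (1 / (N : ℂ)) *
    ∑ n ∈ Finset.Icc 1 N, w n * (ArithmeticFunction.moebius n : ℂ)) atTop (𝓝 0)

lemma MoebiusOrthogonal.const_mul {w : ℕ → ℂ} (h : MoebiusOrthogonal w) (c : ℂ) :
    MoebiusOrthogonal fun n => c * w n := by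
  have := Tendsto.const_mul c h
  rw [mul_zero] at this
  refine this.congr fun N => ?_
  simp only [mul_assoc, ← Finset.mul_sum]
  ring

lemma MoebiusOrthogonal.sum {ι : Type*} {s : Finset ι} {w : ι → ℕ → ℂ}
    (h : ∀ i ∈ s, MoebiusOrthogonal (w i)) : MoebiusOrthogonal fun n => ∑ i ∈ s, w i n := by
  have := tendsto_finsetSum s h
  rw [Finset.sum_const_zero] at this
  refine this.congr fun N => ?_
  rw [← Finset.mul_sum, Finset.sum_comm]
  simp only [Finset.sum_mul]

lemma norm_moebius_le_one (n : ℕ) : ‖(ArithmeticFunction.moebius n : ℂ)‖ ≤ 1 := by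
  rw [Complex.norm_intCast]
  exact_mod_cast ArithmeticFunction.abs_moebius_le_one

/-- Prime number theorem for arithmetic progressions, in the form of the vanishing of the mean
of the Möbius function twisted by a Dirichlet character. -/
theorem moebiusOrthogonal_dirichletCharacter {m : ℕ} [NeZero m] (χ : DirichletCharacter ℂ m) :
    MoebiusOrthogonal fun n => χ n := by
  have ha : ∀ n : ℕ, ‖χ n * (ArithmeticFunction.moebius n : ℂ)‖ ≤ 1 := fun n => by
    rw [norm_mul]
    exact mul_le_one₀ (χ.norm_le_one _) (norm_nonneg _) (norm_moebius_le_one n)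
  have hL : ∀ s : ℂ, 1 < s.re → LSeries (fun n : ℕ => χ n * (ArithmeticFunction.moebius n : ℂ)) s =
      (DirichletCharacter.LFunction χ s)⁻¹ := fun s hs => by
    have := DirichletCharacter.LSeries.mul_mu_eq_one χ hs
    rw [DirichletCharacter.LFunction_eq_LSeries χ hs]
    exact eq_inv_of_mul_eq_one_right this
  by_cases hχ : χ = 1
  · subst hχ
    refine tendsto_mean_zero_of_LSeries ha
      (H := fun s => (s - 1) * (DirichletCharacter.LFunctionTrivChar₁ m s)⁻¹) ?_ fun s hs => ?_
    · refine ContinuousOn.mul (by fun_prop) (ContinuousOn.inv₀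
        (DirichletCharacter.differentiable_LFunctionTrivChar₁ m).continuous.continuousOn
        fun s hs => ?_)
      rcases eq_or_ne s 1 with rfl | hs1
      · exact DirichletCharacter.LFunctionTrivChar₁_apply_one_ne_zero m
      · rw [DirichletCharacter.LFunctionTrivChar₁, Function.update_of_ne hs1]
        exact mul_ne_zero (sub_ne_zero.2 hs1)
          (DirichletCharacter.LFunction_ne_zero_of_one_le_re _ (.inr hs1) hs)
    · have hs1 : s ≠ 1 := fun h => by simp [h] at hs
      rw [hL s hs, DirichletCharacter.LFunctionTrivChar₁, Function.update_of_ne hs1, mul_inv,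
        mul_inv_cancel_left₀ (sub_ne_zero.2 hs1)]
  · exact tendsto_mean_zero_of_LSeries ha (H := fun s => (DirichletCharacter.LFunction χ s)⁻¹)
      (ContinuousOn.inv₀ (DirichletCharacter.differentiable_LFunction hχ).continuous.continuousOn
        fun s hs => DirichletCharacter.LFunction_ne_zero_of_one_le_re _ (.inl hχ) hs) hL

/-- Functions supported by the residue classes coprime to the modulus are combinations of
Dirichlet characters. -/
lemma moebiusOrthogonal_of_support_isUnit {m : ℕ} [NeZero m] (v : ZMod m → ℂ)
    (hv : ∀ b, ¬ IsUnit b → v b = 0) : MoebiusOrthogonal fun n => v n := by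
  have h : MoebiusOrthogonal fun n => ∑ b : ZMod m, ∑ χ : DirichletCharacter ℂ m,
      (v b * (m.totient : ℂ)⁻¹ * χ b⁻¹) * χ n :=
    .sum fun b _ => .sum fun χ _ => (moebiusOrthogonal_dirichletCharacter χ).const_mul _
  refine h.congr fun N => ?_
  congr 1
  refine Finset.sum_congr rfl fun n _ => ?_
  congr 1
  have hφ : (m.totient : ℂ) ≠ 0 := by
    exact_mod_cast (Nat.totient_pos.2 (NeZero.pos m)).ne'
  have : ∀ b : ZMod m, ∑ χ : DirichletCharacter ℂ m, (v b * (m.totient : ℂ)⁻¹ * χ b⁻¹) * χ n =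
      if b = n then v b else 0 := by
    intro b
    by_cases hb : IsUnit b
    · simp only [mul_assoc, ← Finset.mul_sum]
      rw [DirichletCharacter.sum_char_inv_mul_char_eq ℂ hb]
      split_ifs with h
      · rw [inv_mul_cancel₀ hφ, mul_one]
      · simp
    · simp [hv b hb]
  simp [this]

/-- The Möbius function has mean value zero along every residue class. A class which is not
coprime to the modulus is reduced to coprime classes by splitting off the common divisor. -/
theorem moebiusOrthogonal_residueClass {m : ℕ} [NeZero m] (a : ZMod m) :
    MoebiusOrthogonal fun n => if (n : ZMod m) = a then 1 else 0 := by
  set g := Nat.gcd a.val m with hg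
  have hm0 : 0 < m := NeZero.pos m
  have hg0 : 0 < g := Nat.gcd_pos_of_pos_right _ hm0
  have hgm : g ∣ m := Nat.gcd_dvd_right _ _
  classical
  let v : ZMod m → ℂ := fun b => if IsUnit b ∧ (g : ZMod m) * b = a then 1 else 0
  have hv := moebiusOrthogonal_of_support_isUnit v fun b hb => if_neg fun h => hb h.1
  have hgcd : ∀ n : ℕ, (n : ZMod m) = a → Nat.gcd n m = g := by
    intro n hn
    rw [hg, ← hn, ZMod.val_natCast, ← Nat.gcd_rec, Nat.gcd_comm]
  have hterm : ∀ n : ℕ, (if ((g * n : ℕ) : ZMod m) = a then (1 : ℂ) else 0) *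
      (ArithmeticFunction.moebius (g * n) : ℂ) =
      (ArithmeticFunction.moebius g : ℂ) * (v n * (ArithmeticFunction.moebius n : ℂ)) := by
    intro n
    by_cases h : ((g * n : ℕ) : ZMod m) = a
    · have h' : (g : ZMod m) * n = a := by rw [← h, Nat.cast_mul]
      rw [if_pos h, one_mul]
      by_cases hc : Nat.Coprime g n
      · have hu : IsUnit (n : ZMod m) := by
          rw [ZMod.isUnit_iff_coprime]
          have h1 := hgcd _ h
          obtain ⟨m', hm'⟩ := hgm
          rw [hm', Nat.gcd_mul_left] at h1
          have h2 : Nat.Coprime n m' := by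
            have : g * Nat.gcd n m' = g * 1 := by rw [h1, mul_one]
            exact Nat.eq_of_mul_eq_mul_left hg0 this
          rw [hm']
          exact Nat.Coprime.mul_right hc.symm h2
        rw [show v n = 1 from if_pos ⟨hu, h'⟩, one_mul,
          ArithmeticFunction.isMultiplicative_moebius.map_mul_of_coprime hc]
        push_cast
        rfl
      · have hu : ¬ IsUnit (n : ZMod m) := fun hu =>
          hc ((((ZMod.isUnit_iff_coprime n m).1 hu).symm).coprime_dvd_left hgm)
        rw [show v n = 0 from if_neg fun h => hu h.1,
          ArithmeticFunction.moebius_eq_zero_of_not_squarefree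
            fun hs => hc (Nat.coprime_of_squarefree_mul hs)]
        simp
    · rw [if_neg h, show v n = 0 from if_neg fun hh => h (by rw [← hh.2, Nat.cast_mul])]
      simp
  have hsum : ∀ N : ℕ, ∑ n ∈ Finset.Icc 1 N, (if (n : ZMod m) = a then (1 : ℂ) else 0) *
      (ArithmeticFunction.moebius n : ℂ) = (ArithmeticFunction.moebius g : ℂ) *
        ∑ n ∈ Finset.Icc 1 (N / g), v n * (ArithmeticFunction.moebius n : ℂ) := by
    intro N
    rw [Finset.mul_sum, ← Finset.sum_congr rfl fun n _ => hterm n,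
      ← Finset.sum_image (s := Finset.Icc 1 (N / g)) (g := fun n => g * n)
        (f := fun n : ℕ => (if (n : ZMod m) = a then (1 : ℂ) else 0) *
          (ArithmeticFunction.moebius n : ℂ)) fun x _ y _ hxy => Nat.eq_of_mul_eq_mul_left hg0 hxy]
    symm
    refine Finset.sum_subset ?_ ?_
    · intro n hn
      obtain ⟨k, hk, rfl⟩ := Finset.mem_image.1 hn
      rw [Finset.mem_Icc] at hk ⊢
      exact ⟨Nat.mul_pos hg0 hk.1, (Nat.mul_le_mul_left g hk.2).trans (Nat.mul_div_le N g)⟩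
    · intro n hn hn'
      rw [if_neg, zero_mul]
      intro h
      have hgn : g ∣ n := hgcd n h ▸ Nat.gcd_dvd_left n m
      obtain ⟨k, rfl⟩ := hgn
      rw [Finset.mem_Icc] at hn
      refine hn' (Finset.mem_image.2 ⟨k, Finset.mem_Icc.2 ⟨?_, ?_⟩, rfl⟩)
      · exact Nat.pos_of_mul_pos_left hn.1
      · rw [Nat.le_div_iff_mul_le hg0, mul_comm]
        exact hn.2
  have hdiv : Tendsto (fun N : ℕ => N / g) atTop atTop := Nat.tendsto_div_const_atTop hg0.ne'
  have h1 := (hv.comp hdiv).norm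
  rw [norm_zero] at h1
  refine squeeze_zero_norm (fun N => ?_) h1
  simp only [Function.comp_apply]
  rw [hsum, norm_mul, norm_mul, norm_mul]
  set S := ‖∑ n ∈ Finset.Icc 1 (N / g), v n * (ArithmeticFunction.moebius n : ℂ)‖
  rcases Nat.eq_zero_or_pos (N / g) with h0 | h0
  · simp [S, h0]
  · have hN : N / g ≤ N := Nat.div_le_self _ _
    have h2 : ‖(1 / (N : ℂ))‖ ≤ ‖(1 / ((N / g : ℕ) : ℂ))‖ := by
      simp only [norm_div, norm_one, Complex.norm_natCast]
      exact one_div_le_one_div_of_le (by exact_mod_cast h0) (by exact_mod_cast hN)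
    refine mul_le_mul h2 ?_ (by positivity) (norm_nonneg _)
    exact mul_le_of_le_one_left (norm_nonneg _) (norm_moebius_le_one g)

/-- Periodic sequences have mean correlation zero with the Möbius function. -/
theorem moebiusOrthogonal_zmod {m : ℕ} [NeZero m] (v : ZMod m → ℂ) :
    MoebiusOrthogonal fun n => v n := by
  have h : MoebiusOrthogonal fun n => ∑ b : ZMod m, v b * if (n : ZMod m) = b then 1 else 0 :=
    .sum fun b _ => (moebiusOrthogonal_residueClass b).const_mul _
  simpa using h

/-- A sequence that is approximated in mean by periodic sequences has mean correlation zero with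
the Möbius function. -/
theorem moebiusOrthogonal_of_approx {w : ℕ → ℂ}
    (h : ∀ ε > 0, ∃ (m : ℕ) (_ : NeZero m) (v : ZMod m → ℂ), ∀ᶠ N : ℕ in atTop,
      ∑ n ∈ Finset.Icc 1 N, ‖w n - v n‖ ≤ ε * N) : MoebiusOrthogonal w := by
  rw [MoebiusOrthogonal, Metric.tendsto_atTop]
  intro ε hε
  obtain ⟨m, _, v, hv⟩ := h (ε / 2) (by positivity)
  have h1 := (moebiusOrthogonal_zmod v).norm
  rw [norm_zero] at h1
  obtain ⟨N0, hN0⟩ := (hv.and ((h1.eventually (gt_mem_nhds (half_pos hε))).and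
    (eventually_gt_atTop 0))).exists_forall_of_atTop
  refine ⟨N0, fun N hN => ?_⟩
  obtain ⟨h2, h3, hN1⟩ := hN0 N hN
  have hN1' : (0 : ℝ) < N := Nat.cast_pos.2 hN1
  rw [dist_zero_right]
  have h4 : (1 / (N : ℂ)) * ∑ n ∈ Finset.Icc 1 N, w n * (ArithmeticFunction.moebius n : ℂ) =
      (1 / (N : ℂ)) * ∑ n ∈ Finset.Icc 1 N, (w n - v n) * (ArithmeticFunction.moebius n : ℂ) +
      (1 / (N : ℂ)) * ∑ n ∈ Finset.Icc 1 N, v n * (ArithmeticFunction.moebius n : ℂ) := by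
    rw [← mul_add, ← Finset.sum_add_distrib]
    congr 1
    exact Finset.sum_congr rfl fun n _ => by ring
  rw [h4]
  refine (norm_add_le _ _).trans_lt ?_
  have h5 : ‖(1 / (N : ℂ)) * ∑ n ∈ Finset.Icc 1 N,
      (w n - v n) * (ArithmeticFunction.moebius n : ℂ)‖ ≤ ε / 2 := by
    rw [norm_mul, norm_div, norm_one, Complex.norm_natCast, one_div_mul_eq_div, div_le_iff₀ hN1']
    refine (norm_sum_le _ _).trans ((Finset.sum_le_sum fun n _ => ?_).trans h2)
    rw [norm_mul]
    exact mul_le_of_le_one_right (norm_nonneg _) (norm_moebius_le_one n)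
  linarith

end Residues
end MoebiusCorrelation

namespace OdometerModel
namespace Parameters

variable (D : Parameters)

/-! ### Periods and numbers of unfilled positions -/

/-- The period `p_k` after `k` steps. -/
def per (k : ℕ) : ℕ := period D.q k

/-- The number of unfilled residues modulo `p_k` after `k` steps. -/
def unf (k : ℕ) : ℕ := unfilled D.q D.r k

lemma q_pos (k : ℕ) : 0 < D.q k := (D.r_pos k).trans (D.r_lt k)

lemma per_zero : D.per 0 = 1 := rfl

lemma per_succ (k : ℕ) : D.per (k + 1) = D.per k * D.q k := Finset.prod_range_succ _ _

lemma per_pos (k : ℕ) : 0 < D.per k :=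
  Finset.prod_pos (s := Finset.range k) fun i _ => D.q_pos i

lemma unf_zero : D.unf 0 = 1 := rfl

lemma unf_succ (k : ℕ) : D.unf (k + 1) = D.unf k * (D.q k - D.r k) := Finset.prod_range_succ _ _

lemma unf_pos (k : ℕ) : 0 < D.unf k :=
  Finset.prod_pos (s := Finset.range k) fun i _ => Nat.sub_pos_of_lt (D.r_lt i)

lemma per_dvd_per {k l : ℕ} (h : k ≤ l) : D.per k ∣ D.per l :=
  Finset.prod_dvd_prod_of_subset _ _ _ (Finset.range_mono h)

lemma unf_dvd_unf {k l : ℕ} (h : k ≤ l) : D.unf k ∣ D.unf l :=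
  Finset.prod_dvd_prod_of_subset _ _ _ (Finset.range_mono h)

lemma two_pow_le_per (k : ℕ) : 2 ^ k ≤ D.per k := by
  induction k with
  | zero => simp [per_zero]
  | succ k ih =>
    rw [D.per_succ, pow_succ]
    exact Nat.mul_le_mul ih
      (Nat.succ_le_of_lt ((Nat.succ_le_of_lt (D.r_pos k)).trans_lt (D.r_lt k)))

lemma lt_per (k : ℕ) : k < D.per k := Nat.lt_two_pow_self.trans_le (D.two_pow_le_per k)

lemma unf_div_per (k : ℕ) :
    (D.unf k : ℝ) / D.per k = ∏ i ∈ Finset.range k, (1 - (D.r i : ℝ) / D.q i) := by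
  rw [unf, per, unfilled, period, Nat.cast_prod, Nat.cast_prod, ← Finset.prod_div_distrib]
  refine Finset.prod_congr rfl fun i _ => ?_
  have : (D.q i : ℝ) ≠ 0 := Nat.cast_ne_zero.2 (D.q_pos i).ne'
  rw [Nat.cast_sub (D.r_lt i).le]
  field_simp

lemma tendsto_unf_div_per : Tendsto (fun k => (D.unf k : ℝ) / D.per k) atTop (𝓝 D.d) := by
  simpa only [D.unf_div_per] using D.tendsto_d

lemma antitone_unf_div_per : Antitone fun k => (D.unf k : ℝ) / D.per k := by
  refine antitone_nat_of_succ_le fun k => ?_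
  simp only [D.unf_div_per, Finset.prod_range_succ]
  refine mul_le_of_le_one_right ?_ ?_
  · rw [← D.unf_div_per]
    positivity
  · have : 0 ≤ (D.r k : ℝ) / D.q k := by positivity
    linarith

lemma d_le_unf_div_per (k : ℕ) : D.d ≤ (D.unf k : ℝ) / D.per k :=
  D.antitone_unf_div_per.le_of_tendsto D.tendsto_unf_div_per k

/-- The number of unfilled positions in a period tends to infinity, since `p_k` does and the
proportion of unfilled positions stays above `d`. -/
lemma exists_lt_unf (N : ℕ) : ∃ K, ∀ k ≥ K, N < D.unf k := by
  obtain ⟨K, hK⟩ := exists_nat_gt (N / D.d)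
  refine ⟨K, fun k hk => ?_⟩
  have h1 : D.d * D.per k ≤ D.unf k :=
    (le_div_iff₀ (Nat.cast_pos.2 (D.per_pos k))).1 (D.d_le_unf_div_per k)
  have h2 : (N : ℝ) < D.d * K := by rwa [div_lt_iff₀' D.d_pos] at hK
  have h3 : (K : ℝ) ≤ D.per k := by exact_mod_cast hk.trans (D.lt_per k).le
  have h4 := mul_le_mul_of_nonneg_left h3 D.d_pos.le
  exact_mod_cast (by linarith : (N : ℝ) < D.unf k)

/-! ### The partially filled sequences -/

/-- The partially filled sequence after `k` steps, extended periodically to all integers. -/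
def symbol (k : ℕ) (n : ℤ) : Option (Fin 2) := fill D.q D.r D.s k (n % D.per k).toNat

/-- The residue of an integer modulo `p_k`, as a natural number. -/
def res (k : ℕ) (n : ℤ) : ℕ := (n % D.per k).toNat

/-- The number of positions that are unfilled after `k` steps and lie before a given one. -/
def holeCount (k : ℕ) (n : ℕ) : ℕ := Nat.count (fun j => fill D.q D.r D.s k j = none) n

lemma per_pos' (k : ℕ) : (0 : ℤ) < D.per k := by exact_mod_cast D.per_pos k

lemma coe_res (k : ℕ) (n : ℤ) : (D.res k n : ℤ) = n % D.per k :=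
  Int.toNat_of_nonneg (Int.emod_nonneg _ (D.per_pos' k).ne')

lemma res_lt (k : ℕ) (n : ℤ) : D.res k n < D.per k := by
  have := Int.emod_lt_of_pos n (D.per_pos' k)
  rw [← D.coe_res] at this
  exact_mod_cast this

lemma res_natCast (k n : ℕ) : D.res k n = n % D.per k := by
  have := D.coe_res k n
  exact_mod_cast this

lemma res_eq_iff {k : ℕ} {m n : ℤ} : D.res k m = D.res k n ↔ m ≡ n [ZMOD D.per k] := by
  rw [← Nat.cast_inj (R := ℤ), D.coe_res, D.coe_res]
  rfl

lemma fill_add_per (k n : ℕ) : fill D.q D.r D.s k (n + D.per k) = fill D.q D.r D.s k n := by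
  have key : ∀ k n j, fill D.q D.r D.s k (n + D.per k * j) = fill D.q D.r D.s k n := by
    intro k
    induction k with
    | zero => intro n j; rfl
    | succ k ih =>
      intro n j
      have h1 : (n + D.per (k + 1) * j) % period D.q (k + 1) = n % period D.q (k + 1) :=
        Nat.add_mul_mod_self_left _ _ _
      have h2 : fill D.q D.r D.s k (n + D.per (k + 1) * j) = fill D.q D.r D.s k n := by
        rw [D.per_succ, mul_assoc, ih]
      simp only [fill, h1, h2]
  simpa using key k n 1

lemma fill_mod_per (k n : ℕ) : fill D.q D.r D.s k (n % D.per k) = fill D.q D.r D.s k n :=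
  (show Function.Periodic (fill D.q D.r D.s k) (D.per k) from D.fill_add_per k).map_mod_nat n

lemma symbol_eq_fill_res (k : ℕ) (n : ℤ) : D.symbol k n = fill D.q D.r D.s k (D.res k n) := rfl

lemma symbol_natCast (k n : ℕ) : D.symbol k n = fill D.q D.r D.s k n := by
  rw [symbol_eq_fill_res, res_natCast, fill_mod_per]

lemma symbol_congr {k : ℕ} {m n : ℤ} (h : m ≡ n [ZMOD D.per k]) : D.symbol k m = D.symbol k n := by
  rw [symbol_eq_fill_res, symbol_eq_fill_res, D.res_eq_iff.2 h]

lemma modEq_of_le {k l : ℕ} (hkl : k ≤ l) {m n : ℤ} (h : m ≡ n [ZMOD D.per l]) :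
    m ≡ n [ZMOD D.per k] :=
  h.of_dvd (by exact_mod_cast D.per_dvd_per hkl)

lemma res_modEq (k : ℕ) (n : ℤ) : (D.res k n : ℤ) ≡ n [ZMOD D.per k] := by
  rw [D.coe_res]
  exact Int.mod_modEq _ _

lemma symbol_res {k l : ℕ} (h : k ≤ l) (n : ℤ) : D.symbol k (D.res l n) = D.symbol k n :=
  D.symbol_congr (D.modEq_of_le h (D.res_modEq l n))

/-- One step of the construction, for the two-sided periodic extensions. -/
lemma symbol_succ (k : ℕ) (n : ℤ) : D.symbol (k + 1) n =
    if D.symbol k n = none ∧ D.res (k + 1) n < D.r k * D.per k then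
      some (if D.holeCount k (D.res (k + 1) n) = D.s k then 1 else 0)
    else D.symbol k n := by
  have h1 : fill D.q D.r D.s k (D.res (k + 1) n) = D.symbol k n := by
    rw [← D.symbol_natCast, D.symbol_res k.le_succ]
  have h2 : D.res (k + 1) n % period D.q (k + 1) = D.res (k + 1) n :=
    Nat.mod_eq_of_lt (D.res_lt _ _)
  rw [symbol_eq_fill_res]
  simp only [fill, h1, h2]
  rfl

lemma symbol_mono {k l : ℕ} (hkl : k ≤ l) {n : ℤ} {v : Fin 2} (h : D.symbol k n = some v) :
    D.symbol l n = some v := by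
  induction l, hkl using Nat.le_induction with
  | base => exact h
  | succ l _ ih => rw [D.symbol_succ, if_neg (by simp [ih]), ih]

lemma symbol_eq_none_of_le {k l : ℕ} (hkl : k ≤ l) {n : ℤ} (h : D.symbol l n = none) :
    D.symbol k n = none := by
  cases hk : D.symbol k n with
  | none => rfl
  | some v => rw [D.symbol_mono hkl hk] at h; cases h

/-- A position is left unfilled by a step exactly if it lies outside the filled blocks. -/
lemma symbol_succ_eq_none_iff {k : ℕ} {n : ℤ} :
    D.symbol (k + 1) n = none ↔ D.symbol k n = none ∧ D.r k * D.per k ≤ D.res (k + 1) n := by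
  rw [D.symbol_succ]
  split_ifs with h
  · simp only [false_iff, not_and, not_le]
    exact fun _ => h.2
  · constructor
    · intro h'
      exact ⟨h', not_lt.1 fun h2 => h ⟨h', h2⟩⟩
    · exact fun h' => h'.1

lemma coe_res_succ (k : ℕ) (n : ℤ) :
    (D.res (k + 1) n : ℤ) = D.res k n + D.per k * (n / D.per k % D.q k) := by
  rw [D.coe_res, D.coe_res, D.per_succ, Nat.cast_mul, Int.emod_def, Int.emod_def, Int.emod_def,
    ← Int.ediv_ediv_of_nonneg (D.per_pos' k).le]
  ring

lemma ediv_congr_of_le {k l : ℕ} (hkl : k ≤ l) {m n : ℤ} (h : m / D.per k = n / D.per k) :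
    m / D.per l = n / D.per l := by
  obtain ⟨c, hc⟩ := D.per_dvd_per hkl
  rw [hc, Nat.cast_mul, ← Int.ediv_ediv_of_nonneg (D.per_pos' k).le,
    ← Int.ediv_ediv_of_nonneg (D.per_pos' k).le, h]

lemma res_succ_div (k : ℕ) (n : ℤ) :
    ((D.res (k + 1) n / D.per k : ℕ) : ℤ) = n / D.per k % D.q k := by
  rw [Int.natCast_div, D.coe_res_succ, Int.add_mul_ediv_left _ _ (D.per_pos' k).ne',
    Int.ediv_eq_zero_of_lt (by positivity) (by exact_mod_cast D.res_lt k n), zero_add]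

lemma mul_per_le_res_succ_iff (k : ℕ) (n : ℤ) :
    D.r k * D.per k ≤ D.res (k + 1) n ↔ (D.r k : ℤ) ≤ n / D.per k % D.q k := by
  rw [← D.res_succ_div, ← Nat.le_div_iff_mul_le (D.per_pos k)]
  exact Nat.cast_le.symm

/-- The unfilled positions in an aligned block of length `p_k` are filled at the same step. -/
lemma symbol_eq_none_iff_of_ediv_eq {k l : ℕ} (hkl : k ≤ l) {m n : ℤ}
    (h : m / D.per k = n / D.per k) (hm : D.symbol k m = none) (hn : D.symbol k n = none) :
    D.symbol l m = none ↔ D.symbol l n = none := by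
  induction l, hkl using Nat.le_induction with
  | base => simp [hm, hn]
  | succ l hl ih =>
    rw [D.symbol_succ_eq_none_iff, D.symbol_succ_eq_none_iff, ih, D.mul_per_le_res_succ_iff,
      D.mul_per_le_res_succ_iff, D.ediv_congr_of_le hl h]

lemma eq_of_ediv_eq_of_res_eq {k : ℕ} {m n : ℤ} (h : m / D.per k = n / D.per k)
    (h' : D.res k m = D.res k n) : m = n := by
  rw [← Int.mul_ediv_add_emod m (D.per k), ← Int.mul_ediv_add_emod n (D.per k), h,
    ← D.coe_res, ← D.coe_res, h']

/-- At most one of the unfilled positions in an aligned block of length `p_k` will receive the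
symbol `1`. -/
lemma eq_of_symbol_eq_one {k l : ℕ} {m n : ℤ}
    (h : m / D.per k = n / D.per k) (hm : D.symbol k m = none) (hn : D.symbol k n = none)
    (hm1 : D.symbol l m = some 1) (hn1 : D.symbol l n = some 1) : m = n := by
  have hkl : k ≤ l := by
    by_contra! hlk
    rw [D.symbol_mono hlk.le hm1] at hm
    cases hm
  induction l, hkl using Nat.le_induction with
  | base => rw [hm] at hm1; cases hm1
  | succ l hl ih =>
    have hiff := D.symbol_eq_none_iff_of_ediv_eq hl h hm hn
    have hs := D.symbol_succ l
    cases hml : D.symbol l m with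
    | some v =>
      have h1 : D.symbol l m = some 1 := by rw [hml, ← D.symbol_mono l.le_succ hml, hm1]
      cases hnl : D.symbol l n with
      | none => rw [hiff.2 hnl] at hml; cases hml
      | some w => exact ih h1 (by rw [hnl, ← D.symbol_mono l.le_succ hnl, hn1])
    | none =>
      have hnl := hiff.1 hml
      have key : ∀ n, D.symbol l n = none → D.symbol (l + 1) n = some 1 →
          D.holeCount l (D.res (l + 1) n) = D.s l := by
        intro n h0 h1
        rw [hs, h0] at h1
        split_ifs at h1 with h2 h3 <;> simp_all
      refine D.eq_of_ediv_eq_of_res_eq (D.ediv_congr_of_le (hl.trans l.le_succ) h)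
        (Nat.count_injective ?_ ?_ ((key m hml hm1).trans (key n hnl hn1).symm))
      · rw [← D.symbol_natCast, D.symbol_res l.le_succ, hml]
      · rw [← D.symbol_natCast, D.symbol_res l.le_succ, hnl]

/-! ### Counting unfilled positions -/

lemma holeCount_add (k m n : ℕ) :
    D.holeCount k (D.per k * m + n) = m * D.holeCount k (D.per k) + D.holeCount k n := by
  induction m with
  | zero => simp
  | succ m ih =>
    have : D.per k * (m + 1) + n = D.per k + (D.per k * m + n) := by ring
    rw [this, holeCount, Nat.count_add]
    simp only [add_comm (D.per k), D.fill_add_per]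
    change Nat.count (fun j => fill D.q D.r D.s k j = none) (D.per k) +
      D.holeCount k (D.per k * m + n) = _
    rw [ih]
    simp only [holeCount]
    ring

/-- Passing from step `k` to step `k + 1` deletes an initial segment of unfilled positions. -/
lemma holeCount_succ {k n : ℕ} (hn : n ≤ D.per (k + 1)) :
    D.holeCount (k + 1) n = D.holeCount k (n - D.r k * D.per k) := by
  induction n with
  | zero => simp [holeCount]
  | succ n ih =>
    have ih := ih (by lia)
    have hres : D.res (k + 1) n = n := by rw [D.res_natCast, Nat.mod_eq_of_lt (by lia)]
    have h1 : fill D.q D.r D.s (k + 1) n = none ↔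
        fill D.q D.r D.s k n = none ∧ D.r k * D.per k ≤ n := by
      rw [← D.symbol_natCast, D.symbol_succ_eq_none_iff, hres, D.symbol_natCast]
    rcases lt_or_ge n (D.r k * D.per k) with h | h
    · have h2 : n + 1 - D.r k * D.per k = 0 := by lia
      have h3 : n - D.r k * D.per k = 0 := by lia
      rw [h3] at ih
      rw [h2, ← ih, holeCount, Nat.count_succ, if_neg (by rw [h1]; lia)]
      rfl
    · obtain ⟨t, rfl⟩ := Nat.exists_eq_add_of_le h
      have h2 : D.r k * D.per k + t + 1 - D.r k * D.per k = t + 1 := by lia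
      have h3 : D.r k * D.per k + t - D.r k * D.per k = t := by lia
      have h4 : fill D.q D.r D.s k (D.r k * D.per k + t) = fill D.q D.r D.s k t := by
        rw [← D.fill_mod_per k, mul_comm, Nat.mul_add_mod, D.fill_mod_per]
      rw [h3] at ih
      rw [h4] at h1
      rw [h2, holeCount, Nat.count_succ, holeCount, Nat.count_succ]
      simp only [holeCount] at ih
      rw [ih]
      simp [h1]

lemma holeCount_per (k : ℕ) : D.holeCount k (D.per k) = D.unf k := by
  induction k with
  | zero => simp [holeCount, per_zero, unf_zero, fill, Nat.count_succ]
  | succ k ih =>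
    rw [D.holeCount_succ le_rfl, D.per_succ, mul_comm (D.r k), ← Nat.mul_sub, D.unf_succ]
    have := D.holeCount_add k (D.q k - D.r k) 0
    rw [add_zero, ih] at this
    rw [this, mul_comm]
    simp [holeCount]

lemma holeCount_per_mul (k m : ℕ) : D.holeCount k (D.per k * m) = m * D.unf k := by
  have := D.holeCount_add k m 0
  rw [add_zero, D.holeCount_per] at this
  rw [this]
  simp [holeCount]

/-- The index of a position among the unfilled positions in its aligned block of length `p_k`. -/
def rank (k : ℕ) (n : ℤ) : ℕ := D.holeCount k (D.res k n)

lemma rank_congr {k : ℕ} {m n : ℤ} (h : m ≡ n [ZMOD D.per k]) : D.rank k m = D.rank k n := by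
  rw [rank, rank, D.res_eq_iff.2 h]

lemma rank_lt {k : ℕ} {n : ℤ} (h : D.symbol k n = none) : D.rank k n < D.unf k := by
  rw [← D.holeCount_per, rank, holeCount]
  exact Nat.count_strict_mono h (D.res_lt k n)

lemma holeCount_natCast (k n : ℕ) : D.holeCount k n = n / D.per k * D.unf k + D.rank k n := by
  conv_lhs => rw [← Nat.div_add_mod n (D.per k), D.holeCount_add, D.holeCount_per]
  rw [rank, D.res_natCast]

lemma modEq_of_rank_eq {k : ℕ} {m n : ℤ} (hm : D.symbol k m = none) (hn : D.symbol k n = none)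
    (h : D.rank k m = D.rank k n) : m ≡ n [ZMOD D.per k] :=
  D.res_eq_iff.1 (Nat.count_injective hm hn h)

/-- The index of a position in a longer block determines its index in the shorter one: the filled
parts and the translates have numbers of unfilled positions divisible by that of a short block. -/
lemma rank_mod {k l : ℕ} (hkl : k ≤ l) {n : ℤ} (h : D.symbol l n = none) :
    D.rank l n % D.unf k = D.rank k n := by
  induction l, hkl using Nat.le_induction with
  | base => exact Nat.mod_eq_of_lt (D.rank_lt h)
  | succ l hl ih =>
    have hn := D.symbol_succ_eq_none_iff.1 h
    rw [← ih hn.1, rank, D.holeCount_succ (D.res_lt _ _).le, D.holeCount_natCast,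
      ← Nat.mod_mod_of_dvd _ (D.unf_dvd_unf hl), Nat.mul_add_mod_self_right,
      Nat.mod_mod_of_dvd _ (D.unf_dvd_unf hl)]
    congr 1
    refine D.rank_congr ?_
    rw [Nat.cast_sub hn.2]
    have h1 := D.modEq_of_le l.le_succ (D.res_modEq (l + 1) n)
    refine Int.ModEq.trans ?_ h1
    rw [Int.modEq_iff_dvd]
    push_cast
    simp

lemma exists_holeCount_eq {k u N : ℕ} (h : u < D.holeCount k N) :
    ∃ m < N, fill D.q D.r D.s k m = none ∧ D.holeCount k m = u := by
  induction N with
  | zero => simp [holeCount] at h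
  | succ N ih =>
    by_cases h' : u < D.holeCount k N
    · obtain ⟨m, hm, h1⟩ := ih h'
      exact ⟨m, hm.trans N.lt_succ_self, h1⟩
    · rw [holeCount, Nat.count_succ] at h
      simp only [holeCount] at h' ⊢
      split_ifs at h with h2
      · exact ⟨N, N.lt_succ_self, h2, by lia⟩
      · lia

/-- Every index `u` of the block of step `k` is realized by an unfilled position. -/
lemma exists_symbol_succ_eq {k u : ℕ} (hu : u < D.r k * D.unf k) :
    ∃ m : ℕ, D.symbol k m = none ∧ D.symbol (k + 1) m = some (if u = D.s k then 1 else 0) ∧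
      ∀ j ≤ k, D.rank j m = u % D.unf j := by
  obtain ⟨m, hm, h1, h2⟩ := D.exists_holeCount_eq (k := k) (N := D.per k * D.r k)
    (by rwa [D.holeCount_per_mul])
  have h0 : D.symbol k m = none := by rw [D.symbol_natCast, h1]
  have hmlt : m < D.per (k + 1) := by
    rw [D.per_succ]
    exact hm.trans_le (Nat.mul_le_mul_left _ (D.r_lt k).le)
  have hres : D.res (k + 1) m = m := by rw [D.res_natCast, Nat.mod_eq_of_lt hmlt]
  refine ⟨m, h0, ?_, fun j hj => ?_⟩
  · rw [D.symbol_succ, hres, if_pos ⟨h0, by rwa [mul_comm]⟩, h2]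
  · rw [← D.rank_mod hj h0, ← h2, D.holeCount_natCast,
      ← Nat.mod_mod_of_dvd (_ + _) (D.unf_dvd_unf hj), Nat.mul_add_mod_self_right,
      Nat.mod_mod_of_dvd _ (D.unf_dvd_unf hj)]

/-- Every residue class of unfilled positions receives the symbol `1` in arbitrarily late
steps. -/
lemma exists_symbol_eq_one {k c : ℕ} (hc : c < D.unf k) (K : ℕ) :
    ∃ j ≥ K, k ≤ j ∧ ∃ m : ℕ, D.symbol j m = none ∧ D.symbol (j + 1) m = some 1 ∧
      D.rank k m = c := by
  obtain ⟨j, ⟨hkj, hj⟩, hKj⟩ := (D.recurrent k c hc).exists_gt K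
  obtain ⟨m, h1, h2, h3⟩ := D.exists_symbol_succ_eq (D.s_lt j)
  exact ⟨j, hKj.le, hkj, m, h1, by simpa using h2, (h3 k hkj).trans hj⟩

/-- Every residue class of unfilled positions receives the symbol `0` at some later step. -/
lemma exists_symbol_eq_zero {k c : ℕ} (hc : c < D.unf k) :
    ∃ j ≥ k, ∃ m : ℕ, D.symbol j m = none ∧ D.symbol (j + 1) m = some 0 ∧ D.rank k m = c := by
  obtain ⟨K, hK⟩ := D.exists_lt_unf (D.unf k)
  set j := max k K with hj
  have hlt : D.unf k < D.unf j := hK j (le_max_right _ _)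
  have hkj : k ≤ j := le_max_left _ _
  obtain ⟨t, ht⟩ := D.unf_dvd_unf hkj
  have hle : D.unf j ≤ D.r j * D.unf j := Nat.le_mul_of_pos_left _ (D.r_pos j)
  have ht2 : 2 ≤ t := by
    by_contra! h
    have : D.unf k * t ≤ D.unf k * 1 := Nat.mul_le_mul_left _ (by lia)
    lia
  have h2 : D.unf k * 2 ≤ D.unf k * t := Nat.mul_le_mul_left _ ht2
  obtain ⟨u, hu, hus, huc⟩ : ∃ u < D.r j * D.unf j, u ≠ D.s j ∧ u % D.unf k = c := by
    by_cases h : c = D.s j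
    · refine ⟨c + D.unf k, by lia, ?_, ?_⟩
      · have := D.unf_pos k
        lia
      · rw [Nat.add_mod_right, Nat.mod_eq_of_lt hc]
    · exact ⟨c, by lia, h, Nat.mod_eq_of_lt hc⟩
  obtain ⟨m, h3, h4, h5⟩ := D.exists_symbol_succ_eq hu
  exact ⟨j, hkj, m, h3, by simpa [hus] using h4, (h5 k hkj).trans huc⟩

end Parameters
end OdometerModel

namespace OdometerModel
namespace Parameters

variable (D : Parameters)

/-! ### The adding machine and integer representatives -/

/-- An integer representing the image of `g` modulo `p_k`. -/
def rep (g : D.scale.addingMachine) : ℕ → ℤ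
  | 0 => 0
  | k + 1 => ((g.1 k).val : ℤ)

local instance neZero_scale (k : ℕ) : NeZero (D.scale.p k) := ⟨(D.scale.pos k).ne'⟩

lemma coe_rep_succ (g : D.scale.addingMachine) (k : ℕ) :
    ((D.rep g (k + 1) : ℤ) : ZMod (D.scale.p k)) = g.1 k := by
  simp [rep]

lemma intCast_eq_iff_modEq_rep {g : D.scale.addingMachine} {k : ℕ} {t : ℤ} :
    (t : ZMod (D.scale.p k)) = g.1 k ↔ t ≡ D.rep g (k + 1) [ZMOD D.per (k + 1)] := by
  rw [← D.coe_rep_succ, ZMod.intCast_eq_intCast_iff]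
  rfl

lemma modEq_zero (m n : ℤ) : m ≡ n [ZMOD D.per 0] := by
  rw [per_zero]
  exact Int.modEq_one

lemma rep_modEq {k l : ℕ} (hkl : k ≤ l) (g : D.scale.addingMachine) :
    D.rep g l ≡ D.rep g k [ZMOD D.per k] := by
  induction l, hkl using Nat.le_induction with
  | base => rfl
  | succ l hl ih =>
    refine Int.ModEq.trans (D.modEq_of_le hl ?_) ih
    cases l with
    | zero => exact D.modEq_zero _ _
    | succ l =>
      rw [← D.intCast_eq_iff_modEq_rep]
      have h1 := g.2 l
      rw [← D.coe_rep_succ g (l + 1), map_intCast] at h1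
      exact h1

lemma rep_add_zsmul_one (g : D.scale.addingMachine) (n : ℤ) (k : ℕ) :
    D.rep (g + n • D.scale.one) k ≡ D.rep g k + n [ZMOD D.per k] := by
  cases k with
  | zero => exact D.modEq_zero _ _
  | succ k =>
    refine (D.intCast_eq_iff_modEq_rep.1 ?_).symm
    have h1 : (g + n • D.scale.one).1 k = g.1 k + n • (1 : ZMod (D.scale.p k)) := rfl
    rw [h1, Int.cast_add, D.coe_rep_succ]
    simp

lemma addingMachine_ext {g h : D.scale.addingMachine}
    (H : ∀ k, D.rep g k ≡ D.rep h k [ZMOD D.per k]) : g = h := by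
  refine Subtype.ext (funext fun k => ?_)
  rw [← D.coe_rep_succ g]
  exact D.intCast_eq_iff_modEq_rep.2 (H (k + 1))

/-- The element of the adding machine represented by a coherent sequence of integers. -/
def ofSeq (t : ℕ → ℤ) (ht : ∀ k, t (k + 1) ≡ t k [ZMOD D.per k]) : D.scale.addingMachine :=
  ⟨fun k => (t (k + 1) : ZMod (D.scale.p k)), fun k => by
    rw [map_intCast, ZMod.intCast_eq_intCast_iff]
    exact ht (k + 1)⟩

lemma rep_ofSeq (t : ℕ → ℤ) (ht : ∀ k, t (k + 1) ≡ t k [ZMOD D.per k]) (k : ℕ) :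
    D.rep (D.ofSeq t ht) k ≡ t k [ZMOD D.per k] := by
  cases k with
  | zero => exact D.modEq_zero _ _
  | succ k => exact (D.intCast_eq_iff_modEq_rep.1 rfl).symm

lemma continuous_rep (k : ℕ) : Continuous fun g => D.rep g k := by
  cases k with
  | zero => exact continuous_const
  | succ k =>
    exact (continuous_of_discreteTopology (f := fun a : ZMod (D.scale.p k) => (a.val : ℤ))).comp
      ((continuous_apply k).comp continuous_subtype_val)

/-! ### The skeleton of a point of the adding machine -/

/-- The symbol at position `n` of the two-sided sequence that is filled with period `p_k` relative
to the position prescribed by `g`. -/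
def skeleton (g : D.scale.addingMachine) (k : ℕ) (n : ℤ) : Option (Fin 2) :=
  D.symbol k (D.rep g k + n)

/-- The positions that no step fills. -/
def holes (g : D.scale.addingMachine) : Set ℤ := {n | ∀ k, D.skeleton g k n = none}

/-- The sequence `z` carries the prescribed symbols at all positions filled relative to `g`. -/
def Extends (g : D.scale.addingMachine) (z : ℤ → Fin 2) : Prop :=
  ∀ k n v, D.skeleton g k n = some v → z n = v

variable {D}
variable {g h : D.scale.addingMachine} {z : ℤ → Fin 2}

lemma skeleton_eq_symbol {k l : ℕ} (hkl : k ≤ l) (n : ℤ) :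
    D.skeleton g k n = D.symbol k (D.rep g l + n) :=
  D.symbol_congr ((D.rep_modEq hkl g).symm.add_right n)

lemma skeleton_mono {k l : ℕ} (hkl : k ≤ l) {n : ℤ} {v : Fin 2} (hv : D.skeleton g k n = some v) :
    D.skeleton g l n = some v := by
  rw [skeleton_eq_symbol hkl] at hv
  exact D.symbol_mono hkl hv

lemma skeleton_congr {k : ℕ} {m n : ℤ} (hmn : m ≡ n [ZMOD D.per k]) :
    D.skeleton g k m = D.skeleton g k n :=
  D.symbol_congr (hmn.add_left _)

lemma skeleton_add_zsmul_one (m : ℤ) (k : ℕ) (n : ℤ) :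
    D.skeleton (g + m • D.scale.one) k n = D.skeleton g k (m + n) := by
  refine D.symbol_congr ?_
  rw [← add_assoc]
  exact (D.rep_add_zsmul_one g m k).add_right n

lemma extends_add_zsmul_one (m : ℤ) :
    D.Extends (g + m • D.scale.one) (SymbolicDynamics.FullShift.shift m z) ↔ D.Extends g z := by
  simp only [Extends, skeleton_add_zsmul_one, SymbolicDynamics.FullShift.shift_apply]
  constructor
  · intro H k n v hv
    simpa using H k (n - m) v (by simpa using hv)
  · intro H k n v hv
    exact H k (m + n) v hv

lemma exists_skeleton_of_notMem_holes {n : ℤ} (hn : n ∉ D.holes g) :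
    ∃ k v, D.skeleton g k n = some v := by
  simp only [holes, Set.mem_ofPred_eq, not_forall] at hn
  obtain ⟨k, hk⟩ := hn
  exact ⟨k, Option.ne_none_iff_exists'.1 hk⟩

/-- Unfilled positions that are close to each other lie in the same aligned block, since each
aligned block starts with a long interval of filled positions. -/
lemma ediv_eq_of_skeleton_eq_none {k : ℕ} {m n : ℤ} (hm : D.skeleton g (k + 1) m = none)
    (hn : D.skeleton g (k + 1) n = none) (hmn : |n - m| < D.per k) :
    (D.rep g (k + 1) + m) / D.per (k + 1) = (D.rep g (k + 1) + n) / D.per (k + 1) := by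
  wlog hle : m ≤ n generalizing m n
  · exact (this hn hm (by rwa [abs_sub_comm]) (le_of_not_ge hle)).symm
  rw [abs_of_nonneg (sub_nonneg.2 hle)] at hmn
  set P : ℤ := (D.per (k + 1) : ℤ) with hP
  have h1 := (D.symbol_succ_eq_none_iff.1 hn).2
  have h2 : (D.per k : ℤ) ≤ D.res (k + 1) (D.rep g (k + 1) + n) := by
    exact_mod_cast (Nat.le_mul_of_pos_left _ (D.r_pos k)).trans h1
  have h3 := D.res_lt (k + 1) (D.rep g (k + 1) + n)
  zify at h3
  rw [D.coe_res, ← hP] at h2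
  rw [D.coe_res, ← hP] at h3
  have hP0 : 0 < P := D.per_pos' (k + 1)
  have h4 := Int.mul_ediv_add_emod (D.rep g (k + 1) + n) P
  set e := (D.rep g (k + 1) + n) / P with he
  have h5 : D.rep g (k + 1) + m = (D.rep g (k + 1) + n) % P - (n - m) + P * e := by linarith
  rw [h5, Int.add_mul_ediv_left _ _ hP0.ne', Int.ediv_eq_zero_of_lt (by linarith) (by linarith),
    zero_add]

/-! ### The points of the subshift -/

lemma limitSequence_eq_of_symbol {k : ℕ} {n : ℤ} (hn : 0 ≤ n) {v : Fin 2}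
    (hv : D.symbol k n = some v) : limitSequence D.q D.r D.s n.toNat = v := by
  lift n to ℕ using hn
  rw [Int.toNat_natCast]
  have h1 : limitSequence D.q D.r D.s n = 1 ↔ v = 1 := by
    classical
    rw [limitSequence, ite_eq_left_iff]
    constructor
    · intro H
      have : ∃ l, fill D.q D.r D.s l n = some 1 := by
        by_contra hc
        exact zero_ne_one (H hc)
      obtain ⟨l, hl⟩ := this
      rw [← D.symbol_natCast] at hl
      have h2 := D.symbol_mono (le_max_left k l) hv
      have h3 := D.symbol_mono (le_max_right k l) hl
      rw [h2] at h3
      exact Option.some_injective _ h3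
    · rintro rfl hc
      exact (hc ⟨k, by rw [← D.symbol_natCast, hv]⟩).elim
  lia

lemma exists_symbol_of_limitSequence_eq_one {n : ℤ} (hn : 0 ≤ n)
    (h1 : limitSequence D.q D.r D.s n.toNat = 1) : ∃ k, D.symbol k n = some 1 := by
  lift n to ℕ using hn
  rw [Int.toNat_natCast, limitSequence] at h1
  split_ifs at h1 with h2
  · obtain ⟨k, hk⟩ := h2
    exact ⟨k, by rw [D.symbol_natCast, hk]⟩
  · exact (zero_ne_one h1).elim

/-- Every nonnegative position is filled eventually. -/
lemma exists_symbol_eq_some {n : ℤ} (hn : 0 ≤ n) :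
    ∃ k, D.symbol k n = some (limitSequence D.q D.r D.s n.toNat) := by
  have h1 : D.symbol (n.toNat + 1) n ≠ none := by
    intro h
    have h2 := (D.symbol_succ_eq_none_iff.1 h).2
    have h3 : D.res (n.toNat + 1) n ≤ n.toNat := by
      conv_lhs => rw [← Int.toNat_of_nonneg hn]
      rw [D.res_natCast]
      exact Nat.mod_le _ _
    have h4 := D.lt_per n.toNat
    have h5 := Nat.le_mul_of_pos_left (D.per n.toNat) (D.r_pos n.toNat)
    lia
  obtain ⟨v, hv⟩ := Option.ne_none_iff_exists'.1 h1
  exact ⟨_, by rw [limitSequence_eq_of_symbol hn hv, hv]⟩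

lemma mem_subshift_iff : z ∈ D.subshift.carrier ↔
    ∀ (a : ℤ) (n : ℕ), ∃ m : ℕ, ∀ i < n, z (a + i) = limitSequence D.q D.r D.s (m + i) := Iff.rfl

/-- For a point `z` of the subshift there is a point `g` of the adding machine such that long
central windows of `z` occur in the one-sided sequence at positions close to `g`. -/
lemma exists_approx_of_mem (hz : z ∈ D.subshift.carrier) :
    ∃ g : D.scale.addingMachine, ∀ k N : ℕ, ∃ t : ℤ, t ≡ D.rep g k [ZMOD D.per k] ∧
      ∀ n : ℤ, |n| ≤ N → 0 ≤ t + n ∧ z n = limitSequence D.q D.r D.s (t + n).toNat := by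
  choose m hm using fun N : ℕ => mem_subshift_iff.1 hz (-N) (2 * N + 1)
  obtain ⟨g, hg⟩ := exists_clusterPt_of_compactSpace
    (map (fun N : ℕ => (0 : D.scale.addingMachine) + ((m N + N : ℕ) : ℤ) • D.scale.one) atTop)
  refine ⟨g, fun k N0 => ?_⟩
  have hopen : IsOpen {h : D.scale.addingMachine | D.rep h k = D.rep g k} :=
    (isOpen_discrete {D.rep g k}).preimage (D.continuous_rep k)
  have h1 := hg.frequently (p := fun h => D.rep h k = D.rep g k) (hopen.mem_nhds rfl)
  rw [frequently_map] at h1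
  obtain ⟨N, hN, hrep⟩ := (frequently_atTop.1 h1) N0
  refine ⟨((m N + N : ℕ) : ℤ), ?_, fun n hn => ?_⟩
  · rw [← hrep]
    have h2 := D.rep_add_zsmul_one 0 ((m N + N : ℕ) : ℤ) k
    have h3 : D.rep 0 k ≡ 0 [ZMOD D.per k] := by
      cases k with
      | zero => exact D.modEq_zero _ _
      | succ k => exact (D.intCast_eq_iff_modEq_rep.1 (by simp)).symm
    have h4 := h2.trans (h3.add_right _)
    rw [zero_add ((m N + N : ℕ) : ℤ)] at h4
    exact h4.symm
  · have hn' : |n| ≤ N := hn.trans (by exact_mod_cast hN)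
    rw [abs_le] at hn'
    obtain ⟨i, hi⟩ := Int.eq_ofNat_of_zero_le (by linarith : 0 ≤ n + N)
    have h2 := hm N i (by lia)
    refine ⟨by push_cast; linarith, ?_⟩
    rw [show n = -(N : ℤ) + i by linarith, h2]
    congr 1
    lia

/-- The points of the subshift over `g`, in terms of the skeleton of `g`. -/
structure IsPointOver (g : D.scale.addingMachine) (z : ℤ → Fin 2) : Prop where
  ext : D.Extends g z
  atMostOne : ∀ m ∈ D.holes g, ∀ n ∈ D.holes g, z m = 1 → z n = 1 → m = n

/-- Every point of the subshift lies over some point of the adding machine. Two symbols `1` at holes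
would lie in one aligned block of high level, together with their approximations in the one-sided
sequence, where such a block receives at most one `1` after that level. -/
theorem exists_isPointOver_of_mem (hz : z ∈ D.subshift.carrier) : ∃ g, D.IsPointOver g z := by
  obtain ⟨g, hg⟩ := exists_approx_of_mem hz
  refine ⟨g, fun k n v hv => ?_, fun m hm n hn hm1 hn1 => ?_⟩
  · obtain ⟨t, ht, hw⟩ := hg k n.natAbs
    obtain ⟨h1, h2⟩ := hw n (by simp)
    rw [h2]
    refine limitSequence_eq_of_symbol h1 (k := k) ?_
    rw [← hv]
    exact D.symbol_congr (ht.add_right n)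
  · obtain ⟨k, hk⟩ : ∃ k : ℕ, |n - m| < D.per k :=
      ⟨(n - m).natAbs, by
        have := D.lt_per (n - m).natAbs
        zify at this
        exact this⟩
    obtain ⟨t, ht, hw⟩ := hg (k + 1) (max m.natAbs n.natAbs)
    obtain ⟨h1, h2⟩ := hw m (by simp)
    obtain ⟨h3, h4⟩ := hw n (by simp)
    rw [hm1] at h2
    rw [hn1] at h4
    obtain ⟨l, hl⟩ := exists_symbol_of_limitSequence_eq_one h1 h2.symm
    obtain ⟨l', hl'⟩ := exists_symbol_of_limitSequence_eq_one h3 h4.symm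
    obtain ⟨c, hc⟩ := ht.symm.dvd
    have key : ∀ x : ℤ, (t + x) / D.per (k + 1) = (D.rep g (k + 1) + x) / D.per (k + 1) + c :=
      fun x => by
        rw [show t + x = D.rep g (k + 1) + x + D.per (k + 1) * c by linarith,
          Int.add_mul_ediv_left _ _ (D.per_pos' _).ne']
    have h5 := D.eq_of_symbol_eq_one (k := k + 1) (m := t + m) (n := t + n) (l := max l l')
      (by rw [key, key, ediv_eq_of_skeleton_eq_none (hm _) (hn _) hk])
      (by rw [← hm (k + 1)]; exact D.symbol_congr (ht.add_right m))
      (by rw [← hn (k + 1)]; exact D.symbol_congr (ht.add_right n))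
      (D.symbol_mono (le_max_left _ _) hl) (D.symbol_mono (le_max_right _ _) hl')
    linarith

end Parameters
end OdometerModel

namespace OdometerModel
namespace Parameters

/-! ### The sequences over a point of the adding machine belong to the subshift -/

variable {D : Parameters} {g h : D.scale.addingMachine} {z : ℤ → Fin 2}

lemma add_ediv_eq_of_modEq {P s t : ℤ} (hP : P ≠ 0) (hst : s ≡ t [ZMOD P]) (x : ℤ) :
    (s + x) / P = (t + x) / P + (s - t) / P := by
  obtain ⟨c, hc⟩ := hst.symm.dvd
  rw [hc, Int.mul_ediv_cancel_left _ hP, show s + x = t + x + P * c by linarith,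
    Int.add_mul_ediv_left _ _ hP]

lemma ediv_eq_of_rep {k l : ℕ} (hkl : k ≤ l) {m n : ℤ}
    (hmn : (D.rep g k + m) / D.per k = (D.rep g k + n) / D.per k) :
    (D.rep g l + m) / D.per k = (D.rep g l + n) / D.per k := by
  rw [add_ediv_eq_of_modEq (D.per_pos' k).ne' (D.rep_modEq hkl g),
    add_ediv_eq_of_modEq (D.per_pos' k).ne' (D.rep_modEq hkl g), hmn]

/-- In a point of the subshift, at most one of the positions in an aligned block of length `p_k`
that are unfilled after `k` steps carries the symbol `1`. -/
lemma IsPointOver.eq_of_ediv_eq (hz : D.IsPointOver g z) {k : ℕ} {m n : ℤ}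
    (hmn : (D.rep g k + m) / D.per k = (D.rep g k + n) / D.per k)
    (hm : D.skeleton g k m = none) (hn : D.skeleton g k n = none) (hm1 : z m = 1) (hn1 : z n = 1) :
    m = n := by
  have key : ∀ l, k ≤ l → (D.skeleton g l m = none ↔ D.skeleton g l n = none) := fun l hl =>
    D.symbol_eq_none_iff_of_ediv_eq hl (ediv_eq_of_rep hl hmn)
      (by rw [← skeleton_eq_symbol hl, hm]) (by rw [← skeleton_eq_symbol hl, hn])
  by_cases h0 : ∀ l, k ≤ l → D.skeleton g l m = none
  · have hole : ∀ x : ℤ, (∀ l, k ≤ l → D.skeleton g l x = none) → x ∈ D.holes g := fun x hx l => by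
      rw [skeleton_eq_symbol (le_max_left l k)]
      exact D.symbol_eq_none_of_le (le_max_left l k) (hx _ (le_max_right l k))
    exact hz.atMostOne m (hole m h0) n (hole n fun l hl => (key l hl).1 (h0 l hl)) hm1 hn1
  · push Not at h0
    obtain ⟨l, hl, h1⟩ := h0
    obtain ⟨v, hv⟩ := Option.ne_none_iff_exists'.1 h1
    obtain ⟨w, hw⟩ := Option.ne_none_iff_exists'.1 fun hc => h1 ((key l hl).2 hc)
    have h2 := hz.ext _ _ _ hv
    have h3 := hz.ext _ _ _ hw
    rw [hm1] at h2
    rw [hn1] at h3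
    subst h2 h3
    have := D.eq_of_symbol_eq_one (ediv_eq_of_rep hl hmn)
      (by rw [← skeleton_eq_symbol hl, hm]) (by rw [← skeleton_eq_symbol hl, hn]) hv hw
    linarith

/-- Conversely, every sequence that extends the skeleton of `g` and has at most one symbol `1` at
the remaining positions belongs to the subshift: the index of this symbol among the unfilled
positions of a long block is realized by some block of the construction. -/
theorem IsPointOver.mem_subshift (hz : D.IsPointOver g z) : z ∈ D.subshift.carrier := by
  rw [mem_subshift_iff]
  intro a L
  -- a level at which all fillable positions of the window are filled
  obtain ⟨K0, hK0⟩ : ∃ K0, ∀ i < L, ∀ K ≥ K0, D.skeleton g K (a + i) = none →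
      a + (i : ℤ) ∈ D.holes g := by
    have : ∀ i : ℕ, ∃ K0, ∀ K ≥ K0, D.skeleton g K (a + i) = none → a + (i : ℤ) ∈ D.holes g := by
      intro i
      by_cases hi : a + (i : ℤ) ∈ D.holes g
      · exact ⟨0, fun _ _ _ => hi⟩
      · obtain ⟨k, v, hv⟩ := exists_skeleton_of_notMem_holes hi
        exact ⟨k, fun K hK hc => by rw [skeleton_mono hK hv] at hc; cases hc⟩
    choose K1 hK1 using this
    exact ⟨(Finset.range L).sup K1, fun i hi K hK =>
      hK1 i K ((Finset.le_sup (f := K1) (Finset.mem_range.2 hi)).trans hK)⟩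
  obtain ⟨K2, hK2⟩ := D.exists_lt_unf L
  set k := max K0 (max K2 L) with hk
  set K := k + 1 with hKdef
  set t := D.rep g K with ht
  have hKK0 : K0 ≤ K := (le_max_left _ _).trans k.le_succ
  have hLunf : L < D.unf K := hK2 K (((le_max_left _ _).trans (le_max_right _ _)).trans k.le_succ)
  have hLper : L < D.per k :=
    (((le_max_right _ _).trans (le_max_right _ _) : L ≤ k)).trans_lt (D.lt_per k)
  have hblock : ∀ i < L, ∀ j < L, a + (i : ℤ) ∈ D.holes g → a + (j : ℤ) ∈ D.holes g →
      (t + (a + i)) / D.per K = (t + (a + j)) / D.per K := fun i hi j hj hi' hj' =>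
    ediv_eq_of_skeleton_eq_none (hi' K) (hj' K) (by rw [abs_lt]; lia)
  obtain ⟨e, he⟩ : ∃ e : ℤ, ∀ i < L, a + (i : ℤ) ∈ D.holes g → (t + (a + i)) / D.per K = e := by
    by_cases h0 : ∃ j < L, a + (j : ℤ) ∈ D.holes g
    · obtain ⟨j, hj, hj'⟩ := h0
      exact ⟨_, fun i hi hi' => hblock i hi j hj hi' hj'⟩
    · push Not at h0
      exact ⟨0, fun i hi hi' => (h0 i hi hi').elim⟩
  -- the index at which the symbol `1` is wanted; an index outside the window if there is none
  obtain ⟨c, hc, hcz⟩ : ∃ c < D.unf K, ∀ i < L, a + (i : ℤ) ∈ D.holes g →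
      (z (a + i) = 1 ↔ D.rank K (t + (a + i)) = c) := by
    by_cases h0 : ∃ j < L, a + (j : ℤ) ∈ D.holes g ∧ z (a + j) = 1
    · obtain ⟨j, hj, hj', hj1⟩ := h0
      refine ⟨_, D.rank_lt (hj' K), fun i hi hi' => ⟨fun h1 => ?_, fun h1 => ?_⟩⟩
      · rw [hz.atMostOne _ hi' _ hj' h1 hj1]
      · have h2 := D.modEq_of_rank_eq (hi' K) (hj' K) h1
        have h3 := D.eq_of_ediv_eq_of_res_eq (hblock i hi j hj hi' hj') (D.res_eq_iff.2 h2)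
        rw [show a + (i : ℤ) = a + j by linarith, hj1]
    · push Not at h0
      obtain ⟨c, hc, hc'⟩ := Finset.exists_mem_notMem_of_card_lt_card
        (s := (Finset.range L).image fun i : ℕ => D.rank K (t + (a + i)))
        (t := Finset.range (D.unf K))
        (Finset.card_image_le.trans_lt (by simpa using hLunf))
      refine ⟨c, Finset.mem_range.1 hc, fun i hi hi' => ⟨fun h1 => (h0 i hi hi' h1).elim,
        fun h1 => (hc' (Finset.mem_image.2 ⟨i, Finset.mem_range.2 hi, h1⟩)).elim⟩⟩
  obtain ⟨j, hKj, -, m, hm0, hm1, hmc⟩ := D.exists_symbol_eq_one hc K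
  set J : ℤ := (m : ℤ) / D.per K
  have hPK := D.per_pos' K
  set B : ℤ := |t + D.per K * (J - e) + a|
  have hB : 0 ≤ B := abs_nonneg _
  obtain ⟨f, hf⟩ := D.per_dvd_per (hKj.trans j.le_succ)
  -- `s` is the position of the one-sided sequence that corresponds to the position `0` of `z`,
  -- and `m'` the position of the symbol `1` in the block containing the window
  set s : ℤ := t + D.per K * (J - e) + D.per (j + 1) * B with hs
  set m' : ℤ := m + D.per (j + 1) * B with hm'
  have hm'1 : D.symbol (j + 1) m' = some 1 := by
    rw [← hm1]
    exact D.symbol_congr (by rw [Int.modEq_iff_dvd]; exact ⟨-B, by rw [hm']; ring⟩)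
  have hm'K : m' ≡ m [ZMOD D.per K] := by
    rw [Int.modEq_iff_dvd]
    exact ⟨-f * B, by rw [hm', hf]; push_cast; ring⟩
  have hm'0 : D.symbol K m' = none := by
    rw [D.symbol_congr hm'K, D.symbol_eq_none_of_le hKj hm0]
  have hm'c : D.rank K m' = c := by rw [D.rank_congr hm'K, hmc]
  have hm'div : m' / D.per K = J + f * B := by
    rw [hm', hf, Nat.cast_mul, mul_assoc, Int.add_mul_ediv_left _ _ hPK.ne']
  have hst : ∀ x, s + x ≡ t + x [ZMOD D.per K] := fun x => by
    rw [Int.modEq_iff_dvd]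
    exact ⟨-(J - e) - f * B, by rw [hs, hf]; push_cast; ring⟩
  have hsdiv : ∀ i < L, a + (i : ℤ) ∈ D.holes g → (s + (a + i)) / D.per K = J + f * B := by
    intro i hi hi'
    rw [show s + (a + i) = t + (a + i) + D.per K * (J - e + f * B) by
      rw [hs, hf]; push_cast; ring, Int.add_mul_ediv_left _ _ hPK.ne', he i hi hi']
    ring
  have hsa : 0 ≤ s + a := by
    have h1 : -B ≤ t + D.per K * (J - e) + a := neg_abs_le _
    have h2 : 1 * B ≤ D.per (j + 1) * B :=
      mul_le_mul_of_nonneg_right (D.per_pos' (j + 1)) hB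
    linarith
  refine ⟨(s + a).toNat, fun i hi => ?_⟩
  have hnn : 0 ≤ s + (a + i) := by linarith
  rw [show (s + a).toNat + i = (s + (a + i)).toNat by lia]
  by_cases hi' : a + (i : ℤ) ∈ D.holes g
  · have hi0 : D.symbol K (s + (a + i)) = none := by
      rw [D.symbol_congr (hst _)]
      exact hi' K
    have hblk : (s + (a + i)) / D.per K = m' / D.per K := by rw [hsdiv i hi hi', hm'div]
    have key : z (a + i) = 1 ↔ limitSequence D.q D.r D.s (s + (a + i)).toNat = 1 := by
      rw [hcz i hi hi', ← D.rank_congr (hst _), ← hm'c]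
      constructor
      · intro h1
        have h2 := D.eq_of_ediv_eq_of_res_eq hblk
          (D.res_eq_iff.2 (D.modEq_of_rank_eq hi0 hm'0 h1))
        exact limitSequence_eq_of_symbol hnn (by rw [h2, hm'1])
      · intro h1
        obtain ⟨l, hl⟩ := exists_symbol_of_limitSequence_eq_one hnn h1
        rw [D.eq_of_symbol_eq_one hblk hi0 hm'0 (D.symbol_mono (le_max_left l (j + 1)) hl)
          (D.symbol_mono (le_max_right l (j + 1)) hm'1)]
    lia
  · obtain ⟨v, hv⟩ := Option.ne_none_iff_exists'.1 fun hc => hi' (hK0 i hi K hKK0 hc)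
    rw [hz.ext _ _ _ hv]
    refine (limitSequence_eq_of_symbol hnn (k := K) ?_).symm
    rw [D.symbol_congr (hst _)]
    exact hv

/-! ### Periodic and aperiodic parts -/

/-- A position unfilled after `k` steps is congruent modulo `p_k` to positions that later receive
each of the two symbols. -/
lemma exists_modEq_skeleton_eq {k : ℕ} {n : ℤ} (hn : D.skeleton g k n = none) (v : Fin 2) :
    ∃ l ≥ k, ∃ n' : ℤ, n' ≡ n [ZMOD D.per k] ∧ D.skeleton g l n' = some v := by
  obtain ⟨j, hkj, m, hm0, hmv, hmr⟩ : ∃ j ≥ k, ∃ m : ℕ, D.symbol j m = none ∧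
      D.symbol (j + 1) m = some v ∧ D.rank k m = D.rank k (D.rep g k + n) := by
    have hlt := D.rank_lt hn
    rcases (by lia : v = 0 ∨ v = 1) with rfl | rfl
    · exact D.exists_symbol_eq_zero hlt
    · obtain ⟨j, -, hkj, m, h1⟩ := D.exists_symbol_eq_one hlt 0
      exact ⟨j, hkj, m, h1⟩
  have h1 := D.modEq_of_rank_eq (D.symbol_eq_none_of_le hkj hm0) hn hmr
  refine ⟨j + 1, hkj.trans j.le_succ, m - D.rep g (j + 1), ?_, ?_⟩
  · have h2 := h1.sub (D.rep_modEq (hkj.trans j.le_succ) g)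
    simpa using h2
  · rw [skeleton, add_sub_cancel, hmv]

/-- The periodic part with period `p_k` consists of the positions filled after `k` steps. -/
lemma Extends.periodicPart_eq (hz : D.Extends g z) (k : ℕ) :
    periodicPart (D.per k) z = {n | D.skeleton g k n ≠ none} := by
  ext n
  constructor
  · intro hn h0
    have key : ∀ v, z n = v := fun v => by
      obtain ⟨l, -, n', h1, h2⟩ := exists_modEq_skeleton_eq h0 v
      obtain ⟨c, hc⟩ := h1.symm.dvd
      rw [hn c, ← hz _ _ _ h2]
      congr 1
      linarith
    exact zero_ne_one ((key 0).symm.trans (key 1))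
  · intro hn m
    obtain ⟨v, hv⟩ := Option.ne_none_iff_exists'.1 hn
    rw [hz _ _ _ hv, hz k (n + m * D.per k) v]
    rw [← hv]
    exact skeleton_congr (by rw [Int.modEq_iff_dvd]; exact ⟨-m, by ring⟩)

/-- No hole belongs to a periodic part, even for periods `p` unrelated to the scale: the subgroup
generated by `p` and a large `p_l` contains a fixed `p_K`, and the class of the hole modulo `p_K`
receives both symbols. -/
lemma Extends.aperiodicPart_eq (hz : D.Extends g z) : aperiodicPart z = D.holes g := by
  ext n
  constructor
  · intro hn k
    by_contra hc
    exact hn (D.per k) (D.per_pos k) (by rw [hz.periodicPart_eq]; exact hc)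
  · intro hn p hp hnp
    -- the common divisor of `p` and the periods `p_k` stabilizes
    obtain ⟨K, hK⟩ : ∃ K, ∀ k, Nat.gcd p (D.per k) ≤ Nat.gcd p (D.per K) := by
      have hbdd : BddAbove (Set.range fun k => Nat.gcd p (D.per k)) :=
        ⟨p, by rintro _ ⟨k, rfl⟩; exact Nat.gcd_le_left _ hp⟩
      obtain ⟨K, hK⟩ := Nat.sSup_mem (Set.range_nonempty _) hbdd
      exact ⟨K, fun k => by
        simp only at hK
        rw [hK]
        exact le_csSup hbdd ⟨k, rfl⟩⟩
    have key : ∀ v, z n = v := fun v => by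
      obtain ⟨l, hl, n', h1, h2⟩ := exists_modEq_skeleton_eq (hn K) v
      have hgcd : Nat.gcd p (D.per l) ∣ D.per K := by
        have h3 : Nat.gcd p (D.per K) ∣ Nat.gcd p (D.per l) :=
          Nat.gcd_dvd_gcd_of_dvd_right _ (D.per_dvd_per hl)
        rw [Nat.le_antisymm (hK l) (Nat.le_of_dvd (Nat.gcd_pos_of_pos_left _ hp) h3)]
        exact Nat.gcd_dvd_right _ _
      obtain ⟨c, hc⟩ := h1.symm.dvd
      obtain ⟨d, hd⟩ := hgcd
      have hbez := Nat.gcd_eq_gcd_ab p (D.per l)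
      rw [hnp (Nat.gcdA p (D.per l) * d * c)]
      refine hz l _ v ?_
      rw [← h2]
      refine skeleton_congr ?_
      rw [Int.modEq_iff_dvd]
      refine ⟨Nat.gcdB p (D.per l) * d * c, ?_⟩
      have h4 : (D.per K : ℤ) = Nat.gcd p (D.per l) * d := by exact_mod_cast hd
      rw [h4, hbez] at hc
      linear_combination hc
    exact zero_ne_one ((key 0).symm.trans (key 1))

/-! ### Uniqueness of the point of the adding machine -/

/-- A sequence extends the skeleton of at most one point of the adding machine, since the set of
unfilled positions determines the position relative to each period. -/
theorem Extends.unique (hg : D.Extends g z) (hh : D.Extends h z) : g = h := by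
  refine D.addingMachine_ext fun k => ?_
  induction k with
  | zero => exact D.modEq_zero _ _
  | succ k ih =>
    have hiff : ∀ n, D.skeleton g (k + 1) n = none ↔ D.skeleton h (k + 1) n = none := fun n => by
      have := Set.ext_iff.1 ((hg.periodicPart_eq (k + 1)).symm.trans (hh.periodicPart_eq (k + 1))) n
      exact not_iff_not.1 this
    have hk : D.rep g (k + 1) ≡ D.rep h (k + 1) [ZMOD D.per k] :=
      ((D.rep_modEq k.le_succ g).trans ih).trans (D.rep_modEq k.le_succ h).symm
    obtain ⟨v, hv⟩ := hk.dvd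
    obtain ⟨m, hm0, -⟩ := D.exists_symbol_succ_eq (k := k) (u := 0)
      (Nat.mul_pos (D.r_pos k) (D.unf_pos k))
    have hP := D.per_pos' k
    have hr := D.r_pos k
    have hrq := D.r_lt k
    have hhole : ∀ b : ℤ, D.symbol (k + 1) ((m : ℤ) + D.per k * b) = none ↔
        (D.r k : ℤ) ≤ ((m : ℤ) / D.per k + b) % D.q k := fun b => by
      rw [D.symbol_succ_eq_none_iff, D.mul_per_le_res_succ_iff, Int.add_mul_ediv_left _ _ hP.ne']
      have : D.symbol k ((m : ℤ) + D.per k * b) = none := by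
        rw [← hm0]
        exact D.symbol_congr (by rw [Int.modEq_iff_dvd]; exact ⟨-b, by ring⟩)
      simp [this]
    have hshift : ∀ b : ℤ, (D.r k : ℤ) ≤ b % D.q k ↔ (D.r k : ℤ) ≤ (b + v) % D.q k := fun b => by
      have h1 := hhole (b - (m : ℤ) / D.per k)
      have h2 := hhole (b + v - (m : ℤ) / D.per k)
      rw [add_sub_cancel] at h1 h2
      rw [← h1, ← h2]
      have h3 := hiff ((m : ℤ) + D.per k * (b - (m : ℤ) / D.per k) - D.rep g (k + 1))
      rw [skeleton, skeleton, add_sub_cancel] at h3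
      rw [h3, show D.rep h (k + 1) + ((m : ℤ) + D.per k * (b - (m : ℤ) / D.per k)
        - D.rep g (k + 1)) = (m : ℤ) + D.per k * (b + v - (m : ℤ) / D.per k) by
          linear_combination hv]
    have hqv : (D.q k : ℤ) ∣ v := by
      have h1 := hshift 0
      have h2 := hshift (-1)
      have hq : (0 : ℤ) < D.q k := by exact_mod_cast D.q_pos k
      have h3 : (-1 : ℤ) % D.q k = D.q k - 1 := by
        rw [← Int.add_emod_right, Int.emod_eq_of_lt] <;> lia
      rw [zero_add, Int.zero_emod] at h1
      rw [h3] at h2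
      have h4 := Int.emod_nonneg v hq.ne'
      have h5 : v % D.q k < D.r k := by lia
      have h6 : (D.r k : ℤ) ≤ (-1 + v) % D.q k := by lia
      by_contra hc
      have h7 : 0 < v % D.q k := lt_of_le_of_ne h4 fun h => hc (Int.dvd_of_emod_eq_zero h.symm)
      have h8 : (-1 + v) % D.q k = v % D.q k - 1 := by
        rw [← Int.add_emod_emod, Int.emod_eq_of_lt] <;> lia
      lia
    obtain ⟨w, rfl⟩ := hqv
    rw [Int.modEq_iff_dvd]
    exact ⟨w, by rw [hv, D.per_succ]; push_cast; ring⟩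

end Parameters
end OdometerModel

namespace OdometerModel

/-! ### Windows and powers of the shift -/

lemma shiftHomeo_zpow_apply (X : BinarySubshift) (n : ℤ) (x : X.carrier) :
    ((shiftHomeo X ^ n) x).1 = SymbolicDynamics.FullShift.shift n x.1 := by
  induction n using Int.induction_on generalizing x with
  | zero => simp
  | succ i ih =>
    rw [zpow_add_one, Homeomorph.mul_apply, ih]
    funext m
    change x.1 (1 + (i + m)) = x.1 (i + 1 + m)
    exact congrArg x.1 (by ring)
  | pred i ih =>
    rw [zpow_sub_one, Homeomorph.mul_apply, ih]
    funext m
    change x.1 (-1 + (-i + m)) = x.1 (-i - 1 + m)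
    exact congrArg x.1 (by ring)

lemma exists_window_subset_of_mem_nhds {x : ℤ → Fin 2} {U : Set (ℤ → Fin 2)} (hU : U ∈ 𝓝 x) :
    ∃ N : ℕ, ∀ y : ℤ → Fin 2, (∀ n : ℤ, |n| ≤ N → y n = x n) → y ∈ U := by
  obtain ⟨V, hVU, hV, hx⟩ := mem_nhds_iff.1 hU
  obtain ⟨I, u, h1, h2⟩ := isOpen_pi_iff.1 hV x hx
  refine ⟨I.sup Int.natAbs, fun y hy => hVU (h2 fun n hn => ?_)⟩
  have h3 := Finset.le_sup (f := Int.natAbs) hn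
  rw [hy n (by rw [Int.abs_eq_natAbs]; exact_mod_cast h3)]
  exact (h1 n hn).2

lemma exists_window_of_mem_nhds {X : BinarySubshift} {x : X.carrier} {U : Set X.carrier}
    (hU : U ∈ 𝓝 x) :
    ∃ N : ℕ, ∀ y : X.carrier, (∀ n : ℤ, |n| ≤ N → y.1 n = x.1 n) → y ∈ U := by
  rw [nhds_subtype_eq_comap] at hU
  obtain ⟨V, hV, hVU⟩ := mem_comap.1 hU
  obtain ⟨N, hN⟩ := exists_window_subset_of_mem_nhds hV
  exact ⟨N, fun y hy => hVU (hN y.1 hy)⟩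

instance compactSpace_carrier (X : BinarySubshift) : CompactSpace X.carrier :=
  isCompact_iff_compactSpace.mp X.isClosed.isCompact

namespace Parameters

variable (D : Parameters) {g h : D.scale.addingMachine} {z : ℤ → Fin 2}

/-! ### The factor map to the adding machine and its fibres -/

/-- The factor map from the subshift to the adding machine. -/
noncomputable def factor (z : D.subshift.carrier) : D.scale.addingMachine :=
  (exists_isPointOver_of_mem z.2).choose

lemma isPointOver_factor (z : D.subshift.carrier) : D.IsPointOver (D.factor z) z.1 :=
  (exists_isPointOver_of_mem z.2).choose_spec

variable {D}

lemma Extends.factor_eq {z : D.subshift.carrier} (hz : D.Extends g z.1) : D.factor z = g :=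
  (D.isPointOver_factor z).ext.unique hz

open scoped Classical in
/-- The sequence that extends the skeleton of `g` and agrees with `y` at all positions that remain
unfilled. -/
noncomputable def fillHoles (g : D.scale.addingMachine) (y : ℤ → Fin 2) (n : ℤ) : Fin 2 :=
  if (∃ k, D.skeleton g k n = some 1) ∨ (n ∈ D.holes g ∧ y n = 1) then 1 else 0

lemma extends_fillHoles (g : D.scale.addingMachine) (y : ℤ → Fin 2) :
    D.Extends g (fillHoles g y) := by
  intro k n v hv
  have h1 : fillHoles g y n = 1 ↔ v = 1 := by
    classical
    rw [fillHoles, ite_eq_left_iff]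
    constructor
    · intro H
      by_contra hc
      refine zero_ne_one (H ?_)
      rintro (⟨l, hl⟩ | ⟨hn, -⟩)
      · have h2 := skeleton_mono (le_max_left k l) hv
        rw [skeleton_mono (le_max_right k l) hl] at h2
        exact hc (Option.some_injective _ h2).symm
      · rw [hn k] at hv
        cases hv
    · rintro rfl hc
      exact (hc (.inl ⟨k, hv⟩)).elim
  lia

lemma fillHoles_of_mem {g : D.scale.addingMachine} {n : ℤ} (hn : n ∈ D.holes g) (y : ℤ → Fin 2) :
    fillHoles g y n = y n := by
  have h1 : fillHoles g y n = 1 ↔ y n = 1 := by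
    classical
    rw [fillHoles, ite_eq_left_iff]
    constructor
    · intro H
      by_contra hc
      refine zero_ne_one (H ?_)
      rintro (⟨l, hl⟩ | ⟨-, h⟩)
      · rw [hn l] at hl
        cases hl
      · exact hc h
    · intro h hc
      exact (hc (.inr ⟨hn, h⟩)).elim
  lia

lemma isPointOver_fillHoles (g : D.scale.addingMachine) {y : ℤ → Fin 2}
    (hy : ∀ m ∈ D.holes g, ∀ n ∈ D.holes g, y m = 1 → y n = 1 → m = n) :
    D.IsPointOver g (fillHoles g y) where
  ext := extends_fillHoles g y
  atMostOne m hm n hn := by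
    rw [fillHoles_of_mem hm, fillHoles_of_mem hn]
    exact hy m hm n hn

variable (D) in
/-- The point over `g` whose symbols at the positions that remain unfilled are all `0`. -/
noncomputable def zeroPoint (g : D.scale.addingMachine) : D.subshift.carrier :=
  ⟨fillHoles g 0, (isPointOver_fillHoles g (by simp)).mem_subshift⟩

lemma factor_zeroPoint (g : D.scale.addingMachine) : D.factor (D.zeroPoint g) = g :=
  Extends.factor_eq (extends_fillHoles g 0)

lemma IsPointOver.eq_of_notMem_holes {z z' : ℤ → Fin 2} (hz : D.IsPointOver g z)
    (hz' : D.IsPointOver g z') {n : ℤ} (hn : n ∉ D.holes g) : z n = z' n := by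
  obtain ⟨k, v, hv⟩ := exists_skeleton_of_notMem_holes hn
  rw [hz.ext _ _ _ hv, hz'.ext _ _ _ hv]

lemma aperiodicPart_eq_holes_factor (z : D.subshift.carrier) :
    aperiodicPart z.1 = D.holes (D.factor z) :=
  (D.isPointOver_factor z).ext.aperiodicPart_eq

/-- Two points of the same fibre differ at finitely many positions only. -/
lemma exists_forall_eq_of_factor_eq {z z' : D.subshift.carrier} (h : D.factor z = D.factor z') :
    ∃ N : ℕ, ∀ n : ℤ, N < |n| → z.1 n = z'.1 n := by
  have hz := D.isPointOver_factor z
  have hz' := D.isPointOver_factor z'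
  rw [← h] at hz'
  have key : ∀ w : ℤ → Fin 2, D.IsPointOver (D.factor z) w →
      ∃ N : ℕ, ∀ n : ℤ, N < |n| → n ∈ D.holes (D.factor z) → w n = 0 := by
    intro w hw
    by_cases h0 : ∃ m ∈ D.holes (D.factor z), w m = 1
    · obtain ⟨m, hm, hm1⟩ := h0
      refine ⟨m.natAbs, fun n hn hn' => ?_⟩
      by_contra hc
      have : m = n := hw.atMostOne m hm n hn' hm1 (by lia)
      subst this
      simp at hn
    · push Not at h0
      exact ⟨0, fun n _ hn => by have := h0 n hn; lia⟩
  obtain ⟨N, hN⟩ := key _ hz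
  obtain ⟨N', hN'⟩ := key _ hz'
  refine ⟨max N N', fun n hn => ?_⟩
  push_cast at hn
  by_cases hn0 : n ∈ D.holes (D.factor z)
  · rw [hN n (lt_of_le_of_lt (le_max_left _ _) hn) hn0,
      hN' n (lt_of_le_of_lt (le_max_right _ _) hn) hn0]
  · exact hz.eq_of_notMem_holes hz' hn0

variable (D)

/-- The graph of the factor map is closed and the adding machine is compact. -/
theorem continuous_factor : Continuous D.factor := by
  rw [continuous_iff_isClosed]
  intro C hC
  have hgraph :
      IsClosed {p : D.subshift.carrier × D.scale.addingMachine | D.Extends p.2 p.1.1} := by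
    simp only [Extends, Set.ofPred_forall]
    refine isClosed_iInter fun k => isClosed_iInter fun n => isClosed_iInter fun v => ?_
    have h1 : Continuous fun p : D.subshift.carrier × D.scale.addingMachine =>
        (D.rep p.2 k, p.1.1 n) :=
      ((D.continuous_rep k).comp continuous_snd).prodMk
        ((continuous_apply n).comp (continuous_subtype_val.comp continuous_fst))
    exact (isClosed_discrete {p : ℤ × Fin 2 | D.symbol k (p.1 + n) = some v → p.2 = v}).preimage h1
  have h2 := isClosedMap_fst_of_compactSpace _ (hgraph.inter (hC.preimage continuous_snd))
  convert h2 using 1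
  ext z
  constructor
  · intro hz
    exact ⟨(z, D.factor z), ⟨(D.isPointOver_factor z).ext, hz⟩, rfl⟩
  · rintro ⟨⟨z', g⟩, ⟨h1, h2⟩, rfl⟩
    have : D.factor z' = g := Extends.factor_eq h1
    simpa [this] using h2

lemma factor_shift (z : D.subshift.carrier) :
    D.factor (shiftHomeo D.subshift z) = D.scale.odometer (D.factor z) := by
  refine Extends.factor_eq ?_
  have := (extends_add_zsmul_one (D := D) 1).2 (D.isPointOver_factor z).ext
  rwa [one_zsmul] at this

theorem isFactorMap_factor : IsFactorMap (shiftHomeo D.subshift) D.scale.odometer D.factor where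
  continuous := D.continuous_factor
  surjective g := ⟨_, factor_zeroPoint g⟩
  equivariant := D.factor_shift

/-! ### Minimality -/

/-- Every window of a point of the subshift occurs in every other point, among the positions that
are filled. -/
lemma exists_shift_eq_window (x z : D.subshift.carrier) (N : ℕ) :
    ∃ m : ℤ, ∀ n : ℤ, |n| ≤ N → m + n ∉ D.holes (D.factor z) ∧ z.1 (m + n) = x.1 n := by
  obtain ⟨p, hp⟩ := mem_subshift_iff.1 x.2 (-N) (2 * N + 1)
  choose K hK using fun i : ℕ => exists_symbol_eq_some (D := D)
    (n := ((p + i : ℕ) : ℤ)) (by positivity)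
  set k := (Finset.range (2 * N + 1)).sup K
  refine ⟨p + N - D.rep (D.factor z) k, fun n hn => ?_⟩
  rw [abs_le] at hn
  obtain ⟨i, hi⟩ := Int.eq_ofNat_of_zero_le (by linarith : 0 ≤ n + N)
  have hi' : i < 2 * N + 1 := by lia
  have h1 : D.skeleton (D.factor z) k (p + N - D.rep (D.factor z) k + n) = some (x.1 n) := by
    have h2 := D.symbol_mono (Finset.le_sup (f := K) (Finset.mem_range.2 hi')) (hK i)
    rw [skeleton, show D.rep (D.factor z) k + (p + N - D.rep (D.factor z) k + n) =
      ((p + i : ℕ) : ℤ) by push_cast; linarith, h2, Int.toNat_natCast, ← hp i hi']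
    rw [show -(N : ℤ) + i = n by linarith]
  refine ⟨fun hc => ?_, (D.isPointOver_factor z).ext _ _ _ h1⟩
  rw [hc k] at h1
  cases h1

instance nonempty_carrier : Nonempty D.subshift.carrier := ⟨D.zeroPoint 0⟩

theorem isMinimalSystem : IsMinimalSystem (shiftHomeo D.subshift) := by
  refine ⟨inferInstance, fun z => ?_⟩
  intro x
  rw [mem_closure_iff_nhds]
  intro U hU
  obtain ⟨N, hN⟩ := exists_window_of_mem_nhds hU
  obtain ⟨m, hm⟩ := D.exists_shift_eq_window x z N
  refine ⟨(shiftHomeo D.subshift ^ m) z, hN _ fun n hn => ?_, ⟨m, rfl⟩⟩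
  rw [shiftHomeo_zpow_apply]
  exact (hm n hn).2

/-! ### Toeplitz sequences in the subshift -/

/-- The points with empty aperiodic part form a residual set. -/
lemma residual_holes_eq_empty :
    {z : D.subshift.carrier | D.holes (D.factor z) = ∅} ∈ residual D.subshift.carrier := by
  have h1 : {z : D.subshift.carrier | D.holes (D.factor z) = ∅} =
      ⋂ n : ℤ, {z | n ∉ D.holes (D.factor z)} := by
    ext z
    simp [Set.eq_empty_iff_forall_notMem]
  rw [h1, countable_iInter_mem]
  intro n
  refine residual_of_dense_open ?_ ?_
  · have h2 : {z : D.subshift.carrier | n ∉ D.holes (D.factor z)} =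
        ⋃ k, {z | D.skeleton (D.factor z) k n ≠ none} := by
      ext z
      simp [holes]
    rw [h2]
    refine isOpen_iUnion fun k => ?_
    exact (isOpen_discrete {t : ℤ | D.symbol k (t + n) ≠ none}).preimage
      ((D.continuous_rep k).comp D.continuous_factor)
  · intro x
    rw [mem_closure_iff_nhds]
    intro U hU
    obtain ⟨N, hN⟩ := exists_window_of_mem_nhds hU
    obtain ⟨m, hm⟩ := D.exists_shift_eq_window x x (max N n.natAbs)
    refine ⟨(shiftHomeo D.subshift ^ m) x, hN _ fun j hj => ?_, ?_⟩
    · rw [shiftHomeo_zpow_apply]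
      exact (hm j (hj.trans (by simp))).2
    · have h2 := (extends_add_zsmul_one (D := D) m).2 (D.isPointOver_factor x).ext
      rw [← shiftHomeo_zpow_apply] at h2
      change n ∉ D.holes _
      rw [h2.factor_eq]
      intro hc
      refine (hm n (by simp)).1 fun k => ?_
      rw [← skeleton_add_zsmul_one]
      exact hc k

lemma fiber_eq_singleton_of_holes_eq_empty {z : D.subshift.carrier}
    (hz : D.holes (D.factor z) = ∅) : D.factor ⁻¹' {D.factor z} = {z} := by
  ext y
  constructor
  · intro hy
    have hy : D.factor y = D.factor z := hy
    refine Subtype.ext (funext fun n => ?_)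
    refine (hy ▸ D.isPointOver_factor y).eq_of_notMem_holes (D.isPointOver_factor z) ?_
    rw [hz]
    exact Set.notMem_empty n
  · rintro rfl
    rfl

theorem isAlmostOneToOne_factor : IsAlmostOneToOne D.factor :=
  mem_of_superset D.residual_holes_eq_empty fun _ hz => D.fiber_eq_singleton_of_holes_eq_empty hz

/-- A point without holes is a Toeplitz sequence, and its orbit is dense. -/
theorem isToeplitzSubshift : IsToeplitzSubshift D.subshift := by
  obtain ⟨z, hz⟩ := (dense_of_mem_residual D.residual_holes_eq_empty).nonempty
  refine ⟨z.1, fun n => ?_, Set.Subset.antisymm (fun x hx => ?_) ?_⟩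
  · by_contra! hc
    have h1 : n ∈ aperiodicPart z.1 := hc
    rw [aperiodicPart_eq_holes_factor, hz] at h1
    exact h1
  · rw [mem_closure_iff_nhds]
    intro U hU
    obtain ⟨N, hN⟩ := exists_window_subset_of_mem_nhds hU
    obtain ⟨m, hm⟩ := D.exists_shift_eq_window ⟨x, hx⟩ z N
    exact ⟨_, hN _ fun n hn => (hm n hn).2, ⟨m, rfl⟩⟩
  · refine closure_minimal ?_ D.subshift.isClosed
    rintro _ ⟨m, rfl⟩
    exact D.subshift.mapsTo m z.2

end Parameters
end OdometerModel

namespace OdometerModel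

/-! ### The maximal equicontinuous factor -/

lemma odometer_zpow_apply (H : Scale) (n : ℤ) (g : H.addingMachine) :
    (H.odometer ^ n) g = g + n • H.one := by
  have h1 : ∀ g, H.odometer g = g + H.one := fun _ => rfl
  have h2 : ∀ g, H.odometer⁻¹ g = g - H.one := fun g => (sub_eq_add_neg g H.one).symm
  induction n using Int.induction_on generalizing g with
  | zero => simp
  | succ i ih => rw [zpow_add_one, Homeomorph.mul_apply, ih, h1, add_zsmul, one_zsmul]; abel
  | pred i ih => rw [zpow_sub_one, Homeomorph.mul_apply, ih, h2, sub_zsmul, one_zsmul]; abel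

/-- The odometer acts by translations, which are equicontinuous for the uniformity of the group. -/
lemma isEquicontinuousSystem_odometer (H : Scale) : IsEquicontinuousSystem H.odometer := by
  have hu : (uniformSpaceOfCompactR1 : UniformSpace H.addingMachine) =
      IsTopologicalAddGroup.rightUniformSpace H.addingMachine :=
    unique_uniformity_of_compact rfl rfl
  change @UniformEquicontinuous ℤ H.addingMachine H.addingMachine uniformSpaceOfCompactR1
    uniformSpaceOfCompactR1 fun n x => (H.odometer ^ n) x
  rw [hu]
  let _ := IsTopologicalAddGroup.rightUniformSpace H.addingMachine
  have : IsUniformAddGroup H.addingMachine := isUniformAddGroup_of_addCommGroup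
  intro V hV
  rw [uniformity_eq_comap_nhds_zero] at hV ⊢
  obtain ⟨W, hW, hWV⟩ := mem_comap.1 hV
  filter_upwards [preimage_mem_comap hW] with p hp n
  refine hWV ?_
  simp only [Set.mem_preimage, odometer_zpow_apply] at hp ⊢
  rwa [add_sub_add_right_eq_sub]

namespace Parameters

variable (D : Parameters)

/-- Every factor map onto an equicontinuous system identifies the points of a fibre: two points of
a fibre are asymptotic, so their images come arbitrarily close to each other. -/
lemma eq_of_factor_eq {Z : Type u} [TopologicalSpace Z] [CompactSpace Z] [T2Space Z] {R : Z ≃ₜ Z}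
    {φ : D.subshift.carrier → Z} (hR : IsEquicontinuousSystem R)
    (hφ : IsFactorMap (shiftHomeo D.subshift) R φ) {z z' : D.subshift.carrier}
    (hzz : D.factor z = D.factor z') : φ z = φ z' := by
  let _ : UniformSpace Z := uniformSpaceOfCompactR1
  have hR : UniformEquicontinuous fun (n : ℤ) (x : Z) => (R ^ n) x := hR
  by_contra hne
  obtain ⟨V, hV, hVn⟩ : ∃ V ∈ uniformity Z, (φ z, φ z') ∉ V := by
    by_contra! hc
    exact hne (eq_of_uniformity fun {V} hV => hc V hV)
  have hW := hR V hV
  have hpow : ∀ (m : ℕ) (x : D.subshift.carrier),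
      φ ((shiftHomeo D.subshift ^ (m : ℤ)) x) = (R ^ (m : ℤ)) (φ x) := by
    intro m x
    induction m generalizing x with
    | zero => simp
    | succ m ih =>
      push_cast
      rw [zpow_add_one, zpow_add_one, Homeomorph.mul_apply, Homeomorph.mul_apply, ih,
        hφ.equivariant]
  obtain ⟨N, hN⟩ := exists_forall_eq_of_factor_eq hzz
  obtain ⟨⟨a, b⟩, hab⟩ := exists_clusterPt_of_compactSpace
    (map (fun m : ℕ => ((shiftHomeo D.subshift ^ (m : ℤ)) z, (shiftHomeo D.subshift ^ (m : ℤ)) z'))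
      atTop)
  have haeq : a = b := by
    refine Subtype.ext (funext fun n => ?_)
    have hcont : Continuous fun p : D.subshift.carrier × D.subshift.carrier =>
        (p.1.1 n, p.2.1 n) :=
      ((continuous_apply n).comp (continuous_subtype_val.comp continuous_fst)).prodMk
        ((continuous_apply n).comp (continuous_subtype_val.comp continuous_snd))
    have hopen := (isOpen_discrete {(a.1 n, b.1 n)}).preimage hcont
    have hev : ∀ᶠ p : D.subshift.carrier × D.subshift.carrier in 𝓝 (a, b),
        (p.1.1 n, p.2.1 n) = (a.1 n, b.1 n) := hopen.mem_nhds (Set.mem_singleton _)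
    have h1 := hab.frequently hev
    rw [frequently_map] at h1
    obtain ⟨m, hm, h2⟩ := (frequently_atTop.1 h1) (N + n.natAbs + 1)
    simp only [shiftHomeo_zpow_apply, SymbolicDynamics.FullShift.shift_apply] at h2
    rw [hN (m + n) (by rw [abs_of_nonneg] <;> lia)] at h2
    have h3 := Prod.ext_iff.1 h2
    exact h3.1.symm.trans h3.2
  subst haeq
  have h1 : ∀ᶠ p : D.subshift.carrier × D.subshift.carrier in 𝓝 (a, a),
      ∀ n : ℤ, ((R ^ n) (φ p.1), (R ^ n) (φ p.2)) ∈ V := by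
    have h2 : Tendsto (fun p : D.subshift.carrier × D.subshift.carrier => (φ p.1, φ p.2))
        (𝓝 (a, a)) (𝓝 (φ a, φ a)) :=
      ((hφ.continuous.comp continuous_fst).prodMk (hφ.continuous.comp continuous_snd)).tendsto _
    exact h2.eventually ((nhds_le_uniformity (φ a)) hW)
  have h3 := hab.frequently h1
  rw [frequently_map] at h3
  obtain ⟨m, hm⟩ := h3.exists
  have h4 := hm (-(m : ℤ))
  simp only [hpow] at h4
  rw [← Homeomorph.mul_apply, ← Homeomorph.mul_apply, ← zpow_add, neg_add_cancel, zpow_zero] at h4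
  exact hVn h4

theorem isMaximalEquicontinuousFactor :
    IsMaximalEquicontinuousFactor.{u} (shiftHomeo D.subshift) D.scale.odometer D.factor where
  isFactorMap := D.isFactorMap_factor
  equicontinuous := isEquicontinuousSystem_odometer _
  maximal Z _ _ _ R φ hR hφ := by
    have hfib : ∀ z, φ (D.zeroPoint (D.factor z)) = φ z := fun z =>
      D.eq_of_factor_eq hR hφ (factor_zeroPoint _)
    have hcomp : φ = (fun g => φ (D.zeroPoint g)) ∘ D.factor := funext fun z => (hfib z).symm
    have hq : IsQuotientMap D.factor :=
      D.continuous_factor.isClosedMap.isQuotientMap D.continuous_factor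
        D.isFactorMap_factor.surjective
    refine ⟨fun g => φ (D.zeroPoint g), ⟨?_, fun w => ?_, fun g => ?_⟩, hcomp⟩
    · rw [hq.continuous_iff, ← hcomp]
      exact hφ.continuous
    · obtain ⟨z, rfl⟩ := hφ.surjective w
      exact ⟨D.factor z, hfib z⟩
    · rw [← hφ.equivariant, ← hfib (shiftHomeo _ (D.zeroPoint g)), D.factor_shift,
        factor_zeroPoint]

end Parameters
end OdometerModel

namespace OdometerModel

/-! ### Invariant measures on sequences with at most one `1` -/

/-- In a probability space, pairwise disjoint events that are indexed by the integers and have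
equal probabilities are null. -/
lemma measure_eq_zero_of_disjoint {Ω : Type*} [MeasurableSpace Ω] {μ : Measure Ω}
    [IsProbabilityMeasure μ] {A : ℤ → Set Ω} (hA : ∀ n, MeasurableSet (A n))
    (hd : Pairwise (Function.onFun Disjoint A)) (he : ∀ n, μ (A (n + 1)) = μ (A n)) (n : ℤ) :
    μ (A n) = 0 := by
  have hconst : ∀ n, μ (A n) = μ (A 0) := fun n => by
    induction n using Int.induction_on with
    | zero => rfl
    | succ i ih => rw [he, ih]
    | pred i ih => rw [← ih, ← he, sub_add_cancel]
  rw [hconst n]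
  by_contra h0
  have h1 := measure_iUnion (μ := μ) hd hA
  simp only [hconst] at h1
  rw [ENNReal.tsum_const_eq_top_of_ne_zero h0] at h1
  exact measure_ne_top μ _ h1

/-- The only invariant probability measure supported by the sequences with at most one symbol `1`
is the point mass at the zero sequence. -/
theorem measurePreserving_shift_and_iff (ν : Measure (ℤ → Fin 2)) (hν : IsProbabilityMeasure ν) :
    (MeasurePreserving (SymbolicDynamics.FullShift.shift (1 : ℤ)) ν ν ∧ ν atMostOneOneᶜ = 0) ↔
      ν = Measure.dirac 0 := by
  have hmeas : ∀ n : ℤ, MeasurableSet {y : ℤ → Fin 2 | y n = 1} := fun n =>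
    measurable_pi_apply n (measurableSet_singleton 1)
  have hshift : Measurable (SymbolicDynamics.FullShift.shift (1 : ℤ) : (ℤ → Fin 2) → ℤ → Fin 2) :=
    measurable_pi_lambda _ fun n => measurable_pi_apply (1 + n)
  constructor
  · rintro ⟨hinv, hsupp⟩
    have hY : MeasurableSet atMostOneOne := by
      simp only [atMostOneOne, Set.ofPred_forall]
      refine .iInter fun i => .iInter fun j => ?_
      have : {y : ℤ → Fin 2 | y i = 1 → y j = 1 → i = j} =
          ({y : ℤ → Fin 2 | y i = 1} ∩ {y | y j = 1})ᶜ ∪ {_y | i = j} := by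
        ext y
        simp only [Set.mem_ofPred_eq, Set.mem_union, Set.mem_compl_iff, Set.mem_inter_iff]
        tauto
      rw [this]
      exact ((hmeas i).inter (hmeas j)).compl.union (.const _)
    have hzero : ∀ n : ℤ, ν ({y | y n = 1} ∩ atMostOneOne) = 0 := by
      refine measure_eq_zero_of_disjoint (fun n => (hmeas n).inter hY) ?_ fun n => ?_
      · intro m n hmn
        refine Set.disjoint_left.2 fun y hm hn => hmn (hm.2 m n hm.1 hn.1)
      · rw [← hinv.measure_preimage ((hmeas n).inter hY).nullMeasurableSet]
        congr 1
        ext y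
        simp only [Set.mem_inter_iff, Set.mem_ofPred_eq, Set.mem_preimage,
          SymbolicDynamics.FullShift.shift_apply, add_comm n 1, and_congr_right_iff]
        intro _
        constructor
        · intro h i j hi hj
          simpa using h (1 + i) (1 + j) hi hj
        · intro h i j hi hj
          simpa using h (i - 1) (j - 1) (by simpa using hi) (by simpa using hj)
    have h0 : ∀ᵐ y ∂ν, y = 0 := by
      have h1 : ∀ᵐ y ∂ν, ∀ n : ℤ, y ∉ ({y | y n = 1} ∩ atMostOneOne : Set (ℤ → Fin 2)) :=
        ae_all_iff.2 fun n => measure_eq_zero_iff_ae_notMem.1 (hzero n)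
      have h2 : ∀ᵐ y ∂ν, y ∈ atMostOneOne := hsupp
      filter_upwards [h1, h2] with y hy1 hy2
      funext n
      have : y n ≠ 1 := fun h => hy1 n ⟨h, hy2⟩
      change y n = 0
      lia
    have h1 : Measure.map id ν = Measure.map (fun _ => (0 : ℤ → Fin 2)) ν := Measure.map_congr h0
    rwa [Measure.map_id, Measure.map_const, measure_univ, one_smul] at h1
  · rintro rfl
    refine ⟨⟨hshift, ?_⟩, ?_⟩
    · rw [Measure.map_dirac' hshift]
      rfl
    · rw [Measure.dirac_apply]
      simp [atMostOneOne]

namespace Parameters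

variable (D : Parameters) {g h : D.scale.addingMachine}

/-! ### Invariant measures of the adding machine -/

/-- The points of the adding machine with a given residue modulo `p_k`. -/
def cylinder (k : ℕ) (a : ℤ) : Set D.scale.addingMachine := {g | D.rep g k ≡ a [ZMOD D.per k]}

lemma isOpen_cylinder (k : ℕ) (a : ℤ) : IsOpen (D.cylinder k a) :=
  (isOpen_discrete {t : ℤ | t ≡ a [ZMOD D.per k]}).preimage (D.continuous_rep k)

lemma exists_cylinder_subset {U : Set D.scale.addingMachine} (hU : U ∈ 𝓝 g) :
    ∃ k, D.cylinder k (D.rep g k) ⊆ U := by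
  rw [nhds_subtype_eq_comap] at hU
  obtain ⟨V, hV, hVU⟩ := mem_comap.1 hU
  obtain ⟨W, hWV, hW, hx⟩ := mem_nhds_iff.1 hV
  obtain ⟨I, u, h1, h2⟩ := isOpen_pi_iff.1 hW g.1 hx
  refine ⟨I.sup id + 1, fun h hh => hVU (hWV (h2 fun k hk => ?_))⟩
  have hk' : k + 1 ≤ I.sup id + 1 := Nat.succ_le_succ (Finset.le_sup (f := id) hk)
  have h3 : D.rep h (k + 1) ≡ D.rep g (k + 1) [ZMOD D.per (k + 1)] :=
    ((D.rep_modEq hk' h).symm.trans (D.modEq_of_le hk' hh)).trans (D.rep_modEq hk' g)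
  have h4 : h.1 k = g.1 k := by
    rw [← D.intCast_eq_iff_modEq_rep, D.coe_rep_succ] at h3
    exact h3
  rw [h4]
  exact (h1 k hk).2

lemma isTopologicalBasis_cylinder :
    TopologicalSpace.IsTopologicalBasis (Set.range fun p : ℕ × ℤ => D.cylinder p.1 p.2) := by
  refine TopologicalSpace.isTopologicalBasis_of_isOpen_of_nhds ?_ fun g U hg hU => ?_
  · rintro _ ⟨p, rfl⟩
    exact D.isOpen_cylinder _ _
  · obtain ⟨k, hk⟩ := D.exists_cylinder_subset (hU.mem_nhds hg)
    exact ⟨_, ⟨(k, D.rep g k), rfl⟩, Int.ModEq.refl _, hk⟩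

lemma isPiSystem_cylinder : IsPiSystem (Set.range fun p : ℕ × ℤ => D.cylinder p.1 p.2) := by
  have key : ∀ (k l : ℕ) (a b : ℤ), k ≤ l → (D.cylinder k a ∩ D.cylinder l b).Nonempty →
      D.cylinder k a ∩ D.cylinder l b = D.cylinder l b := by
    rintro k l a b hkl ⟨g, hga, hgb⟩
    refine Set.inter_eq_right.2 fun h hh => ?_
    have h1 : D.rep h l ≡ D.rep g l [ZMOD D.per k] :=
      D.modEq_of_le hkl (Int.ModEq.trans hh (Int.ModEq.symm hgb))
    exact (((D.rep_modEq hkl h).symm.trans h1).trans (D.rep_modEq hkl g)).trans hga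
  rintro _ ⟨⟨k, a⟩, rfl⟩ _ ⟨⟨l, b⟩, rfl⟩ hne
  rcases le_total k l with h | h
  · exact ⟨(l, b), (key k l a b h hne).symm⟩
  · refine ⟨(k, a), ?_⟩
    simp only at hne ⊢
    rw [Set.inter_comm] at hne ⊢
    exact (key l k b a h hne).symm

instance secondCountable_addingMachine : SecondCountableTopology D.scale.addingMachine :=
  D.isTopologicalBasis_cylinder.secondCountableTopology (Set.countable_range _)

/-- An invariant probability measure gives equal mass to all residues modulo `p_k`. -/
lemma measure_cylinder {ν : Measure D.scale.addingMachine}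
    (hν : IsInvariantProbability D.scale.odometer ν) (k : ℕ) (a : ℤ) :
    ν (D.cylinder k a) = (D.per k : ENNReal)⁻¹ := by
  have := hν.1
  have hm : ∀ a, MeasurableSet (D.cylinder k a) := fun a => (D.isOpen_cylinder k a).measurableSet
  have hstep : ∀ a, ν (D.cylinder k (a + 1)) = ν (D.cylinder k a) := fun a => by
    rw [← hν.2.measure_preimage (hm (a + 1)).nullMeasurableSet]
    congr 1
    ext g
    have h1 := D.rep_add_zsmul_one g 1 k
    rw [one_zsmul] at h1
    change D.rep (g + D.scale.one) k ≡ a + 1 [ZMOD D.per k] ↔ D.rep g k ≡ a [ZMOD D.per k]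
    constructor
    · intro h2
      exact Int.ModEq.add_right_cancel' 1 (h1.symm.trans h2)
    · intro h2
      exact h1.trans (h2.add_right 1)
  have hconst : ∀ a, ν (D.cylinder k a) = ν (D.cylinder k 0) := fun a => by
    induction a using Int.induction_on with
    | zero => rfl
    | succ i ih => rw [hstep, ih]
    | pred i ih => rw [← ih, ← hstep, sub_add_cancel]
  have hU : (Set.univ : Set D.scale.addingMachine) =
      ⋃ i ∈ Finset.range (D.per k), D.cylinder k i := by
    ext g
    simp only [Set.mem_univ, Set.mem_iUnion, true_iff]
    exact ⟨D.res k (D.rep g k), Finset.mem_range.2 (D.res_lt _ _), (D.res_modEq k _).symm⟩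
  have hsum : ν Set.univ = ∑ i ∈ Finset.range (D.per k), ν (D.cylinder k i) := by
    rw [hU, measure_biUnion_finset (f := fun i : ℕ => D.cylinder k i) ?_ fun i _ => hm i]
    intro i hi j hj hij
    refine Set.disjoint_left.2 fun g hgi hgj => hij ?_
    have h1 : (i : ℤ) ≡ j [ZMOD D.per k] := (Int.ModEq.symm hgi).trans hgj
    rw [Int.natCast_modEq_iff] at h1
    exact Nat.ModEq.eq_of_lt_of_lt h1 (Finset.mem_range.1 hi) (Finset.mem_range.1 hj)
  rw [measure_univ] at hsum
  simp only [hconst, Finset.sum_const, Finset.card_range, nsmul_eq_mul] at hsum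
  rw [hconst]
  exact ENNReal.eq_inv_of_mul_eq_one_left (by rw [mul_comm, ← hsum])

lemma isInvariantProbability_haar : IsInvariantProbability D.scale.odometer D.scale.haar := by
  refine ⟨⟨?_⟩, ?_⟩
  · have := Measure.addHaarMeasure_self
      (K₀ := (⊤ : TopologicalSpace.PositiveCompacts D.scale.addingMachine))
    simpa [Scale.haar] using this
  · have : D.scale.haar.IsAddLeftInvariant := by unfold Scale.haar; infer_instance
    exact measurePreserving_add_right D.scale.haar D.scale.one

/-- The odometer is uniquely ergodic. -/
lemma eq_haar_of_isInvariantProbability {ν : Measure D.scale.addingMachine}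
    (hν : IsInvariantProbability D.scale.odometer ν) : ν = D.scale.haar := by
  have h1 := hν.1
  have h2 := D.isInvariantProbability_haar.1
  refine ext_of_generate_finite _ ?_ D.isPiSystem_cylinder ?_ (by simp)
  · rw [BorelSpace.measurable_eq (α := D.scale.addingMachine),
      D.isTopologicalBasis_cylinder.borel_eq_generateFrom]
  · rintro _ ⟨⟨k, a⟩, rfl⟩
    simp only
    rw [D.measure_cylinder hν, D.measure_cylinder D.isInvariantProbability_haar]

/-! ### Invariant measures of the subshift -/

instance borelSpace_carrier (X : BinarySubshift) : BorelSpace X.carrier := by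
  have : BorelSpace (Fin 2) := ⟨(borel_eq_top_of_discrete).symm⟩
  exact Subtype.borelSpace _

lemma measurable_factor : Measurable D.factor := D.continuous_factor.measurable

lemma measurableSet_mem_holes (n : ℤ) :
    MeasurableSet {g : D.scale.addingMachine | n ∈ D.holes g} := by
  change MeasurableSet {g : D.scale.addingMachine | ∀ k, D.skeleton g k n = none}
  simp only [Set.ofPred_forall]
  exact .iInter fun k => ((isOpen_discrete {t : ℤ | D.symbol k (t + n) = none}).preimage
    (D.continuous_rep k)).measurableSet

lemma measurable_zeroPoint : Measurable D.zeroPoint := by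
  refine Measurable.subtype_mk (measurable_pi_lambda _ fun n => ?_)
  have hs : MeasurableSet {g : D.scale.addingMachine | ∃ k, D.skeleton g k n = some 1} := by
    simp only [Set.ofPred_exists]
    exact .iUnion fun k => ((isOpen_discrete {t : ℤ | D.symbol k (t + n) = some 1}).preimage
      (D.continuous_rep k)).measurableSet
  refine Measurable.ite ?_ measurable_const measurable_const
  convert hs using 1
  ext g
  simp

lemma zeroPoint_odometer (g : D.scale.addingMachine) :
    D.zeroPoint (D.scale.odometer g) = shiftHomeo D.subshift (D.zeroPoint g) := by
  refine Subtype.ext (funext fun n => ?_)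
  have hodo : D.scale.odometer g = g + (1 : ℤ) • D.scale.one := by rw [one_zsmul]; rfl
  change fillHoles (D.scale.odometer g) 0 n = fillHoles g 0 (1 + n)
  have h : ∀ k, D.skeleton (D.scale.odometer g) k n = D.skeleton g k (1 + n) := fun k => by
    rw [hodo, skeleton_add_zsmul_one]
  classical
  exact if_congr (or_congr (exists_congr fun k => by rw [h])
    (and_congr (forall_congr' fun k => by rw [h]) Iff.rfl)) rfl rfl

/-- With respect to every invariant measure, almost every point is the point of its fibre without
symbols `1` at unfilled positions. Since an aperiodic part carries at most one symbol `1`, the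
events that this symbol occurs at position `n` are disjoint and have equal probability. -/
lemma ae_zeroPoint_factor_eq {μ : Measure D.subshift.carrier}
    (hμ : IsInvariantProbability (shiftHomeo D.subshift) μ) :
    ∀ᵐ z ∂μ, D.zeroPoint (D.factor z) = z := by
  have := hμ.1
  have hm : ∀ n : ℤ,
      MeasurableSet {z : D.subshift.carrier | n ∈ D.holes (D.factor z) ∧ z.1 n = 1} :=
    fun n => (D.measurable_factor (D.measurableSet_mem_holes n)).inter
      (((measurable_pi_apply n).comp measurable_subtype_coe) (measurableSet_singleton 1))
  have h0 := measure_eq_zero_of_disjoint (μ := μ) hm (fun m n hmn =>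
      Set.disjoint_left.2 fun z h1 h2 =>
        hmn ((D.isPointOver_factor z).atMostOne m h1.1 n h2.1 h1.2 h2.2)) (fun n => by
    rw [← hμ.2.measure_preimage (hm n).nullMeasurableSet]
    congr 1
    ext z
    have h1 : D.factor (shiftHomeo D.subshift z) = D.factor z + (1 : ℤ) • D.scale.one := by
      rw [D.factor_shift, one_zsmul]
      rfl
    have h2 : (shiftHomeo D.subshift z).1 n = z.1 (1 + n) := rfl
    simp only [Set.mem_ofPred_eq, Set.mem_preimage, holes, h1, h2, skeleton_add_zsmul_one,
      add_comm n 1])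
  have h1 : ∀ᵐ z ∂μ, ∀ n : ℤ, ¬ (n ∈ D.holes (D.factor z) ∧ z.1 n = 1) :=
    ae_all_iff.2 fun n => measure_eq_zero_iff_ae_notMem.1 (h0 n)
  filter_upwards [h1] with z hz
  refine Subtype.ext (funext fun n => ?_)
  by_cases hn : n ∈ D.holes (D.factor z)
  · have h2 : z.1 n ≠ 1 := fun h => hz n ⟨hn, h⟩
    change fillHoles _ 0 n = _
    rw [fillHoles_of_mem hn]
    change 0 = z.1 n
    lia
  · exact (isPointOver_fillHoles _ (by simp)).eq_of_notMem_holes (D.isPointOver_factor z) hn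

lemma measurePreserving_factor {μ : Measure D.subshift.carrier}
    (hμ : IsInvariantProbability (shiftHomeo D.subshift) μ) :
    MeasurePreserving D.factor μ D.scale.haar := by
  have := hμ.1
  refine ⟨D.measurable_factor, D.eq_haar_of_isInvariantProbability
    ⟨Measure.isProbabilityMeasure_map D.measurable_factor.aemeasurable, ?_⟩⟩
  refine ⟨D.scale.odometer.measurable, ?_⟩
  rw [Measure.map_map D.scale.odometer.measurable D.measurable_factor]
  have : D.scale.odometer ∘ D.factor = D.factor ∘ shiftHomeo D.subshift :=
    funext fun z => (D.factor_shift z).symm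
  rw [this, ← Measure.map_map D.measurable_factor (shiftHomeo D.subshift).measurable, hμ.2.map_eq]

lemma measurePreserving_zeroPoint {μ : Measure D.subshift.carrier}
    (hμ : IsInvariantProbability (shiftHomeo D.subshift) μ) :
    MeasurePreserving D.zeroPoint D.scale.haar μ := by
  refine ⟨D.measurable_zeroPoint, ?_⟩
  rw [← (D.measurePreserving_factor hμ).map_eq,
    Measure.map_map D.measurable_zeroPoint D.measurable_factor,
    Measure.map_congr (f := D.zeroPoint ∘ D.factor) (g := id) (D.ae_zeroPoint_factor_eq hμ),
    Measure.map_id]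

theorem isMeasureIsomorphism_factor {μ : Measure D.subshift.carrier}
    (hμ : IsInvariantProbability (shiftHomeo D.subshift) μ) :
    IsMeasureIsomorphism μ D.scale.haar D.factor :=
  ⟨D.measurePreserving_factor hμ, D.zeroPoint, D.measurePreserving_zeroPoint hμ,
    D.ae_zeroPoint_factor_eq hμ, ae_of_all _ factor_zeroPoint⟩

/-- The only invariant probability measure is the image of the Haar measure under the section that
puts zeros on the holes. -/
theorem isUniquelyErgodic : IsUniquelyErgodic (shiftHomeo D.subshift) := by
  have hhaar := D.isInvariantProbability_haar
  have := hhaar.1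
  refine ⟨D.scale.haar.map D.zeroPoint, ⟨Measure.isProbabilityMeasure_map
    D.measurable_zeroPoint.aemeasurable, (shiftHomeo D.subshift).measurable, ?_⟩,
    fun μ hμ => (D.measurePreserving_zeroPoint hμ).map_eq.symm⟩
  rw [Measure.map_map (shiftHomeo D.subshift).measurable D.measurable_zeroPoint]
  have h1 : shiftHomeo D.subshift ∘ D.zeroPoint = D.zeroPoint ∘ D.scale.odometer :=
    funext fun g => (D.zeroPoint_odometer g).symm
  rw [h1, ← Measure.map_map D.measurable_zeroPoint D.scale.odometer.measurable, hhaar.2.map_eq]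

/-! ### Irregularity -/

/-- The residues modulo `p_k` that are unfilled after `k` steps. -/
def holeResidues (k : ℕ) : Finset ℕ :=
  (Finset.range (D.per k)).filter fun a => fill D.q D.r D.s k a = none

lemma card_holeResidues (k : ℕ) : (D.holeResidues k).card = D.unf k := by
  rw [holeResidues, ← Nat.count_eq_card_filter_range]
  exact D.holeCount_per k

lemma symbol_eq_none_iff_res_mem {k : ℕ} {n : ℤ} :
    D.symbol k n = none ↔ D.res k n ∈ D.holeResidues k := by
  simp [holeResidues, D.res_lt, symbol_eq_fill_res]

lemma haar_skeleton_eq_none (k : ℕ) :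
    D.scale.haar {g | D.skeleton g k 0 = none} = (D.unf k : ENNReal) * (D.per k : ENNReal)⁻¹ := by
  have h1 : {g : D.scale.addingMachine | D.skeleton g k 0 = none} =
      ⋃ a ∈ D.holeResidues k, D.cylinder k (a : ℤ) := by
    ext g
    simp only [Set.mem_ofPred_eq, Set.mem_iUnion, skeleton, add_zero, D.symbol_eq_none_iff_res_mem]
    constructor
    · intro h
      exact ⟨_, h, (D.res_modEq k _).symm⟩
    · rintro ⟨a, ha, hga⟩
      have h2 : D.res k (D.rep g k) = a := by
        rw [D.res_eq_iff.2 hga, D.res_natCast]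
        exact Nat.mod_eq_of_lt (Finset.mem_range.1 (Finset.mem_filter.1 ha).1)
      rwa [h2]
  rw [h1, measure_biUnion_finset (f := fun a : ℕ => D.cylinder k a) ?_
    fun a _ => (D.isOpen_cylinder k a).measurableSet]
  · simp only [D.measure_cylinder D.isInvariantProbability_haar, Finset.sum_const,
      D.card_holeResidues, nsmul_eq_mul]
  · intro i hi j hj hij
    refine Set.disjoint_left.2 fun g hgi hgj => hij ?_
    have h1 : (i : ℤ) ≡ j [ZMOD D.per k] := (Int.ModEq.symm hgi).trans hgj
    rw [Int.natCast_modEq_iff] at h1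
    exact Nat.ModEq.eq_of_lt_of_lt h1 (Finset.mem_range.1 (Finset.mem_filter.1 hi).1)
      (Finset.mem_range.1 (Finset.mem_filter.1 hj).1)

/-- The points of the adding machine with hole `0` have measure at least `d`. -/
lemma haar_zero_mem_holes_ne_zero : D.scale.haar {g | (0 : ℤ) ∈ D.holes g} ≠ 0 := by
  have := D.isInvariantProbability_haar.1
  have h1 : {g : D.scale.addingMachine | (0 : ℤ) ∈ D.holes g} =
      ⋂ k, {g | D.skeleton g k 0 = none} := by
    ext g
    simp [holes]
  have hlim := tendsto_measure_iInter_atTop (μ := D.scale.haar)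
    (s := fun k => {g : D.scale.addingMachine | D.skeleton g k 0 = none})
    (fun k => ((isOpen_discrete {t : ℤ | D.symbol k (t + 0) = none}).preimage
      (D.continuous_rep k)).measurableSet.nullMeasurableSet)
    (fun k l hkl g hg => by
      change D.skeleton g k 0 = none
      rw [skeleton_eq_symbol hkl]
      exact D.symbol_eq_none_of_le hkl hg) ⟨0, measure_ne_top _ _⟩
  rw [← h1] at hlim
  have hge : ENNReal.ofReal D.d ≤ D.scale.haar {g | (0 : ℤ) ∈ D.holes g} := by
    refine ge_of_tendsto' hlim fun k => ?_
    simp only [Function.comp_apply]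
    rw [haar_skeleton_eq_none, ← div_eq_mul_inv]
    have h2 := ENNReal.ofReal_le_ofReal (D.d_le_unf_div_per k)
    rwa [ENNReal.ofReal_div_of_pos (Nat.cast_pos.2 (D.per_pos k)), ENNReal.ofReal_natCast,
      ENNReal.ofReal_natCast] at h2
  exact ((ENNReal.ofReal_pos.2 D.d_pos).trans_le hge).ne'

theorem not_isRegularExtension : ¬ IsRegularExtension D.scale D.factor := by
  intro hreg
  refine D.haar_zero_mem_holes_ne_zero (measure_mono_null ?_ hreg)
  -- over a point with an unfilled position `0`, both symbols are possible at this position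
  intro g hg huniq
  have hg : (0 : ℤ) ∈ D.holes g := hg
  have hP : D.IsPointOver g (fillHoles g (Pi.single 0 1)) := isPointOver_fillHoles g (by
    intro m _ n _ hm hn
    have key : ∀ j : ℤ, (Pi.single 0 1 : ℤ → Fin 2) j = 1 → j = 0 := fun j hj => by
      by_contra h
      rw [Pi.single_eq_of_ne h] at hj
      exact zero_ne_one hj
    rw [key m hm, key n hn])
  have h1 := huniq.unique (y₁ := D.zeroPoint g) (y₂ := ⟨_, hP.mem_subshift⟩) (factor_zeroPoint g)
    hP.ext.factor_eq
  have h2 := congrFun (congrArg Subtype.val h1) 0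
  change fillHoles g 0 0 = fillHoles g _ 0 at h2
  rw [fillHoles_of_mem hg, fillHoles_of_mem hg, Pi.single_eq_same] at h2
  exact zero_ne_one h2

end Parameters
end OdometerModel

namespace OdometerModel

/-! ### Densities -/

lemma ncard_inter_Ico (A : Set ℤ) [DecidablePred (· ∈ A)] (a b : ℤ) :
    (A ∩ Set.Ico a b).ncard = ((Finset.Ico a b).filter (· ∈ A)).card := by
  rw [← Set.ncard_coe_finset]
  congr 1
  ext x
  simp [and_comm]

/-- A uniform estimate in the windows `[a, a + n)` containing or adjacent to the origin gives both
one-sided densities. -/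
lemma hasDensity_of_abs_sub_le {A : Set ℤ} {δ : ℝ}
    (h : ∀ ε > 0, ∃ N : ℕ, ∀ n ≥ N, ∀ a : ℤ, -(n : ℤ) ≤ a → a ≤ 0 →
      |((A ∩ Set.Ico a (a + n)).ncard : ℝ) - n * δ| ≤ ε * n) : HasDensity A δ := by
  have key : ∀ a : ℕ → ℤ, (∀ n : ℕ, -(n : ℤ) ≤ a n ∧ a n ≤ 0) →
      Tendsto (fun n : ℕ => ((A ∩ Set.Ico (a n) (a n + n)).ncard : ℝ) / n) atTop (𝓝 δ) := by
    intro a ha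
    rw [Metric.tendsto_atTop]
    intro ε hε
    obtain ⟨N, hN⟩ := h (ε / 2) (half_pos hε)
    refine ⟨max N 1, fun n hn => ?_⟩
    have hn0 : (0 : ℝ) < n := Nat.cast_pos.2 ((le_max_right N 1).trans hn)
    have h1 := hN n ((le_max_left _ _).trans hn) (a n) (ha n).1 (ha n).2
    rw [Real.dist_eq, div_sub' hn0.ne', abs_div, abs_of_pos hn0, div_lt_iff₀ hn0]
    have := mul_pos hε hn0
    linarith
  constructor
  · simpa using key (fun _ => 0) (by simp)
  · simpa using key (fun n => -(n : ℤ)) (by simp)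

lemma abs_card_filter_modEq_sub_le {P : ℕ} (hP : 0 < P) (v a : ℤ) (n : ℕ) :
    |(((Finset.Ico a (a + n)).filter (· ≡ v [ZMOD P])).card : ℝ) - n / P| ≤ 1 := by
  have h1 := Int.Ico_filter_modEq_card a (a + n) (r := P) (by exact_mod_cast hP) v
  have hPQ : (0 : ℚ) < P := by exact_mod_cast hP
  set x : ℚ := ((a : ℚ) - v) / P with hx
  have hy : (((a + n : ℤ) : ℚ) - v) / ((P : ℤ) : ℚ) = x + n / P := by
    rw [hx]
    push_cast
    ring
  rw [hy] at h1
  have hn : (0 : ℚ) ≤ n / P := by positivity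
  have h2 : ⌈x⌉ ≤ ⌈x + n / P⌉ := Int.ceil_le_ceil (by linarith)
  have hx' : (((a : ℤ) : ℚ) - v) / ((P : ℤ) : ℚ) = x := by rw [hx]; simp
  rw [hx', max_eq_left (by linarith)] at h1
  have h3 := Int.le_ceil x
  have h4 := Int.ceil_lt_add_one x
  have h5 := Int.le_ceil (x + n / P)
  have h6 := Int.ceil_lt_add_one (x + n / P)
  have h7 : |((((Finset.Ico a (a + n)).filter (· ≡ v [ZMOD P])).card : ℤ) : ℚ) - n / P| ≤ 1 := by
    rw [h1, abs_le]
    push_cast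
    constructor <;> linarith
  have h8 := (Rat.cast_le (K := ℝ)).2 h7
  push_cast at h8
  exact h8

namespace Parameters

variable (D : Parameters)

/-- The number of positions in a window whose residue modulo `p_k` belongs to a given set. -/
lemma abs_card_filter_res_sub_le (k : ℕ) (t a : ℤ) (n : ℕ) {S : Finset ℕ}
    (hS : S ⊆ Finset.range (D.per k)) :
    |(((Finset.Ico a (a + n)).filter fun x => D.res k (t + x) ∈ S).card : ℝ)
      - n * (S.card / D.per k)| ≤ S.card := by
  have h1 : ((Finset.Ico a (a + n)).filter fun x => D.res k (t + x) ∈ S).card =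
      ∑ s ∈ S, ((Finset.Ico a (a + n)).filter (· ≡ s - t [ZMOD D.per k])).card := by
    rw [Finset.card_eq_sum_card_fiberwise
      (s := (Finset.Ico a (a + n)).filter fun x => D.res k (t + x) ∈ S)
      (f := fun x => D.res k (t + x)) (t := S) fun x hx => (Finset.mem_filter.1 hx).2]
    refine Finset.sum_congr rfl fun s hs => ?_
    congr 1
    ext x
    have hsP : s % D.per k = s := Nat.mod_eq_of_lt (Finset.mem_range.1 (hS hs))
    have h2 : D.res k (t + x) = s ↔ x ≡ s - t [ZMOD D.per k] := by
      conv_lhs => rw [← hsP, ← D.res_natCast, D.res_eq_iff]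
      rw [Int.modEq_iff_dvd, Int.modEq_iff_dvd, sub_sub]
    simp only [Finset.mem_filter, h2]
    constructor
    · exact fun h => ⟨h.1.1, h.2⟩
    · exact fun h => ⟨⟨h.1, by rw [h2.2 h.2]; exact hs⟩, h.2⟩
  rw [h1]
  push_cast
  have h2 : (n : ℝ) * (S.card / D.per k) = ∑ _s ∈ S, (n : ℝ) / D.per k := by
    rw [Finset.sum_const, nsmul_eq_mul]
    ring
  rw [h2, ← Finset.sum_sub_distrib]
  refine (Finset.abs_sum_le_sum_abs _ _).trans ?_
  calc _ ≤ ∑ _s ∈ S, (1 : ℝ) :=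
        Finset.sum_le_sum fun s _ => abs_card_filter_modEq_sub_le (D.per_pos k) _ _ _
    _ = S.card := by simp

lemma hasDensity_res_mem (k : ℕ) (t : ℤ) {S : Finset ℕ} (hS : S ⊆ Finset.range (D.per k)) :
    HasDensity {x | D.res k (t + x) ∈ S} (S.card / D.per k) := by
  refine hasDensity_of_abs_sub_le fun ε hε => ?_
  obtain ⟨N, hN⟩ := exists_nat_ge (S.card / ε)
  refine ⟨N, fun n hn a _ _ => ?_⟩
  classical
  rw [ncard_inter_Ico]
  refine (D.abs_card_filter_res_sub_le k t a n hS).trans ?_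
  rw [div_le_iff₀' hε] at hN
  have : (N : ℝ) ≤ n := Nat.cast_le.2 hn
  exact hN.trans (mul_le_mul_of_nonneg_left this hε.le)

lemma hasDensity_periodicPart (z : D.subshift.carrier) (k : ℕ) :
    HasDensity (periodicPart (D.per k) z.1) (1 - D.unf k / D.per k) := by
  rw [(D.isPointOver_factor z).ext.periodicPart_eq k]
  have h1 : {n | D.skeleton (D.factor z) k n ≠ none} =
      {n | D.res k (D.rep (D.factor z) k + n) ∈ Finset.range (D.per k) \ D.holeResidues k} := by
    ext n
    simp only [Set.mem_ofPred_eq, skeleton, ne_eq, D.symbol_eq_none_iff_res_mem, Finset.mem_sdiff,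
      Finset.mem_range, D.res_lt, true_and]
  rw [h1]
  have hsub : D.holeResidues k ⊆ Finset.range (D.per k) := Finset.filter_subset _ _
  have h2 := D.hasDensity_res_mem k (D.rep (D.factor z) k)
    (Finset.sdiff_subset (s := Finset.range (D.per k)) (t := D.holeResidues k))
  have hP : (D.per k : ℝ) ≠ 0 := Nat.cast_ne_zero.2 (D.per_pos k).ne'
  have hle := Finset.card_le_card hsub
  rw [Finset.card_sdiff_of_subset hsub, Nat.cast_sub hle, D.card_holeResidues, Finset.card_range,
    sub_div, div_self hP] at h2
  exact h2

theorem hasIrregularity : HasIrregularity D.subshift D.scale D.d := by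
  intro z hz
  refine ⟨fun k => 1 - D.unf (k + 1) / D.per (k + 1),
    fun k => D.hasDensity_periodicPart ⟨z, hz⟩ (k + 1), ?_⟩
  refine isLUB_of_tendsto_atTop (fun k l hkl => ?_) ?_
  · have := D.antitone_unf_div_per (Nat.succ_le_succ hkl)
    simp only at this ⊢
    linarith
  · exact tendsto_const_nhds.sub ((tendsto_add_atTop_iff_nat 1).2 D.tendsto_unf_div_per)

/-! ### A point whose unfilled positions have density `d` -/

/-- The proportions of the filled blocks are summable. -/
lemma summable_r_div_q : Summable fun k => (D.r k : ℝ) / D.q k := by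
  refine summable_of_sum_range_le (c := -Real.log D.d) (fun k => by positivity) fun N => ?_
  have h1 := D.d_le_unf_div_per N
  rw [D.unf_div_per] at h1
  have h2 : ∏ i ∈ Finset.range N, (1 - (D.r i : ℝ) / D.q i) ≤
      Real.exp (-∑ i ∈ Finset.range N, (D.r i : ℝ) / D.q i) := by
    rw [← Finset.sum_neg_distrib, Real.exp_sum]
    refine Finset.prod_le_prod (fun i _ => ?_) fun i _ => ?_
    · rw [sub_nonneg]
      exact div_le_one_of_le₀ (Nat.cast_le.2 (D.r_lt i).le) (Nat.cast_nonneg _)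
    · have := Real.add_one_le_exp (-((D.r i : ℝ) / D.q i))
      linarith
  have h3 := Real.log_le_log D.d_pos (h1.trans h2)
  rw [Real.log_exp] at h3
  linarith

/-- The representatives of a point of the adding machine whose distance from the filled blocks
of step `k` is comparable to `p_{k+1}`. -/
def middleSeq : ℕ → ℤ
  | 0 => 0
  | k + 1 => middleSeq k + D.per k * (D.q k / 2 : ℕ)

lemma middleSeq_bounds (k : ℕ) : 0 ≤ D.middleSeq k ∧ D.middleSeq k < D.per k := by
  induction k with
  | zero => simp [middleSeq, per_zero]
  | succ k ih =>
    have hq := D.q_pos k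
    have hr := D.r_pos k
    have hrq := D.r_lt k
    refine ⟨by rw [middleSeq]; have := ih.1; positivity, ?_⟩
    have h1 : D.per k * (1 + D.q k / 2) ≤ D.per k * D.q k := Nat.mul_le_mul_left _ (by lia)
    rw [middleSeq, D.per_succ]
    zify at h1 ⊢
    linarith [ih.2]

/-- A point of the adding machine in the middle of the blocks of each level. -/
def middlePoint : D.scale.addingMachine :=
  D.ofSeq D.middleSeq fun k => by
    rw [Int.modEq_iff_dvd, middleSeq]
    exact ⟨-(D.q k / 2 : ℕ), by ring⟩

lemma skeleton_middlePoint (k : ℕ) (n : ℤ) :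
    D.skeleton D.middlePoint k n = D.symbol k (D.middleSeq k + n) :=
  D.symbol_congr ((D.rep_ofSeq _ _ k).add_right n)

/-- Close to the middle point, a step with small proportion of filled blocks fills nothing. -/
lemma le_res_middleSeq {k : ℕ} (hk : 16 * D.r k ≤ D.q k) {x : ℤ} (hx : 8 * |x| ≤ D.per (k + 1)) :
    D.r k * D.per k ≤ D.res (k + 1) (D.middleSeq (k + 1) + x) := by
  have hb := D.middleSeq_bounds k
  have h1 : D.per k * (16 * D.r k) ≤ D.per k * D.q k := Nat.mul_le_mul_left _ hk
  have h2 : D.per k * D.q k ≤ D.per k * (2 * (D.q k / 2) + 1) := Nat.mul_le_mul_left _ (by lia)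
  have h3 : D.per k * (2 * (D.q k / 2)) ≤ D.per k * D.q k := Nat.mul_le_mul_left _ (by lia)
  have h4 : D.per k * 1 ≤ D.per k * D.r k := Nat.mul_le_mul_left _ (D.r_pos k)
  have hP := D.per_pos' k
  have hx1 := neg_abs_le x
  have hx2 := le_abs_self x
  have hsucc := D.per_succ k
  have hm : D.middleSeq (k + 1) = D.middleSeq k + D.per k * (D.q k / 2 : ℕ) := rfl
  zify at h1 h2 h3 h4 hsucc ⊢
  push_cast at hm
  rw [D.coe_res, Int.emod_eq_of_lt] <;> rw [hm] <;> lia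

open scoped Classical in
/-- In a window close to the middle point, the proportion of positions that are filled after step
`K` is bounded by the tail of the series of the proportions of the filled blocks. -/
lemma card_filter_skeleton_le {K : ℕ} (hK : ∀ j ≥ K, 16 * D.r j ≤ D.q j) {n : ℕ} {a : ℤ}
    (ha : -(n : ℤ) ≤ a) (ha' : a ≤ 0) :
    (((Finset.Ico a (a + n)).filter fun x => D.skeleton D.middlePoint K x = none).card : ℝ) ≤
      ((Finset.Ico a (a + n)).filter (· ∈ D.holes D.middlePoint)).card +
        9 * n * ∑ j ∈ Finset.Ico K (8 * n), (D.r j : ℝ) / D.q j := by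
  set F : ℕ → Finset ℤ := fun j => (Finset.Ico a (a + n)).filter fun x =>
    D.res (j + 1) (D.middleSeq (j + 1) + x) ∈ Finset.range (D.r j * D.per j) with hF
  have habs : ∀ x ∈ Finset.Ico a (a + n), |x| ≤ n := fun x hx => by
    rw [Finset.mem_Ico] at hx
    rw [abs_le]
    constructor <;> linarith
  have hfar : ∀ j ≥ K, ∀ x ∈ F j, D.per (j + 1) < 8 * n := by
    intro j hj x hx
    rw [hF, Finset.mem_filter, Finset.mem_range] at hx
    by_contra! hc
    have h1 := habs x hx.1
    have h2 := D.le_res_middleSeq (hK j hj) (x := x) (by zify at hc; linarith)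
    lia
  have hsub : ((Finset.Ico a (a + n)).filter fun x => D.skeleton D.middlePoint K x = none) ⊆
      ((Finset.Ico a (a + n)).filter (· ∈ D.holes D.middlePoint)) ∪
        (Finset.Ico K (8 * n)).biUnion F := by
    intro x hx
    rw [Finset.mem_filter] at hx
    rw [Finset.mem_union]
    by_cases hh : x ∈ D.holes D.middlePoint
    · exact .inl (Finset.mem_filter.2 ⟨hx.1, hh⟩)
    · right
      obtain ⟨l, v, hv⟩ := exists_skeleton_of_notMem_holes hh
      have hKl : K ≤ l := by
        by_contra! hc
        rw [skeleton_mono hc.le hv] at hx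
        cases hx.2
      obtain ⟨j, hj, hj0, hj1⟩ : ∃ j ≥ K, D.skeleton D.middlePoint j x = none ∧
          D.skeleton D.middlePoint (j + 1) x ≠ none := by
        by_contra! hc
        have : ∀ j, K ≤ j → D.skeleton D.middlePoint j x = none := fun j hj => by
          induction j, hj using Nat.le_induction with
          | base => exact hx.2
          | succ j hj ih => exact hc j hj ih
        rw [this l hKl] at hv
        cases hv
      have hmem : x ∈ F j := by
        rw [hF, Finset.mem_filter, Finset.mem_range]
        refine ⟨hx.1, ?_⟩
        by_contra! hc
        rw [skeleton_eq_symbol j.le_succ] at hj0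
        rw [skeleton_middlePoint] at hj1
        refine hj1 (D.symbol_succ_eq_none_iff.2 ⟨?_, hc⟩)
        rw [← hj0]
        exact D.symbol_congr (D.modEq_of_le j.le_succ
          ((D.rep_ofSeq _ _ (j + 1)).symm.add_right x))
      refine Finset.mem_biUnion.2 ⟨j, Finset.mem_Ico.2 ⟨hj, ?_⟩, hmem⟩
      have := hfar j hj x hmem
      have := D.lt_per (j + 1)
      lia
  have hcard := (Finset.card_le_card hsub).trans
    ((Finset.card_union_le _ _).trans (Nat.add_le_add_left Finset.card_biUnion_le _))
  have hbound : ∀ j ∈ Finset.Ico K (8 * n), ((F j).card : ℝ) ≤ 9 * n * ((D.r j : ℝ) / D.q j) := by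
    intro j hj
    have hjK := (Finset.mem_Ico.1 hj).1
    rcases (F j).eq_empty_or_nonempty with h0 | ⟨x, hx⟩
    · rw [h0, Finset.card_empty, Nat.cast_zero]
      positivity
    · have h1 := hfar j hjK x hx
      have hS : Finset.range (D.r j * D.per j) ⊆ Finset.range (D.per (j + 1)) := by
        rw [Finset.range_subset_range, D.per_succ, mul_comm]
        exact Nat.mul_le_mul_left _ (D.r_lt j).le
      have h2 := (abs_le.1 (D.abs_card_filter_res_sub_le (j + 1) (D.middleSeq (j + 1)) a n hS)).2
      rw [Finset.card_range, D.per_succ] at h2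
      rw [D.per_succ] at h1
      have hP : (0 : ℝ) < D.per j := Nat.cast_pos.2 (D.per_pos j)
      have hq : (0 : ℝ) < D.q j := Nat.cast_pos.2 (D.q_pos j)
      have h3 : ((D.per j * D.q j : ℕ) : ℝ) ≤ (8 * n : ℕ) := Nat.cast_le.2 h1.le
      push_cast at h2 h3
      have h4 : (n : ℝ) * (D.r j * D.per j / (D.per j * D.q j)) = n * (D.r j / D.q j) := by
        field_simp
      have h5 : (D.r j * D.per j : ℝ) ≤ 8 * n * (D.r j / D.q j) := by
        have : (D.r j * D.per j : ℝ) = (D.per j * D.q j) * (D.r j / D.q j) := by field_simp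
        rw [this]
        exact mul_le_mul_of_nonneg_right h3 (by positivity)
      rw [h4] at h2
      change ((F j).card : ℝ) - _ ≤ _ at h2
      linarith
  calc _ ≤ (((Finset.Ico a (a + n)).filter (· ∈ D.holes D.middlePoint)).card : ℝ) +
        ∑ j ∈ Finset.Ico K (8 * n), ((F j).card : ℝ) := by exact_mod_cast hcard
    _ ≤ _ := by
        rw [Finset.mul_sum]
        gcongr with j hj
        exact hbound j hj

/-- Up to a proportion `ε` in long windows, the holes of the middle point are the positions unfilled
after `K` steps, which are periodic with density `Q_K / p_K` close to `d`. -/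
theorem hasDensity_holes_middlePoint : HasDensity (D.holes D.middlePoint) D.d := by
  classical
  refine hasDensity_of_abs_sub_le fun ε hε => ?_
  -- a level after which little is filled, and at which the proportion of unfilled positions is
  -- close to `d`
  obtain ⟨K, hK16, hKd, hKsum⟩ : ∃ K : ℕ, (∀ j ≥ K, 16 * D.r j ≤ D.q j) ∧
      (D.unf K : ℝ) / D.per K ≤ D.d + ε / 4 ∧
      ∀ M, ∑ j ∈ Finset.Ico K M, (D.r j : ℝ) / D.q j ≤ ε / 36 := by
    have h1 : ∀ᶠ j in atTop, 16 * D.r j ≤ D.q j := by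
      filter_upwards [D.summable_r_div_q.tendsto_atTop_zero.eventually
        (gt_mem_nhds (by norm_num : (0 : ℝ) < 1 / 16))] with j hj
      rw [div_lt_iff₀ (Nat.cast_pos.2 (D.q_pos j))] at hj
      have : ((16 * D.r j : ℕ) : ℝ) ≤ D.q j := by push_cast; linarith
      exact_mod_cast this
    have h2 := D.tendsto_unf_div_per.eventually (gt_mem_nhds (by linarith : D.d < D.d + ε / 4))
    have h3 := D.summable_r_div_q.hasSum.tendsto_sum_nat.eventually
      (lt_mem_nhds (sub_lt_self (∑' j, (D.r j : ℝ) / D.q j) (by positivity : 0 < ε / 36)))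
    obtain ⟨K, hK⟩ := ((eventually_forall_ge_atTop.2 h1).and (h2.and h3)).exists
    refine ⟨K, hK.1, hK.2.1.le, fun M => ?_⟩
    rcases le_total M K with h | h
    · rw [Finset.Ico_eq_empty_of_le h, Finset.sum_empty]
      positivity
    · have h4 := D.summable_r_div_q.sum_le_tsum (Finset.range M) fun j _ => by positivity
      rw [Finset.sum_Ico_eq_sub _ h]
      linarith [hK.2.2]
  obtain ⟨N, hN⟩ := exists_nat_ge ((D.unf K : ℝ) / (ε / 2))
  rw [div_le_iff₀ (by positivity)] at hN
  refine ⟨N, fun n hn a ha ha' => ?_⟩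
  have hn' : (N : ℝ) ≤ n := Nat.cast_le.2 hn
  have h1 : (D.unf K : ℝ) ≤ n * (ε / 2) :=
    hN.trans (mul_le_mul_of_nonneg_right hn' (by positivity))
  have h2 := D.abs_card_filter_res_sub_le K (D.middleSeq K) a n
    (S := D.holeResidues K) (Finset.filter_subset _ _)
  simp only [← D.symbol_eq_none_iff_res_mem, ← D.skeleton_middlePoint, D.card_holeResidues] at h2
  have h3 := D.card_filter_skeleton_le hK16 ha ha'
  have h4 : ((Finset.Ico a (a + n)).filter (· ∈ D.holes D.middlePoint)).card ≤
      ((Finset.Ico a (a + n)).filter fun x => D.skeleton D.middlePoint K x = none).card :=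
    Finset.card_le_card (Finset.monotone_filter_right _ fun x _ hx => hx K)
  have h4' : (((Finset.Ico a (a + n)).filter (· ∈ D.holes D.middlePoint)).card : ℝ) ≤
      ((Finset.Ico a (a + n)).filter fun x => D.skeleton D.middlePoint K x = none).card :=
    Nat.cast_le.2 h4
  have h5 := mul_le_mul_of_nonneg_left (hKsum (8 * n)) (by positivity : (0 : ℝ) ≤ 9 * n)
  have h6 := mul_le_mul_of_nonneg_left hKd (by positivity : (0 : ℝ) ≤ n)
  have h7 := mul_le_mul_of_nonneg_left (D.d_le_unf_div_per K) (by positivity : (0 : ℝ) ≤ n)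
  rw [ncard_inter_Ico]
  rw [abs_le] at h2 ⊢
  have h8 : (0 : ℝ) ≤ n * ε := by positivity
  constructor <;> nlinarith [h2.1, h2.2]

end Parameters
end OdometerModel

namespace OdometerModel

/-! ### Aperiodic readouts -/

lemma eq_zero_of_tendsto_ncard_div {B : ℕ → Set ℤ} {F : Set ℤ} (hF : F.Finite)
    (hB : ∀ n, B n ⊆ F) {δ : ℝ}
    (h : Tendsto (fun n : ℕ => ((B n).ncard : ℝ) / n) atTop (𝓝 δ)) : δ = 0 := by
  refine tendsto_nhds_unique h ?_
  refine squeeze_zero (fun n => by positivity) (fun n => ?_)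
    (tendsto_const_div_atTop_nhds_zero_nat (F.ncard : ℝ))
  exact div_le_div_of_nonneg_right (Nat.cast_le.2 (Set.ncard_le_ncard (hB n) hF))
    (Nat.cast_nonneg n)

lemma HasDensity.infinite_natCast {A : Set ℤ} {δ : ℝ} (h : HasDensity A δ) (hδ : δ ≠ 0) :
    {k : ℕ | (k : ℤ) ∈ A}.Infinite := by
  intro hfin
  refine hδ (eq_zero_of_tendsto_ncard_div (hfin.image (fun k : ℕ => (k : ℤ))) (fun n => ?_) h.1)
  rintro x ⟨hx, h0, -⟩
  exact ⟨x.toNat, by rwa [Set.mem_ofPred_eq, Int.toNat_of_nonneg h0], Int.toNat_of_nonneg h0⟩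

lemma HasDensity.infinite_negSucc {A : Set ℤ} {δ : ℝ} (h : HasDensity A δ) (hδ : δ ≠ 0) :
    {k : ℕ | Int.negSucc k ∈ A}.Infinite := by
  intro hfin
  refine hδ (eq_zero_of_tendsto_ncard_div (hfin.image Int.negSucc) (fun n => ?_) h.2)
  rintro x ⟨hx, -, h0⟩
  obtain ⟨k, rfl⟩ := Int.eq_negSucc_of_lt_zero h0
  exact ⟨k, hx, rfl⟩

/-- A set of integers that is unbounded in both directions has an increasing enumeration by `ℤ`
in which index `0` belongs to its least nonnegative element. -/
lemma exists_enumeration {A : Set ℤ} (h1 : {k : ℕ | (k : ℤ) ∈ A}.Infinite)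
    (h2 : {k : ℕ | Int.negSucc k ∈ A}.Infinite) :
    ∃ n : ℤ → ℤ, StrictMono n ∧ Set.range n = A ∧ n (-1) < 0 ∧ 0 ≤ n 0 := by
  classical
  let n : ℤ → ℤ := fun
    | Int.ofNat i => (Nat.nth (fun k : ℕ => (k : ℤ) ∈ A) i : ℤ)
    | Int.negSucc i => Int.negSucc (Nat.nth (fun k => Int.negSucc k ∈ A) i)
  refine ⟨n, strictMono_int_of_lt_succ ?_, ?_, Int.negSucc_lt_zero _, Int.natCast_nonneg _⟩
  · rintro (i | _ | i)
    · exact Int.ofNat_lt.2 (Nat.nth_strictMono h1 i.lt_succ_self)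
    · exact (Int.negSucc_lt_zero _).trans_le (Int.natCast_nonneg _)
    · have := Nat.nth_strictMono h2 i.lt_succ_self
      change Int.negSucc _ < Int.negSucc _
      lia
  · ext x
    constructor
    · rintro ⟨i | i, rfl⟩
      · exact Nat.nth_mem_of_infinite h1 i
      · exact Nat.nth_mem_of_infinite h2 i
    · intro hx
      rcases x with x | x
      · obtain ⟨i, hi⟩ : x ∈ Set.range (Nat.nth fun k : ℕ => (k : ℤ) ∈ A) := by
          rw [Nat.range_nth_of_infinite h1]
          exact hx
        exact ⟨Int.ofNat i, congrArg Int.ofNat hi⟩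
      · obtain ⟨i, hi⟩ : x ∈ Set.range (Nat.nth fun k => Int.negSucc k ∈ A) := by
          rw [Nat.range_nth_of_infinite h2]
          exact hx
        exact ⟨Int.negSucc i, congrArg Int.negSucc hi⟩

namespace Parameters

variable (D : Parameters)

theorem sameAperiodicReadouts :
    SameAperiodicReadouts D.subshift D.factor D.d atMostOneOne := by
  refine ⟨⟨D.middlePoint, fun x hx => ?_⟩, fun g hg => Set.Subset.antisymm ?_ fun y hy => ?_⟩
  · rw [aperiodicPart_eq_holes_factor, hx]
    exact D.hasDensity_holes_middlePoint
  · rintro y ⟨x, rfl, n, hn, hr, -, -, hy⟩ i j hi hj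
    rw [aperiodicPart_eq_holes_factor] at hr
    have hmem : ∀ i, n i ∈ D.holes (D.factor x) := fun i => hr ▸ Set.mem_range_self i
    rw [hy] at hi hj
    exact hn.injective ((D.isPointOver_factor x).atMostOne _ (hmem i) _ (hmem j) hi hj)
  · have hd := hg (D.zeroPoint g) (factor_zeroPoint g)
    rw [aperiodicPart_eq_holes_factor, factor_zeroPoint] at hd
    obtain ⟨n, hn, hr, hn1, hn0⟩ := exists_enumeration (hd.infinite_natCast D.d_pos.ne')
      (hd.infinite_negSucc D.d_pos.ne')
    have hmem : ∀ i, n i ∈ D.holes g := fun i => hr ▸ Set.mem_range_self i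
    have hY : ∀ i, Function.extend n y 0 (n i) = y i := fun i => hn.injective.extend_apply y 0 i
    have hpt : D.IsPointOver g (fillHoles g (Function.extend n y 0)) := by
      refine isPointOver_fillHoles g fun a ha b hb ha1 hb1 => ?_
      rw [← hr] at ha hb
      obtain ⟨i, rfl⟩ := ha
      obtain ⟨j, rfl⟩ := hb
      rw [hY] at ha1 hb1
      rw [hy i j ha1 hb1]
    refine ⟨⟨_, hpt.mem_subshift⟩, Extends.factor_eq hpt.ext, n, hn, ?_, hn1, hn0, fun i => ?_⟩
    · rw [hr, hpt.ext.aperiodicPart_eq]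
    · exact ((fillHoles_of_mem (hmem i) _).trans (hY i)).symm

end Parameters
end OdometerModel

namespace OdometerModel

/-! ### Orthogonality to the Möbius function -/

/-- Up to `ε`, a continuous function on a subshift depends on finitely many coordinates only. -/
lemma exists_uniform_window {X : BinarySubshift} {f : X.carrier → ℂ} (hf : Continuous f) {ε : ℝ}
    (hε : 0 < ε) :
    ∃ L : ℕ, ∀ z z' : X.carrier, (∀ m : ℤ, |m| ≤ L → z.1 m = z'.1 m) → ‖f z - f z'‖ ≤ ε := by
  have h1 : ∀ x : X.carrier, ∃ N : ℕ, ∀ y : X.carrier, (∀ m : ℤ, |m| ≤ N → y.1 m = x.1 m) →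
      ‖f y - f x‖ < ε / 2 := fun x => by
    have := hf.continuousAt (Metric.ball_mem_nhds (f x) (half_pos hε))
    obtain ⟨N, hN⟩ := exists_window_of_mem_nhds (mem_map.1 this)
    exact ⟨N, fun y hy => by simpa [dist_eq_norm] using hN y hy⟩
  choose N hN using h1
  obtain ⟨s, -, hs⟩ := isCompact_univ.elim_nhds_subcover
    (fun x : X.carrier => {y : X.carrier | ∀ m ∈ Finset.Icc (-(N x : ℤ)) (N x), y.1 m = x.1 m})
    fun x _ => by
      simp only [Set.ofPred_forall]
      refine (Filter.biInter_finset_mem _).2 fun m _ => ?_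
      have hc : Continuous fun y : X.carrier => y.1 m :=
        (continuous_apply m).comp continuous_subtype_val
      exact ((isOpen_discrete {x.1 m}).preimage hc).mem_nhds rfl
  refine ⟨s.sup N, fun z z' hz => ?_⟩
  obtain ⟨x, hx, hzx⟩ := Set.mem_iUnion₂.1 (hs (Set.mem_univ z))
  have h2 : ∀ m : ℤ, |m| ≤ N x → z.1 m = x.1 m := fun m hm =>
    hzx m (Finset.mem_Icc.2 (abs_le.1 hm))
  have h3 := hN x z h2
  have h4 := hN x z' fun m hm => by
    rw [← h2 m hm, hz m (hm.trans (by exact_mod_cast Finset.le_sup hx))]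
  have h5 := norm_sub_le (f z - f x) (f z' - f x)
  rw [sub_sub_sub_cancel_right] at h5
  linarith

namespace Parameters

section UnfilledOnes

variable {D : Parameters} {g : D.scale.addingMachine} {z : ℤ → Fin 2}

/-- The positions that are unfilled after `k` steps but carry the symbol `1` have upper density at
most `1 / p_k`, since each aligned block of length `p_k` contains at most one of them. -/
lemma IsPointOver.card_filter_le (hz : D.IsPointOver g z) (k : ℕ) (a : ℤ) (n : ℕ) :
    (((Finset.Ico a (a + n)).filter fun m => D.skeleton g k m = none ∧ z m = 1).card : ℝ) ≤
      n / D.per k + 2 := by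
  have h1 : ((Finset.Ico a (a + n)).filter fun m => D.skeleton g k m = none ∧ z m = 1).card ≤
      (Finset.Icc ((D.rep g k + a) / D.per k) ((D.rep g k + (a + n)) / D.per k)).card := by
    refine Finset.card_le_card_of_injOn (fun m => (D.rep g k + m) / D.per k) (fun m hm => ?_)
      fun m hm m' hm' h => ?_
    · rw [Finset.mem_coe, Finset.mem_filter, Finset.mem_Ico] at hm
      rw [Finset.mem_coe, Finset.mem_Icc]
      exact ⟨Int.ediv_le_ediv (D.per_pos' k) (by linarith),
        Int.ediv_le_ediv (D.per_pos' k) (by linarith)⟩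
    · rw [Finset.mem_coe, Finset.mem_filter] at hm hm'
      exact hz.eq_of_ediv_eq h hm.2.1 hm'.2.1 hm.2.2 hm'.2.2
  have hP : (0 : ℝ) < D.per k := Nat.cast_pos.2 (D.per_pos k)
  have h3 : D.rep g k + a ≤ D.rep g k + (a + n) := by lia
  have h4 := Int.ediv_le_ediv (D.per_pos' k) h3
  rw [Int.card_Icc] at h1
  have h5 : (((Finset.Ico a (a + n)).filter fun m => D.skeleton g k m = none ∧ z m = 1).card : ℤ) ≤
      (D.rep g k + (a + n)) / D.per k + 1 - (D.rep g k + a) / D.per k := by lia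
  have h6 : (((Finset.Ico a (a + n)).filter fun m => D.skeleton g k m = none ∧ z m = 1).card : ℝ) ≤
      (((D.rep g k + (a + n)) / D.per k + 1 - (D.rep g k + a) / D.per k : ℤ) : ℝ) := by
    exact_mod_cast h5
  push_cast at h6
  have h7 : (((D.rep g k + (a + n)) / D.per k : ℤ) : ℝ) ≤ (D.rep g k + (a + n)) / D.per k := by
    rw [le_div_iff₀ hP]
    exact_mod_cast Int.ediv_mul_le _ (D.per_pos' k).ne'
  have h8 : ((D.rep g k + a : ℝ)) / D.per k ≤ (((D.rep g k + a) / D.per k : ℤ) : ℝ) + 1 := by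
    rw [div_le_iff₀ hP]
    exact_mod_cast (Int.lt_ediv_add_one_mul_self _ (D.per_pos' k)).le
  have h9 : ((D.rep g k + (a + n) : ℝ)) / D.per k = (D.rep g k + a) / D.per k + n / D.per k := by
    ring
  linarith

open scoped Classical in
/-- A bound for the number of positions `i` in `[1, N]` such that some position within distance `L`
of `i` is unfilled after `k` steps but carries the symbol `1`. -/
lemma IsPointOver.card_bad_le (hz : D.IsPointOver g z) (k L N : ℕ) :
    (((Finset.Icc 1 N).filter fun i : ℕ =>
      ∃ m : ℤ, |m| ≤ L ∧ D.skeleton g k (i + m) = none ∧ z (i + m) = 1).card : ℝ) ≤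
      (2 * L + 1) * (N / D.per k + 2) := by
  set B : ℤ → Finset ℤ := fun m =>
    (Finset.Ico (1 + m) (1 + m + N)).filter fun x => D.skeleton g k x = none ∧ z x = 1 with hB
  have h1 : ((Finset.Icc 1 N).filter fun i : ℕ =>
      ∃ m : ℤ, |m| ≤ L ∧ D.skeleton g k (i + m) = none ∧ z (i + m) = 1) ⊆
      (Finset.Icc (-L : ℤ) L).biUnion fun m => (B m).image fun x => (x - m).toNat := by
    intro i hi
    rw [Finset.mem_filter, Finset.mem_Icc] at hi
    obtain ⟨⟨hi1, hi2⟩, m, hm, h0, h1⟩ := hi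
    refine Finset.mem_biUnion.2 ⟨m, Finset.mem_Icc.2 (abs_le.1 hm), Finset.mem_image.2
      ⟨i + m, Finset.mem_filter.2 ⟨Finset.mem_Ico.2 ⟨by lia, by lia⟩, h0, h1⟩, by simp⟩⟩
  have h2 := (Finset.card_le_card h1).trans Finset.card_biUnion_le
  have h3 : ∀ m ∈ Finset.Icc (-L : ℤ) L,
      (((B m).image fun x => (x - m).toNat).card : ℝ) ≤ N / D.per k + 2 := fun m _ =>
    (Nat.cast_le.2 Finset.card_image_le).trans (hz.card_filter_le k (1 + m) N)
  calc _ ≤ ∑ m ∈ Finset.Icc (-L : ℤ) L, (((B m).image fun x => (x - m).toNat).card : ℝ) := by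
        exact_mod_cast h2
    _ ≤ ∑ _m ∈ Finset.Icc (-L : ℤ) L, ((N : ℝ) / D.per k + 2) := Finset.sum_le_sum h3
    _ = _ := by
        rw [Finset.sum_const, Int.card_Icc, nsmul_eq_mul,
          show ((L : ℤ) + 1 - -L).toNat = 2 * L + 1 by lia]
        push_cast
        ring

end UnfilledOnes

/-- Off a set of small density, the sequence of values of a continuous function along an orbit is
nearly periodic: its value at a position is determined, up to `ε`, by the positions filled after
`k` steps as soon as the remaining positions nearby carry the symbol `0`. -/
theorem sarnakConjectureHolds (D : Parameters) : SarnakConjectureHolds (shiftHomeo D.subshift) := by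
  classical
  intro f hf x
  have hiter : ∀ i : ℕ, ∀ m : ℤ, ((shiftHomeo D.subshift)^[i] x).1 m = x.1 (i + m) := fun i m => by
    have : (shiftHomeo D.subshift)^[i] x = (shiftHomeo D.subshift ^ (i : ℤ)) x := by
      induction i with
      | zero => simp
      | succ i ih =>
        rw [Function.iterate_succ_apply', ih, Nat.cast_succ, add_comm (i : ℤ), zpow_add, zpow_one,
          Homeomorph.mul_apply]
    rw [this, shiftHomeo_zpow_apply, SymbolicDynamics.FullShift.shift_apply]
  have horth : MoebiusCorrelation.MoebiusOrthogonal fun n => f ((shiftHomeo D.subshift)^[n] x) := by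
    refine MoebiusCorrelation.moebiusOrthogonal_of_approx fun ε hε => ?_
    obtain ⟨C, hC⟩ := isCompact_univ.exists_bound_of_continuousOn hf.continuousOn
    have hC0 : 0 ≤ C := (norm_nonneg _).trans (hC x (Set.mem_univ _))
    obtain ⟨L, hL⟩ := exists_uniform_window hf (half_pos hε)
    have hz := D.isPointOver_factor x
    -- a level at which the exceptional positions contribute less than `ε / 4` to the mean
    obtain ⟨k, hk⟩ := exists_nat_gt (2 * C * (2 * L + 1) / (ε / 4))
    have hP : (0 : ℝ) < D.per k := Nat.cast_pos.2 (D.per_pos k)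
    have hkP : 2 * C * (2 * L + 1) / D.per k ≤ ε / 4 := by
      rw [div_lt_iff₀ (by positivity)] at hk
      rw [div_le_iff₀ hP]
      have : (k : ℝ) ≤ D.per k := Nat.cast_le.2 (D.lt_per k).le
      nlinarith
    let bad : ℕ → Prop := fun i => ∃ m : ℤ, |m| ≤ L ∧
      D.skeleton (D.factor x) k (i + m) = none ∧ x.1 (i + m) = 1
    have hne : NeZero (D.per k) := ⟨(D.per_pos k).ne'⟩
    let v : ZMod (D.per k) → ℂ := fun c =>
      if h : ∃ i : ℕ, (i : ZMod (D.per k)) = c ∧ ¬ bad i then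
        f ((shiftHomeo D.subshift)^[h.choose] x) else 0
    have hv : ∀ c, ‖v c‖ ≤ C := fun c => by
      simp only [v]
      split_ifs
      · exact hC _ (Set.mem_univ _)
      · simpa using hC0
    have hgood : ∀ i : ℕ, ¬ bad i → ‖f ((shiftHomeo D.subshift)^[i] x) - v i‖ ≤ ε / 2 := by
      intro i hi
      have h : ∃ j : ℕ, (j : ZMod (D.per k)) = i ∧ ¬ bad j := ⟨i, rfl, hi⟩
      simp only [v, dif_pos h]
      obtain ⟨h1, h2⟩ := h.choose_spec
      set j := h.choose
      refine hL _ _ fun m hm => ?_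
      rw [hiter, hiter]
      have h3 : D.skeleton (D.factor x) k (i + m) = D.skeleton (D.factor x) k (j + m) := by
        refine skeleton_congr (Int.ModEq.add_right m ?_)
        exact Int.natCast_modEq_iff.2 ((ZMod.natCast_eq_natCast_iff _ _ _).1 h1.symm)
      rcases h4 : D.skeleton (D.factor x) k (i + m) with _ | w
      · have h5 : x.1 (i + m) ≠ 1 := fun h5 => hi ⟨m, hm, h4, h5⟩
        have h6 : x.1 (j + m) ≠ 1 := fun h6 => h2 ⟨m, hm, h3 ▸ h4, h6⟩
        lia
      · rw [hz.ext _ _ _ h4, hz.ext _ _ _ (h3 ▸ h4)]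
    obtain ⟨M, hM⟩ := exists_nat_ge (2 * C * (2 * L + 1) * 2 / (ε / 4))
    rw [div_le_iff₀ (by positivity)] at hM
    refine ⟨D.per k, hne, v, eventually_atTop.2 ⟨M, fun N hN => ?_⟩⟩
    have hpt : ∀ i ∈ Finset.Icc 1 N, ‖f ((shiftHomeo D.subshift)^[i] x) - v i‖ ≤
        ε / 2 + if bad i then 2 * C else 0 := by
      intro i _
      split_ifs with h
      · have := (norm_sub_le (f ((shiftHomeo D.subshift)^[i] x)) (v i)).trans
          (add_le_add (hC _ (Set.mem_univ _)) (hv i))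
        linarith
      · simpa using hgood i h
    have hbad := mul_le_mul_of_nonneg_left (hz.card_bad_le k L N) (by positivity : 0 ≤ 2 * C)
    refine (Finset.sum_le_sum hpt).trans ?_
    rw [Finset.sum_add_distrib, Finset.sum_const, Nat.card_Icc, Nat.add_sub_cancel, nsmul_eq_mul,
      ← Finset.sum_filter, Finset.sum_const, nsmul_eq_mul]
    have h7 : 2 * C * ((2 * L + 1) * (N / D.per k + 2)) =
        (2 * C * (2 * L + 1) / D.per k) * N + 2 * C * (2 * L + 1) * 2 := by ring
    have h8 := mul_le_mul_of_nonneg_right hkP (Nat.cast_nonneg (α := ℝ) N)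
    have h9 := mul_le_mul_of_nonneg_right (Nat.cast_le (α := ℝ).2 hN) (by positivity : 0 ≤ ε / 4)
    rw [h7] at hbad
    linarith
  simpa [Uncorrelated, MoebiusCorrelation.MoebiusOrthogonal] using horth

end Parameters
end OdometerModel

namespace OdometerModel

/-! ### Existence of admissible parameters -/

lemma prod_range_one_sub_inv_sq (N : ℕ) :
    ∏ k ∈ Finset.range N, (1 - ((1 : ℕ) : ℝ) / ((k + 2) ^ 2 : ℕ)) = 1 / 2 + 1 / (2 * (N + 1)) := by
  induction N with
  | zero => norm_num
  | succ N ih =>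
    rw [Finset.prod_range_succ, ih]
    push_cast
    field_simp
    ring

lemma infinite_setOf_unpair_fst_eq (k c : ℕ) : {j | k ≤ j ∧ j.unpair.1 = c}.Infinite := by
  refine Set.infinite_of_injective_forall_mem (f := fun i => Nat.pair c (k + i)) (fun i j h => ?_)
    fun i => ⟨(Nat.le_add_right k i).trans (Nat.right_le_pair _ _), by simp⟩
  have := (Nat.pair_eq_pair.1 h).2
  lia

/-- Admissible parameters exist: the product `∏ (1 - 1 / (k + 2) ^ 2)` converges to `1 / 2`, and the
first component of the inverse of a pairing function takes every value infinitely often. -/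
theorem nonempty_parameters : Nonempty Parameters := by
  have hpos : ∀ k, 0 < unfilled (fun k => (k + 2) ^ 2) (fun _ => 1) k := fun k =>
    Finset.prod_pos fun i _ => Nat.sub_pos_of_lt (Nat.one_lt_pow two_ne_zero (by lia))
  exact ⟨{
    q := fun k => (k + 2) ^ 2
    r := fun _ => 1
    s := fun k => k.unpair.1 % unfilled (fun k => (k + 2) ^ 2) (fun _ => 1) k
    d := 1 / 2
    r_pos := fun _ => one_pos
    r_lt := fun k => Nat.one_lt_pow two_ne_zero (by lia)
    s_lt := fun k => by
      rw [one_mul]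
      exact Nat.mod_lt _ (hpos k)
    d_pos := by norm_num
    tendsto_d := by
      simp_rw [prod_range_one_sub_inv_sq]
      have h := (tendsto_one_div_add_atTop_nhds_zero_nat (𝕜 := ℝ)).const_mul (1 / 2)
      have h' := h.const_add (1 / 2)
      simp only [mul_zero, add_zero] at h'
      refine h'.congr fun N => ?_
      field_simp
    recurrent := fun k c hc => by
      refine (infinite_setOf_unpair_fst_eq k c).mono ?_
      rintro j ⟨hkj, rfl⟩
      refine ⟨hkj, ?_⟩
      have hdvd : unfilled (fun k => (k + 2) ^ 2) (fun _ => 1) k ∣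
          unfilled (fun k => (k + 2) ^ 2) (fun _ => 1) j :=
        Finset.prod_dvd_prod_of_subset _ _ _ (Finset.range_subset_range.2 hkj)
      rw [Nat.mod_mod_of_dvd _ hdvd, Nat.mod_eq_of_lt hc] }⟩

end OdometerModel

open OdometerModel
theorem mainTheorem3 :
    Nonempty Parameters ∧
    (∀ D : Parameters,
      IsToeplitzSubshift D.subshift ∧
      IsStrictlyErgodic (shiftHomeo D.subshift) ∧
      (∃ π : D.subshift.carrier → D.scale.addingMachine,
        IsMaximalEquicontinuousFactor.{u} (shiftHomeo D.subshift) D.scale.odometer π ∧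
        IsAlmostOneToOne π ∧
        ¬ IsRegularExtension D.scale π ∧
        (∀ μ : Measure D.subshift.carrier, IsInvariantProbability (shiftHomeo D.subshift) μ →
          IsMeasureIsomorphism μ D.scale.haar π) ∧
        HasIrregularity D.subshift D.scale D.d ∧
        SameAperiodicReadouts D.subshift π D.d atMostOneOne) ∧
      SarnakConjectureHolds (shiftHomeo D.subshift)) ∧
    (∀ ν : Measure (ℤ → Fin 2), IsProbabilityMeasure ν →
      ((MeasurePreserving (SymbolicDynamics.FullShift.shift (1 : ℤ)) ν ν ∧ ν atMostOneOneᶜ = 0) ↔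
        ν = Measure.dirac 0)) := by
  refine ⟨nonempty_parameters, fun D => ⟨D.isToeplitzSubshift,
    ⟨D.isMinimalSystem, D.isUniquelyErgodic⟩, ⟨D.factor, D.isMaximalEquicontinuousFactor,
      D.isAlmostOneToOne_factor, D.not_isRegularExtension,
      fun μ hμ => D.isMeasureIsomorphism_factor hμ, D.hasIrregularity, D.sameAperiodicReadouts⟩,
    D.sarnakConjectureHolds⟩, measurePreserving_shift_and_iff⟩
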